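/- For two $n$-point multisets $P,Q\subseteq\mathbb{R}^2$, a matrix $A\in\mathbb{R}^{\lambda\times 2}$ and a vector $b\in\mathbb{R}^{\lambda}$, let $(P\oplus Q)_{Ar\ge b}$ be the multiset of all sums $p+q$ with $p\in P$, $q\in Q$ and $A(p+q)\ge b$. The Minkowski Sum Selection problem with $\lambda$ linear constraints and a linear objective function asks, given $P$, $Q$, $A$, $b$, coefficients $d,e\in\mathbb{R}$ and a positive integer $k\le|(P\oplus Q)_{Ar\ge b}|$, for the $k$-th largest value, counted with multiplicity, of $f(x,y)=dx+ey$ on the points of $(P\oplus Q)_{Ar\ge b}$. Running times are worst-case numbers of steps on a real RAM (unit-cost arithmetic and comparisons on reals, indirect addressing through natural-number cells, cells outside the input uninitialised), as functions of $n$ (and $\lambda$). 1. There are a single real RAM program, which takes $\lambda$ as part of its input, and an absolute constant $C$ such that for all $\lambda>2$ and all $n$ the program transforms every such instance with $\lambda$ constraints, in at most $C(\lambda n\log n+\lambda\log\lambda)$ steps, into one such instance with two constraints, with the same $P$, $Q$ and objective function and with the same solution. 2. There is an absolute constant $C$ such that, for every function $T_2$, if some program solves the two-constraint problem in time $T_2(n)$,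 then some program solves, for all $\lambda>2$, the problem with $\lambda$ constraints in time at most $C(\lambda n\log n+\lambda\log\lambda+T_2(n))$. 3. Conversely, for each fixed $\lambda>2$ there is a constant $C$ such that, if some program solves the problem with $\lambda$ constraints in time $T(n)$, then some program solves the two-constraint problem in time $T(n)+C$. 4. Consequently, for each fixed $\lambda>2$, the two problems are asymptotically equivalent: for every function $T$ with $n\log n=O(T(n))$, the two-constraint problem can be solved in time $O(T(n))$ if and only if the problem with $\lambda$ constraints can be solved in time $O(T(n))$. -/

import Mathlib

/-! ## The selection problem on constrained Minkowski sums -/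

/-- The constrained Minkowski sum `(P ⊕ Q)_{A r ≥ b}`: the multiset of all sums `p + q` with
`A (p + q) ≥ b`. The pairs `(p, q)` are counted with multiplicity. -/
noncomputable def constrainedMinkowskiSum {lam : ℕ} (P Q : Multiset (Fin 2 → ℝ))
    (A : Matrix (Fin lam) (Fin 2) ℝ) (b : Fin lam → ℝ) : Multiset (Fin 2 → ℝ) :=
  open Classical in
  ((P ×ˢ Q).map (fun pq => pq.1 + pq.2)).filter (fun r => b ≤ A.mulVec r)

/-- `v` is the `k`-th largest element of the multiset `M`: the entry number `k` (counted from one)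
of the list of the elements of `M`, with multiplicity, in nonincreasing order. -/
def IsKthLargest (M : Multiset ℝ) (k : ℕ) (v : ℝ) : Prop :=
  1 ≤ k ∧ (M.sort (· ≥ ·))[k - 1]? = some v

/-- An instance of the selection problem with `lam` linear constraints `A r ≥ b`, the linear
objective function `r ↦ f 0 * r 0 + f 1 * r 1` and the rank `k`. The two `n`-point multisets are
listed, in any order and with any repetitions, by `P` and `Q`. -/
structure SelInstance (lam n : ℕ) where
  P : Fin n → Fin 2 → ℝ
  Q : Fin n → Fin 2 → ℝ
  A : Matrix (Fin lam) (Fin 2) ℝ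
  b : Fin lam → ℝ
  f : Fin 2 → ℝ
  k : ℕ

/-- The multiset of the objective values of the points of the constrained Minkowski sum. -/
noncomputable def SelInstance.values {lam n : ℕ} (I : SelInstance lam n) : Multiset ℝ :=
  (constrainedMinkowskiSum (Finset.univ.val.map I.P) (Finset.univ.val.map I.Q) I.A I.b).map
    (fun r => I.f 0 * r 0 + I.f 1 * r 1)

/-- `v` is the solution of the instance: the `k`-th largest objective value. -/
def SelInstance.IsAnswer {lam n : ℕ} (I : SelInstance lam n) (v : ℝ) : Prop :=
  IsKthLargest I.values I.k v

/-- The instance has a solution: `1 ≤ k`, and there are at least `k` feasible points. -/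
def SelInstance.Valid {lam n : ℕ} (I : SelInstance lam n) : Prop :=
  1 ≤ I.k ∧ I.k ≤ Multiset.card I.values

/-! ## The real RAM

A machine with random access memory for natural numbers (indices and counters) and for real
numbers. The memory is divided into arrays with fixed names `0, 1, 2, …`, of which a program can
mention only finitely many; the entries of an array are addressed by computed natural numbers.
Every elementary operation (reading a constant, a memory access, an arithmetic operation, a
comparison, a Boolean operation, a store) takes one unit of time. Reals can be added, subtracted,
multiplied, divided and compared; there is no rounding of reals. Naturals can be added, subtracted,
halved and compared. -/

/-- The contents of the memory: `nat a i` and `real a i` are the entries number `i` of the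
`a`-th array of naturals and of the `a`-th array of reals. -/
structure RamState where
  nat : ℕ → ℕ → ℕ
  real : ℕ → ℕ → ℝ

/-- Expressions with values in the naturals. Subtraction is truncated, `half` rounds down. -/
inductive NatExpr where
  | const (m : ℕ)
  | get (a : ℕ) (i : NatExpr)
  | add (e₁ e₂ : NatExpr)
  | sub (e₁ e₂ : NatExpr)
  | half (e : NatExpr)

/-- Expressions with values in the reals. The constants are rational; `x / 0` is `0`. -/
inductive RealExpr where
  | const (q : ℚ)
  | get (a : ℕ) (i : NatExpr)
  | add (e₁ e₂ : RealExpr)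
  | sub (e₁ e₂ : RealExpr)
  | mul (e₁ e₂ : RealExpr)
  | div (e₁ e₂ : RealExpr)

/-- Conditions. -/
inductive BoolExpr where
  | natLt (e₁ e₂ : NatExpr)
  | realLt (e₁ e₂ : RealExpr)
  | not (c : BoolExpr)
  | and (c₁ c₂ : BoolExpr)

/-- Programs. -/
inductive RamProgram where
  | skip
  | setNat (a : ℕ) (i e : NatExpr)
  | setReal (a : ℕ) (i : NatExpr) (e : RealExpr)
  | seq (p₁ p₂ : RamProgram)
  | ite (c : BoolExpr) (p₁ p₂ : RamProgram)
  | while (c : BoolExpr) (p : RamProgram)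

def NatExpr.eval (s : RamState) : NatExpr → ℕ
  | .const m => m
  | .get a i => s.nat a (i.eval s)
  | .add e₁ e₂ => e₁.eval s + e₂.eval s
  | .sub e₁ e₂ => e₁.eval s - e₂.eval s
  | .half e => e.eval s / 2

noncomputable def RealExpr.eval (s : RamState) : RealExpr → ℝ
  | .const q => (q : ℝ)
  | .get a i => s.real a (i.eval s)
  | .add e₁ e₂ => e₁.eval s + e₂.eval s
  | .sub e₁ e₂ => e₁.eval s - e₂.eval s
  | .mul e₁ e₂ => e₁.eval s * e₂.eval s
  | .div e₁ e₂ => e₁.eval s / e₂.eval s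

def BoolExpr.eval (s : RamState) : BoolExpr → Prop
  | .natLt e₁ e₂ => e₁.eval s < e₂.eval s
  | .realLt e₁ e₂ => e₁.eval s < e₂.eval s
  | .not c => ¬ c.eval s
  | .and c₁ c₂ => c₁.eval s ∧ c₂.eval s

/-- The number of elementary operations in the evaluation of an expression. -/
def NatExpr.cost : NatExpr → ℕ
  | .const _ => 1
  | .get _ i => i.cost + 1
  | .add e₁ e₂ => e₁.cost + e₂.cost + 1
  | .sub e₁ e₂ => e₁.cost + e₂.cost + 1
  | .half e => e.cost + 1

/-- The number of elementary operations in the evaluation of an expression. -/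
def RealExpr.cost : RealExpr → ℕ
  | .const _ => 1
  | .get _ i => i.cost + 1
  | .add e₁ e₂ => e₁.cost + e₂.cost + 1
  | .sub e₁ e₂ => e₁.cost + e₂.cost + 1
  | .mul e₁ e₂ => e₁.cost + e₂.cost + 1
  | .div e₁ e₂ => e₁.cost + e₂.cost + 1

/-- The number of elementary operations in the evaluation of an expression. -/
def BoolExpr.cost : BoolExpr → ℕ
  | .natLt e₁ e₂ => e₁.cost + e₂.cost + 1
  | .realLt e₁ e₂ => e₁.cost + e₂.cost + 1
  | .not c => c.cost + 1
  | .and c₁ c₂ => c₁.cost + c₂.cost + 1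

def RamState.updateNat (s : RamState) (a i v : ℕ) : RamState :=
  { s with nat := Function.update s.nat a (Function.update (s.nat a) i v) }

noncomputable def RamState.updateReal (s : RamState) (a i : ℕ) (v : ℝ) : RamState :=
  { s with real := Function.update s.real a (Function.update (s.real a) i v) }

/-- `Exec p s t s'`: started in the state `s`, the program `p` halts after exactly `t` steps, in
the state `s'`. -/
inductive Exec : RamProgram → RamState → ℕ → RamState → Prop where
  | skip (s : RamState) : Exec .skip s 1 s
  | setNat (a : ℕ) (i e : NatExpr) (s : RamState) :
      Exec (.setNat a i e) s (i.cost + e.cost + 1) (s.updateNat a (i.eval s) (e.eval s))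
  | setReal (a : ℕ) (i : NatExpr) (e : RealExpr) (s : RamState) :
      Exec (.setReal a i e) s (i.cost + e.cost + 1) (s.updateReal a (i.eval s) (e.eval s))
  | seq {p₁ p₂ : RamProgram} {s s' s'' : RamState} {t₁ t₂ : ℕ}
      (h₁ : Exec p₁ s t₁ s') (h₂ : Exec p₂ s' t₂ s'') : Exec (.seq p₁ p₂) s (t₁ + t₂) s''
  | iteTrue {c : BoolExpr} {p₁ p₂ : RamProgram} {s s' : RamState} {t : ℕ}
      (hc : c.eval s) (h : Exec p₁ s t s') : Exec (.ite c p₁ p₂) s (c.cost + t) s'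
  | iteFalse {c : BoolExpr} {p₁ p₂ : RamProgram} {s s' : RamState} {t : ℕ}
      (hc : ¬ c.eval s) (h : Exec p₂ s t s') : Exec (.ite c p₁ p₂) s (c.cost + t) s'
  | whileTrue {c : BoolExpr} {p : RamProgram} {s s' s'' : RamState} {t₁ t₂ : ℕ}
      (hc : c.eval s) (h₁ : Exec p s t₁ s') (h₂ : Exec (.while c p) s' t₂ s'') :
      Exec (.while c p) s (c.cost + t₁ + t₂) s''
  | whileFalse {c : BoolExpr} {p : RamProgram} {s : RamState} (hc : ¬ c.eval s) :
      Exec (.while c p) s c.cost s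

/-! ## Solving the problem on the machine -/

/-- The memory holds the instance `I`: the numbers `lam`, `n`, `k` stand in the natural array `0`,
the coordinates of `P` in the real arrays `0`, `1`, those of `Q` in `2`, `3`, the columns of `A` in
`4`, `5`, the vector `b` in `6`, and the coefficients of the objective function in `7`. Nothing is
required of the other memory cells. -/
structure Encodes {lam n : ℕ} (s : RamState) (I : SelInstance lam n) : Prop where
  lam_eq : s.nat 0 0 = lam
  n_eq : s.nat 0 1 = n
  k_eq : s.nat 0 2 = I.k
  P_eq : ∀ (i : Fin n) (j : Fin 2), s.real j i = I.P i j
  Q_eq : ∀ (i : Fin n) (j : Fin 2), s.real (2 + j) i = I.Q i j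
  A_eq : ∀ (i : Fin lam) (j : Fin 2), s.real (4 + j) i = I.A i j
  b_eq : ∀ i : Fin lam, s.real 6 i = I.b i
  f_eq : ∀ j : Fin 2, s.real 7 j = I.f j

/-- The program `p` solves the selection problem with `lam` constraints and a linear objective
function in (worst case) time `T`: on each instance with `n`-point multisets that has a solution,
it halts after at most `T n` steps, with the solution in entry `0` of the real array `8`. -/
def SolvesSelection (p : RamProgram) (lam : ℕ) (T : ℕ → ℝ) : Prop :=
  ∀ (n : ℕ) (I : SelInstance lam n) (s : RamState), I.Valid → Encodes s I →
    ∃ (t : ℕ) (s' : RamState), Exec p s t s' ∧ (t : ℝ) ≤ T n ∧ I.IsAnswer (s'.real 8 0)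

/-- The selection problem with `lam` constraints and a linear objective function can be solved in
time `O(T(n))`. -/
def SelectionSolvableIn (lam : ℕ) (T : ℕ → ℝ) : Prop :=
  ∃ (p : RamProgram) (τ : ℕ → ℝ), SolvesSelection p lam τ ∧ τ =O[Filter.atTop] T

/-! Assume first that the gradient `f` is nonzero. In the orthogonal coordinates `y = f₀ r₀ + f₁ r₁`
(the objective value) and `x = f₀ r₁ - f₁ r₀`, every constraint is of one of three kinds: a bound `m
y + c ≤ x`, a bound `m y + c ≤ -x`, or a condition on `y` alone (`norm_mul_form` and the lemmas
after it). The bounds of the first kind are together equivalent to their upper envelope, and so are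
those of the second kind. Upper bounds on `y` are merged into one number; conditions on `y` that
persist upwards can be dropped, because only points at least as high as a feasible one matter.

The breakpoints of the two envelopes cut the plane into `O(lam)` slabs `lo < y ≤ hi`, and inside a
slab feasibility depends on only two constraints `i` and `j`. Walking down from the top and counting
the feasible sums slab by slab leads to the slab that contains the solution
(`WalkProgram.runs_walk`). There the instance with the constraints `i` and `j` has the same solution
once the rank is corrected: the feasible sums above `hi` are subtracted from `k`, and the sums above
`hi` that satisfy `i` and `j` are added (`ReduceProgram.Prepared.isAnswer`).

It remains to count the sums in a slab in time `O(n log n)`, without listing all `n²` of them. The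
count is the difference of two counts of sums that satisfy `i` and `j` and lie above a height. Such
a count involves three half-planes, but the affine function `(m_i + m_j) y + (c_i + c_j)` controls
where both constraints can hold, or both can fail, and inclusion-exclusion then leaves only
intersections of at most two half-planes (`WedgeProgram.runs_wedge`). For two half-planes, the
condition `u (p + q) < c` compares a key of `p` with a key of `q`, so the pairs to be counted are
those that two linear orders on the `2n` points arrange oppositely: inversions, which merge sort
counts (`crossInversions_eq_card`, `SortProgram.runs_sort`).

Sorting the slopes costs `O(lam log lam)`, the envelopes are linear after that
(`EnvelopeProgram.runs_envelope`), and the walk costs `O(lam n log n)`. A constant objective is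
trivial. The converse direction pads with constraints `0 ≥ 0` (`padding_step`).

Programs are verified with a small Hoare logic with time bounds. Code without loops is evaluated
symbolically, loops use an invariant with a ghost state, and the arrays that a program leaves alone
are read off its text. -/

/-! ## Program logic for the real RAM -/

/-- Started in `s`, the program halts within `T` steps in a state that satisfies `Q`. -/
def RamProgram.Runs (p : RamProgram) (s : RamState) (T : ℕ) (Q : RamState → Prop) : Prop :=
  ∃ t s', Exec p s t s' ∧ t ≤ T ∧ Q s'

theorem RamProgram.Runs.mono {p : RamProgram} {s : RamState} {T T' : ℕ} {Q Q' : RamState → Prop}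
    (h : p.Runs s T Q) (hT : T ≤ T') (hQ : ∀ s', Q s' → Q' s') : p.Runs s T' Q' := by
  obtain ⟨t, s', he, ht, hq⟩ := h
  exact ⟨t, s', he, ht.trans hT, hQ _ hq⟩

theorem RamProgram.Runs.seq {p q : RamProgram} {s : RamState} {T₁ T₂ : ℕ}
    {Q R : RamState → Prop} (h₁ : p.Runs s T₁ Q) (h₂ : ∀ s', Q s' → q.Runs s' T₂ R) :
    (RamProgram.seq p q).Runs s (T₁ + T₂) R := by
  obtain ⟨t, s', he, ht, hq⟩ := h₁
  obtain ⟨t', s'', he', ht', hr⟩ := h₂ _ hq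
  exact ⟨t + t', s'', .seq he he', by omega, hr⟩

theorem RamProgram.Runs.ite {p q : RamProgram} {c : BoolExpr} {s : RamState} {T : ℕ}
    {Q : RamState → Prop} (h₁ : c.eval s → p.Runs s T Q) (h₂ : ¬ c.eval s → q.Runs s T Q) :
    (RamProgram.ite c p q).Runs s (c.cost + T) Q := by
  by_cases hc : c.eval s
  · obtain ⟨t, s', he, ht, hq⟩ := h₁ hc
    exact ⟨_, s', .iteTrue hc he, by omega, hq⟩
  · obtain ⟨t, s', he, ht, hq⟩ := h₂ hc
    exact ⟨_, s', .iteFalse hc he, by omega, hq⟩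

/-- The loop rule, with a ghost state `g` that carries the invariant and the potential. -/
theorem RamProgram.exec_while {σ : Type*} {c : BoolExpr} {p : RamProgram}
    (I : σ → RamState → Prop) (Φ : σ → ℕ)
    (step : ∀ g s, I g s → c.eval s →
      ∃ t s' g', Exec p s t s' ∧ I g' s' ∧ t + c.cost + Φ g' ≤ Φ g) (g : σ) (s : RamState)
    (h : I g s) :
    ∃ t s' g', Exec (.while c p) s t s' ∧ I g' s' ∧ ¬ c.eval s' ∧ t + Φ g' ≤ Φ g + c.cost := by
  induction hn : Φ g using Nat.strong_induction_on generalizing g s with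
  | _ n ih =>
    by_cases hc : c.eval s
    · obtain ⟨t, s', g', he, hi, ht⟩ := step g s h hc
      -- Evaluating the condition takes at least one step, so the inequality for the potential
      -- already forces `Φ` to decrease strictly; this gives termination.
      have hpos : 0 < c.cost := by cases c <;> simp [BoolExpr.cost]
      obtain ⟨t', s'', g'', he', hi', hc', ht'⟩ := ih (Φ g') (by omega) g' s' hi rfl
      exact ⟨_, s'', g'', .whileTrue hc he he', hi', hc', by omega⟩
    · exact ⟨_, s, g, .whileFalse hc, h, hc, by omega⟩

/-- The loop rule for bodies with a uniform time bound, with a ghost state `g` that carries the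
invariant and a bound on the number of the remaining iterations. -/
theorem RamProgram.runs_while {σ : Type*} {c : BoolExpr} {p : RamProgram}
    (I : σ → RamState → Prop) (Φ : σ → ℕ) (w : ℕ)
    (step : ∀ g s, I g s → c.eval s →
      p.Runs s w (fun s' => ∃ g', I g' s' ∧ Φ g' < Φ g)) (g : σ) (s : RamState) (h : I g s) :
    (RamProgram.while c p).Runs s ((Φ g + 1) * (w + c.cost))
      (fun s' => ∃ g', I g' s' ∧ ¬ c.eval s') := by
  have step' : ∀ g s, I g s → c.eval s → ∃ t s' g', Exec p s t s' ∧ I g' s' ∧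
      t + c.cost + Φ g' * (w + c.cost) ≤ Φ g * (w + c.cost) := by
    intro g s hI hc
    obtain ⟨t, s', he, ht, g', hg', hlt⟩ := step g s hI hc
    refine ⟨t, s', g', he, hg', ?_⟩
    calc t + c.cost + Φ g' * (w + c.cost) ≤ w + c.cost + Φ g' * (w + c.cost) := by omega
      _ = (Φ g' + 1) * (w + c.cost) := by ring
      _ ≤ _ := Nat.mul_le_mul_right _ hlt
  obtain ⟨t, s', g', he, hI, hc, ht⟩ := RamProgram.exec_while I _ step' g s h
  exact ⟨t, s', he, by rw [add_mul]; omega, g', hI, hc⟩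

/-- The program has no loops. -/
def RamProgram.straight : RamProgram → Bool
  | .skip => true
  | .setNat _ _ _ => true
  | .setReal _ _ _ => true
  | .seq p q => p.straight && q.straight
  | .ite _ p q => p.straight && q.straight
  | .while _ _ => false

open Classical in
/-- The final state of a program without loops. -/
noncomputable def RamProgram.step : RamProgram → RamState → RamState
  | .skip, s => s
  | .setNat a i e, s => s.updateNat a (i.eval s) (e.eval s)
  | .setReal a i e, s => s.updateReal a (i.eval s) (e.eval s)
  | .seq p q, s => q.step (p.step s)
  | .ite c p q, s => if c.eval s then p.step s else q.step s
  | .while _ _, s => s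

/-- A bound on the number of steps of a program without loops. -/
def RamProgram.maxCost : RamProgram → ℕ
  | .skip => 1
  | .setNat _ i e => i.cost + e.cost + 1
  | .setReal _ i e => i.cost + e.cost + 1
  | .seq p q => p.maxCost + q.maxCost
  | .ite c p q => c.cost + (p.maxCost + q.maxCost)
  | .while _ _ => 0

theorem RamProgram.runs_step (p : RamProgram) (hp : p.straight = true) (s : RamState) :
    p.Runs s p.maxCost (fun s' => s' = p.step s) := by
  induction p generalizing s with
  | skip => exact ⟨1, s, .skip s, le_rfl, rfl⟩
  | setNat a i e => exact ⟨_, _, .setNat a i e s, le_rfl, rfl⟩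
  | setReal a i e => exact ⟨_, _, .setReal a i e s, le_rfl, rfl⟩
  | seq p q ihp ihq =>
    simp only [straight, Bool.and_eq_true] at hp
    exact (ihp hp.1 s).seq (fun s' h => by subst h; exact ihq hp.2 _)
  | ite c p q ihp ihq =>
    simp only [straight, Bool.and_eq_true] at hp
    refine RamProgram.Runs.ite (fun hc => ?_) (fun hc => ?_)
    · exact (ihp hp.1 s).mono (by omega) (fun s' h => by simp [step, hc, h])
    · exact (ihq hp.2 s).mono (by omega) (fun s' h => by simp [step, hc, h])
  | _ => simp [straight] at hp

theorem RamProgram.runs_of_step {p : RamProgram} (hp : p.straight = true) {s : RamState}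
    {Q : RamState → Prop} (h : Q (p.step s)) : p.Runs s p.maxCost Q :=
  (p.runs_step hp s).mono le_rfl (fun _ hs => hs ▸ h)

/-- The program contains an assignment to the `a`-th array of naturals. -/
def RamProgram.writesNat (a : ℕ) : RamProgram → Bool
  | .skip => false
  | .setNat b _ _ => a == b
  | .setReal _ _ _ => false
  | .seq p q => p.writesNat a || q.writesNat a
  | .ite _ p q => p.writesNat a || q.writesNat a
  | .while _ p => p.writesNat a

/-- The program contains an assignment to the `a`-th array of reals. -/
def RamProgram.writesReal (a : ℕ) : RamProgram → Bool
  | .skip => false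
  | .setNat _ _ _ => false
  | .setReal b _ _ => a == b
  | .seq p q => p.writesReal a || q.writesReal a
  | .ite _ p q => p.writesReal a || q.writesReal a
  | .while _ p => p.writesReal a

/-- The frame rule. The syntactic test `writesNat` can be evaluated, so the survival of an array
through a whole subprogram usually reduces to `rfl` below. -/
theorem Exec.nat_eq {p : RamProgram} {s s' : RamState} {t : ℕ} (h : Exec p s t s') {a : ℕ}
    (ha : p.writesNat a = false) : s'.nat a = s.nat a := by
  induction h with
  | skip => rfl
  | setNat b i e s =>
    have : a ≠ b := by simpa [RamProgram.writesNat] using ha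
    simp [RamState.updateNat, this]
  | setReal => rfl
  | seq _ _ ih₁ ih₂ =>
    simp only [RamProgram.writesNat, Bool.or_eq_false_iff] at ha
    rw [ih₂ ha.2, ih₁ ha.1]
  | iteTrue _ _ ih =>
    simp only [RamProgram.writesNat, Bool.or_eq_false_iff] at ha
    exact ih ha.1
  | iteFalse _ _ ih =>
    simp only [RamProgram.writesNat, Bool.or_eq_false_iff] at ha
    exact ih ha.2
  | whileTrue _ _ _ ih₁ ih₂ => rw [ih₂ ha, ih₁ ha]
  | whileFalse => rfl

theorem Exec.real_eq {p : RamProgram} {s s' : RamState} {t : ℕ} (h : Exec p s t s') {a : ℕ}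
    (ha : p.writesReal a = false) : s'.real a = s.real a := by
  induction h with
  | skip => rfl
  | setReal b i e s =>
    have : a ≠ b := by simpa [RamProgram.writesReal] using ha
    simp [RamState.updateReal, this]
  | setNat => rfl
  | seq _ _ ih₁ ih₂ =>
    simp only [RamProgram.writesReal, Bool.or_eq_false_iff] at ha
    rw [ih₂ ha.2, ih₁ ha.1]
  | iteTrue _ _ ih =>
    simp only [RamProgram.writesReal, Bool.or_eq_false_iff] at ha
    exact ih ha.1
  | iteFalse _ _ ih =>
    simp only [RamProgram.writesReal, Bool.or_eq_false_iff] at ha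
    exact ih ha.2
  | whileTrue _ _ _ ih₁ ih₂ => rw [ih₂ ha, ih₁ ha]
  | whileFalse => rfl

theorem RamProgram.step_nat (p : RamProgram) (s : RamState) {a : ℕ}
    (ha : p.writesNat a = false) : (p.step s).nat a = s.nat a := by
  induction p generalizing s with
  | setNat b i e =>
    have : a ≠ b := by simpa [writesNat] using ha
    simp [step, RamState.updateNat, this]
  | seq p q ihp ihq =>
    simp only [writesNat, Bool.or_eq_false_iff] at ha
    rw [step, ihq _ ha.2, ihp _ ha.1]
  | ite c p q ihp ihq =>
    simp only [writesNat, Bool.or_eq_false_iff] at ha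
    rw [step]
    split_ifs
    · exact ihp _ ha.1
    · exact ihq _ ha.2
  | _ => rfl

theorem RamProgram.step_real (p : RamProgram) (s : RamState) {a : ℕ}
    (ha : p.writesReal a = false) : (p.step s).real a = s.real a := by
  induction p generalizing s with
  | setReal b i e =>
    have : a ≠ b := by simpa [writesReal] using ha
    simp [step, RamState.updateReal, this]
  | seq p q ihp ihq =>
    simp only [writesReal, Bool.or_eq_false_iff] at ha
    rw [step, ihq _ ha.2, ihp _ ha.1]
  | ite c p q ihp ihq =>
    simp only [writesReal, Bool.or_eq_false_iff] at ha
    rw [step]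
    split_ifs
    · exact ihp _ ha.1
    · exact ihq _ ha.2
  | _ => rfl

/-- `s'` agrees with `s` on all arrays to which `p` contains no assignment. -/
def RamProgram.Frame (p : RamProgram) (s s' : RamState) : Prop :=
  (∀ a, p.writesNat a = false → s'.nat a = s.nat a) ∧
    ∀ a, p.writesReal a = false → s'.real a = s.real a

theorem RamProgram.Runs.frame {p : RamProgram} {s : RamState} {T : ℕ} {Q : RamState → Prop}
    (h : p.Runs s T Q) : p.Runs s T (fun s' => Q s' ∧ p.Frame s s') := by
  obtain ⟨t, s', he, ht, hq⟩ := h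
  exact ⟨t, s', he, ht, hq, fun a ha => he.nat_eq ha, fun a ha => he.real_eq ha⟩

@[simp] theorem RamState.updateNat_nat (s : RamState) (a i v b j : ℕ) :
    (s.updateNat a i v).nat b j = if b = a ∧ j = i then v else s.nat b j := by
  by_cases h : b = a
  · subst h; by_cases h' : j = i <;> simp [RamState.updateNat, h']
  · simp [RamState.updateNat, h]

@[simp] theorem RamState.updateNat_real (s : RamState) (a i v : ℕ) :
    (s.updateNat a i v).real = s.real := rfl

@[simp] theorem RamState.updateReal_nat (s : RamState) (a i : ℕ) (v : ℝ) :
    (s.updateReal a i v).nat = s.nat := rfl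

@[simp] theorem RamState.updateReal_real (s : RamState) (a i : ℕ) (v : ℝ) (b j : ℕ) :
    (s.updateReal a i v).real b j = if b = a ∧ j = i then v else s.real b j := by
  by_cases h : b = a
  · subst h; by_cases h' : j = i <;> simp [RamState.updateReal, h']
  · simp [RamState.updateReal, h]

@[simp] theorem RamProgram.step_skip (s : RamState) : RamProgram.skip.step s = s := rfl

@[simp] theorem RamProgram.step_setNat (a : ℕ) (i e : NatExpr) (s : RamState) :
    (RamProgram.setNat a i e).step s = s.updateNat a (i.eval s) (e.eval s) := rfl

@[simp] theorem RamProgram.step_setReal (a : ℕ) (i : NatExpr) (e : RealExpr) (s : RamState) :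
    (RamProgram.setReal a i e).step s = s.updateReal a (i.eval s) (e.eval s) := rfl

@[simp] theorem RamProgram.step_seq (p q : RamProgram) (s : RamState) :
    (RamProgram.seq p q).step s = q.step (p.step s) := rfl

open Classical in
@[simp] theorem RamProgram.step_ite_nat (c : BoolExpr) (p q : RamProgram) (s : RamState)
    (a i : ℕ) : ((RamProgram.ite c p q).step s).nat a i =
      if c.eval s then (p.step s).nat a i else (q.step s).nat a i := by
  rw [step]; split_ifs <;> rfl

open Classical in
@[simp] theorem RamProgram.step_ite_real (c : BoolExpr) (p q : RamProgram) (s : RamState)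
    (a i : ℕ) : ((RamProgram.ite c p q).step s).real a i =
      if c.eval s then (p.step s).real a i else (q.step s).real a i := by
  rw [step]; split_ifs <;> rfl

attribute [simp] NatExpr.eval RealExpr.eval BoolExpr.eval

/-- A scalar variable of type `ℕ` is the entry `0` of an array. -/
@[reducible] def NatExpr.var (a : ℕ) : NatExpr := .get a (.const 0)

/-- A scalar variable of type `ℝ` is the entry `0` of an array. -/
@[reducible] def RealExpr.var (a : ℕ) : RealExpr := .get a (.const 0)

/-- Assignment to a scalar variable. -/
@[reducible] def RamProgram.letNat (a : ℕ) (e : NatExpr) : RamProgram := .setNat a (.const 0) e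

/-- Assignment to a scalar variable. -/
@[reducible] def RamProgram.letReal (a : ℕ) (e : RealExpr) : RamProgram := .setReal a (.const 0) e

/-- Disjunction of conditions. -/
@[reducible] def BoolExpr.or (c₁ c₂ : BoolExpr) : BoolExpr := .not (.and (.not c₁) (.not c₂))

infixr:30 " ;; " => RamProgram.seq

/-- The entries of `f` from `i` on start with the list `l`. -/
def Holds {α : Type*} (f : ℕ → α) : ℕ → List α → Prop
  | _, [] => True
  | i, a :: l => f i = a ∧ Holds f (i + 1) l

@[simp] theorem holds_nil {α : Type*} (f : ℕ → α) (i : ℕ) : Holds f i [] := trivial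

@[simp] theorem holds_cons {α : Type*} (f : ℕ → α) (i : ℕ) (a : α) (l : List α) :
    Holds f i (a :: l) ↔ f i = a ∧ Holds f (i + 1) l := Iff.rfl

theorem holds_append {α : Type*} (f : ℕ → α) (i : ℕ) (l l' : List α) :
    Holds f i (l ++ l') ↔ Holds f i l ∧ Holds f (i + l.length) l' := by
  induction l generalizing i with
  | nil => simp
  | cons a l ih => simp [ih, and_assoc, add_assoc, add_comm 1]

theorem Holds.congr {α : Type*} {f g : ℕ → α} {i : ℕ} {l : List α} (h : Holds f i l)
    (hfg : ∀ j, i ≤ j → j < i + l.length → g j = f j) : Holds g i l := by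
  induction l generalizing i with
  | nil => trivial
  | cons a l ih =>
    refine ⟨(hfg i le_rfl (by simp)).trans h.1, ih h.2 (fun j hj hj' => hfg j (by omega) ?_)⟩
    simp only [List.length_cons]; omega

theorem holds_iff_getElem {α : Type*} (f : ℕ → α) (i : ℕ) (l : List α) :
    Holds f i l ↔ ∀ j (hj : j < l.length), f (i + j) = l[j] := by
  induction l generalizing i with
  | nil => simp
  | cons a l ih =>
    rw [holds_cons, ih]
    constructor
    · rintro ⟨h0, h⟩ (_ | j) hj
      · simpa using h0
      · have := h j (by simpa using hj)
        simpa [add_assoc, add_comm 1] using this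
    · intro h
      refine ⟨h 0 (Nat.succ_pos _), fun j hj => ?_⟩
      have := h (j + 1) (by simpa using hj)
      simpa [add_assoc, add_comm 1] using this

/-! ## Sorting, with a count of inversions -/

section Inversions

variable {β : Type*} [LinearOrder β]

/-- The number of pairs of entries of the list, the first one `≥ h` and the second one `< h`,
whose `g`-values stand in the wrong order. -/
def crossInversions (g : ℕ → β) (h : ℕ) : List ℕ → ℕ
  | [] => 0
  | a :: l => l.countP (fun b => h ≤ a ∧ b < h ∧ g b < g a) + crossInversions g h l

theorem crossInversions_append (g : ℕ → β) (h : ℕ) (l l' : List ℕ) :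
    crossInversions g h (l ++ l') = crossInversions g h l + crossInversions g h l' +
      (l.map (fun a => l'.countP (fun b => h ≤ a ∧ b < h ∧ g b < g a))).sum := by
  induction l with
  | nil => simp [crossInversions]
  | cons a l ih => simp [crossInversions, ih]; ring

theorem crossInversions_eq_zero (g : ℕ → β) (h : ℕ) {l : List ℕ}
    (hl : l.Pairwise (fun a b => g a ≤ g b)) : crossInversions g h l = 0 := by
  induction l with
  | nil => rfl
  | cons a l ih =>
    rw [List.pairwise_cons] at hl
    simp only [crossInversions, ih hl.2, add_zero, List.countP_eq_zero, decide_eq_true_eq]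
    rintro b hb ⟨-, -, hlt⟩
    exact absurd (hl.1 b hb) (not_le.2 hlt)

/-- Moving an entry over a list of entries that are greater. -/
theorem crossInversions_cons_swap (g : ℕ → β) (h : ℕ) (b : ℕ) (l l' : List ℕ)
    (hb : ∀ a ∈ l, g b < g a) :
    crossInversions g h (l ++ b :: l') =
      crossInversions g h (b :: (l ++ l')) + if b < h then l.countP (h ≤ ·) else 0 := by
  induction l with
  | nil => simp
  | cons a l ih =>
    have ih := ih (fun c hc => hb c (by simp [hc]))
    have hba : g b < g a := hb a (by simp)
    simp only [List.cons_append, crossInversions, ih, List.countP_append, List.countP_cons]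
    by_cases h1 : b < h <;> by_cases h2 : h ≤ a <;> simp [h1, h2, hba, not_lt.2 hba.le] <;> omega

/-- The pairs between `k` and the rest depend on the rest only up to permutation, so only the pairs
of `b` with the entries of `l` can change. -/
theorem crossInversions_swap (g : ℕ → β) (h : ℕ) (b : ℕ) (k l l' : List ℕ)
    (hb : ∀ a ∈ l, g b < g a) :
    crossInversions g h (k ++ (l ++ b :: l')) =
      crossInversions g h (k ++ (b :: (l ++ l'))) + if b < h then l.countP (h ≤ ·) else 0 := by
  have hp : (l ++ b :: l').Perm (b :: (l ++ l')) := List.perm_middle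
  rw [crossInversions_append, crossInversions_append g h k, crossInversions_cons_swap g h b l l' hb]
  have : ∀ a, (l ++ b :: l').countP (fun b => h ≤ a ∧ b < h ∧ g b < g a) =
      (b :: (l ++ l')).countP (fun b => h ≤ a ∧ b < h ∧ g b < g a) := fun a => hp.countP_eq _
  simp only [this]
  omega

/-- The list is a concatenation of sorted blocks of length `w`, the last of which may be
shorter. -/
inductive Chunks (g : ℕ → β) (w : ℕ) : List ℕ → Prop
  | last {l : List ℕ} : l.length ≤ w → l.Pairwise (fun a b => g a ≤ g b) → Chunks g w l
  | cons {l l' : List ℕ} : l.length = w → l.Pairwise (fun a b => g a ≤ g b) → Chunks g w l' →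
      Chunks g w (l ++ l')

/-- The list is a concatenation of sorted blocks of length `w`. -/
inductive FullChunks (g : ℕ → β) (w : ℕ) : List ℕ → Prop
  | nil : FullChunks g w []
  | snoc {l l' : List ℕ} : FullChunks g w l → l'.length = w →
      l'.Pairwise (fun a b => g a ≤ g b) → FullChunks g w (l ++ l')

theorem FullChunks.append {g : ℕ → β} {w : ℕ} {l l' : List ℕ} (h : FullChunks g w l)
    (h' : Chunks g w l') : Chunks g w (l ++ l') := by
  induction h generalizing l' with
  | nil => exact h'
  | snoc _ hl hs ih =>
    rw [List.append_assoc]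
    exact ih (.cons hl hs h')

theorem chunks_one (g : ℕ → β) (l : List ℕ) : Chunks g 1 l := by
  induction l with
  | nil => exact .last (by simp) (by simp)
  | cons a l ih => exact .cons (l := [a]) rfl (by simp) ih

theorem Chunks.pairwise {g : ℕ → β} {w : ℕ} {l : List ℕ} (h : Chunks g w l)
    (hw : l.length ≤ w) : l.Pairwise (fun a b => g a ≤ g b) := by
  cases h with
  | last _ h => exact h
  | @cons k l' hl hs _ =>
    have : l' = [] := by
      rw [List.length_append] at hw
      exact List.length_eq_zero_iff.1 (by omega)
    simpa [this] using hs

/-- Splitting off the next block. -/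
theorem Chunks.split {g : ℕ → β} {w : ℕ} {l : List ℕ} (h : Chunks g w l) :
    ∃ k l', l = k ++ l' ∧ k.length = min w l.length ∧ k.Pairwise (fun a b => g a ≤ g b) ∧
      Chunks g w l' := by
  cases h with
  | last h hs => exact ⟨l, [], by simp, by omega, hs, .last (by simp) (by simp)⟩
  | @cons k l' hl hs h =>
    exact ⟨k, l', rfl, by simp; omega, hs, h⟩

end Inversions

/-- The real keys, made distinct by the index. -/
noncomputable def lexKey (s : RamState) (a : ℕ) : ℝ ×ₗ ℕ := toLex (s.real 9 a, a)

theorem lexKey_lt (s : RamState) (a b : ℕ) : lexKey s a < lexKey s b ↔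
    s.real 9 a < s.real 9 b ∨ (s.real 9 a = s.real 9 b ∧ a < b) := by
  rw [lexKey, lexKey, Prod.Lex.toLex_lt_toLex]

theorem lexKey_injective (s : RamState) : Function.Injective (lexKey s) := by
  intro a b h
  have := congrArg (fun x => (ofLex x).2) h
  simpa [lexKey] using this

/-! ### Bottom-up merge sort that counts inversions. -/

namespace SortProgram

/-- Opening the next pair of blocks. Scalars: `3` the length, `4` the block width, `5` the number
of the entries put out, `6` and `8` the positions in the two blocks, `7` and `9` their ends,
`10` the number of the entries `< h` taken from the second block, `11` the inversions, `12` the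
threshold `h`. -/
def openBlocks : RamProgram :=
  .letNat 6 (.var 5) ;;
  -- With truncated subtraction, `N - (N - a)` is `min N a`; blocks are cut off at the end of the
  -- array.
  .letNat 7 (.sub (.var 3) (.sub (.var 3) (.add (.var 5) (.var 4)))) ;;
  .letNat 8 (.var 7) ;;
  .letNat 9 (.sub (.var 3) (.sub (.var 3) (.add (.var 7) (.var 4)))) ;;
  .letNat 10 (.const 0)

/-- The next entry comes from the first block. -/
def takeLeft : BoolExpr :=
  .and (.natLt (.var 6) (.var 7))
    (.not (.and (.natLt (.var 8) (.var 9))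
      (.or (.realLt (.get 9 (.get 1 (.var 8))) (.get 9 (.get 1 (.var 6))))
        (.and (.not (.realLt (.get 9 (.get 1 (.var 6))) (.get 9 (.get 1 (.var 8)))))
          (.natLt (.get 1 (.var 8)) (.get 1 (.var 6)))))))

/-- An entry `≥ h` that leaves the first block has been overtaken by all entries `< h` taken so far
from the second block. Variable `10` is their number, hence the number of inversions settled at this
moment. -/
def emitLeft : RamProgram :=
  .ite (.natLt (.get 1 (.var 6)) (.var 12)) .skip (.letNat 11 (.add (.var 11) (.var 10))) ;;
  .setNat 2 (.var 5) (.get 1 (.var 6)) ;;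
  .letNat 6 (.add (.var 6) (.const 1)) ;;
  .letNat 5 (.add (.var 5) (.const 1))

def emitRight : RamProgram :=
  .ite (.natLt (.get 1 (.var 8)) (.var 12)) (.letNat 10 (.add (.var 10) (.const 1))) .skip ;;
  .setNat 2 (.var 5) (.get 1 (.var 8)) ;;
  .letNat 8 (.add (.var 8) (.const 1)) ;;
  .letNat 5 (.add (.var 5) (.const 1))

/-- Each iteration puts out exactly one entry and opens new blocks only on demand. A pass is
therefore a single loop of uniform cost, and its linear running time needs no amortization. -/
def passBody : RamProgram :=
  .ite (.natLt (.var 5) (.var 9)) .skip openBlocks ;;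
  .ite takeLeft emitLeft emitRight

def passInit : RamProgram :=
  .letNat 5 (.const 0) ;;
  .letNat 9 (.const 0) ;;
  .letNat 10 (.const 0) ;;
  .letNat 6 (.const 0) ;;
  .letNat 7 (.const 0) ;;
  .letNat 8 (.const 0)

/-- Merging the blocks of width `w` of the array `1` pairwise, into the array `2`. -/
def pass : RamProgram :=
  passInit ;; .while (.natLt (.var 5) (.var 3)) passBody

def copyBody : RamProgram :=
  .setNat 1 (.var 5) (.get 2 (.var 5)) ;; .letNat 5 (.add (.var 5) (.const 1))

/-- Copying the array `2` to the array `1`. -/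
def copyBack : RamProgram :=
  .letNat 5 (.const 0) ;; .while (.natLt (.var 5) (.var 3)) copyBody

def sortInit : RamProgram := .letNat 11 (.const 0) ;; .letNat 4 (.const 1)

def sortBody : RamProgram := pass ;; copyBack ;; .letNat 4 (.add (.var 4) (.var 4))

/-- Merge sort of the array `1` of indices by the keys in the real array `9`. -/
def sort : RamProgram := sortInit ;; .while (.natLt (.var 4) (.var 3)) sortBody

/-- The invariant of a pass: `done ++ cur` is put out, `l` and `r` remain of the current two
blocks and `rest` of the array. -/
structure PassInv (g : ℕ → ℝ ×ₗ ℕ) (L : List ℕ) (w h total : ℕ) (f : ℕ → ℕ)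
    (done cur l r rest : List ℕ) (s : RamState) : Prop where
  idx : s.nat 1 = f
  key : lexKey s = g
  len : s.nat 3 0 = L.length
  width : s.nat 4 0 = w
  thr : s.nat 12 0 = h
  out_eq : s.nat 5 0 = done.length + cur.length
  i_eq : s.nat 6 0 + l.length = s.nat 7 0
  j_eq : s.nat 8 0 + r.length = s.nat 9 0
  hi_eq : done.length + cur.length + l.length + r.length = s.nat 9 0
  hl : Holds f (s.nat 6 0) l
  hr : Holds f (s.nat 8 0) r
  hrest : Holds f (s.nat 9 0) rest
  hout : Holds (s.nat 2) 0 (done ++ cur)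
  full : FullChunks g (2 * w) done
  cur_le : cur.length + l.length + r.length ≤ 2 * w
  -- Only the last pair of blocks may be incomplete. The third alternative is the start, before any
  -- block is open.
  cur_eq : rest = [] ∨ cur.length + l.length + r.length = 2 * w ∨ (cur = [] ∧ l = [] ∧ r = [])
  cur_sorted : cur.Pairwise (fun a b => g a ≤ g b)
  cur_l : ∀ a ∈ cur, ∀ b ∈ l, g a ≤ g b
  cur_r : ∀ a ∈ cur, ∀ b ∈ r, g a ≤ g b
  l_sorted : l.Pairwise (fun a b => g a ≤ g b)
  r_sorted : r.Pairwise (fun a b => g a ≤ g b)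
  chunks : Chunks g w rest
  perm : (done ++ (cur ++ (l ++ (r ++ rest)))).Perm L
  -- When an entry `< h` of the second block jumps over `l`, its inversions with `l` pass from the
  -- third term to the second; when an entry of `l` is put out, its share passes from the second
  -- term to the first.
  inv : s.nat 11 0 + s.nat 10 0 * l.countP (h ≤ ·) +
    crossInversions g h (done ++ (cur ++ (l ++ (r ++ rest)))) = total

theorem PassInv.open {g : ℕ → ℝ ×ₗ ℕ} {L : List ℕ} {w h total : ℕ} {f : ℕ → ℕ}
    {done cur l r rest : List ℕ} {s : RamState} (hw : 0 < w)
    (I : PassInv g L w h total f done cur l r rest s)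
    (hN : s.nat 5 0 < s.nat 3 0) (ho : ¬ s.nat 5 0 < s.nat 9 0) :
    ∃ done' cur' l' r' rest', PassInv g L w h total f done' cur' l' r' rest' (openBlocks.step s) ∧
      (openBlocks.step s).nat 5 0 < (openBlocks.step s).nat 9 0 := by
  have h1 := I.out_eq
  have h2 := I.hi_eq
  obtain rfl : l = [] := List.length_eq_zero_iff.1 (by omega)
  obtain rfl : r = [] := List.length_eq_zero_iff.1 (by omega)
  have hlen : done.length + cur.length + rest.length = L.length := by
    have := I.perm.length_eq
    simp at this; omega
  obtain ⟨l', rest₁, h3, h4, h5, h6⟩ := I.chunks.split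
  obtain ⟨r', rest₂, h7, h8, h9, h10⟩ := h6.split
  have hcur : FullChunks g (2 * w) (done ++ cur) := by
    rcases I.cur_eq with h | h | h
    · have := I.len
      simp [h] at hlen; omega
    · exact .snoc I.full (by simpa using h) I.cur_sorted
    · simpa [h.1] using I.full
  have e3 := I.len
  have e4 := I.width
  have l1 : rest.length = l'.length + rest₁.length := by simp [h3]
  have l2 : rest₁.length = r'.length + rest₂.length := by simp [h7]
  have e9 : s.nat 9 0 = s.nat 5 0 := by simp at h2; omega
  have s5 : (openBlocks.step s).nat 5 0 = s.nat 5 0 := by rw [RamProgram.step_nat _ _ rfl]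
  have s6 : (openBlocks.step s).nat 6 0 = s.nat 5 0 := by
    simp [openBlocks]
  have s7 : (openBlocks.step s).nat 7 0 = s.nat 5 0 + l'.length := by
    simp [openBlocks]; omega
  have s8 : (openBlocks.step s).nat 8 0 = s.nat 5 0 + l'.length := by
    simp [openBlocks]; omega
  have s9 : (openBlocks.step s).nat 9 0 = s.nat 5 0 + l'.length + r'.length := by
    simp [openBlocks]; omega
  have s10 : (openBlocks.step s).nat 10 0 = 0 := by
    simp [openBlocks]
  have hrest := I.hrest
  rw [h3, h7, holds_append, holds_append, e9] at hrest
  refine ⟨done ++ cur, [], l', r', rest₂, ?_, by omega⟩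
  constructor
  · rw [RamProgram.step_nat _ _ rfl, I.idx]
  · rw [← I.key]; unfold lexKey; rw [RamProgram.step_real _ _ rfl]
  · rw [RamProgram.step_nat _ _ rfl, I.len]
  · rw [RamProgram.step_nat _ _ rfl, I.width]
  · rw [RamProgram.step_nat _ _ rfl, I.thr]
  · simp [s5, h1]
  · rw [s6, s7]
  · rw [s8, s9]
  · simp [s9]; omega
  · rw [s6]; exact hrest.1
  · rw [s8]; exact hrest.2.1
  · rw [s9]; exact hrest.2.2
  · rw [RamProgram.step_nat _ _ rfl, List.append_nil]; exact I.hout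
  · exact hcur
  · simp; omega
  · rcases List.eq_nil_or_concat rest₂ with h | ⟨k, a, h⟩
    · exact .inl h
    · have : 0 < rest₂.length := by simp [h]
      right; left; simp; omega
  · simp
  · simp
  · simp
  · exact h5
  · exact h9
  · exact h10
  · have := I.perm
    simpa [h3, h7] using this
  · have := I.inv
    rw [s10, RamProgram.step_nat _ _ rfl, ← this]
    simp [h3, h7]

theorem takeLeft_eval (s : RamState) : takeLeft.eval s ↔ s.nat 6 0 < s.nat 7 0 ∧
    ¬ (s.nat 8 0 < s.nat 9 0 ∧ lexKey s (s.nat 1 (s.nat 8 0)) < lexKey s (s.nat 1 (s.nat 6 0))) := by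
  have key : ∀ (x y : ℝ) (a b : ℕ), (¬ (¬ x < y ∧ ¬ (¬ y < x ∧ a < b))) ↔
      x < y ∨ (x = y ∧ a < b) := by
    intro x y a b
    rcases lt_trichotomy x y with h | h | h
    · simp [h]
    · simp [h]
    · simp [h, h.not_gt, h.ne']
  rw [lexKey_lt, ← key]
  rfl

theorem PassInv.emitLeft {g : ℕ → ℝ ×ₗ ℕ} {L : List ℕ} {w h total : ℕ} {f : ℕ → ℕ}
    {done cur l r rest : List ℕ} {a : ℕ} {s : RamState}
    (I : PassInv g L w h total f done cur (a :: l) r rest s) (har : ∀ b ∈ r, g a ≤ g b) :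
    PassInv g L w h total f done (cur ++ [a]) l r rest (emitLeft.step s) := by
  have hl := I.hl
  rw [holds_cons] at hl
  have hia : s.nat 1 (s.nat 6 0) = a := by rw [I.idx]; exact hl.1
  have s5 : (SortProgram.emitLeft.step s).nat 5 0 = s.nat 5 0 + 1 := by simp [SortProgram.emitLeft]
  have s6 : (SortProgram.emitLeft.step s).nat 6 0 = s.nat 6 0 + 1 := by simp [SortProgram.emitLeft]
  have s11 : (SortProgram.emitLeft.step s).nat 11 0 =
      s.nat 11 0 + if h ≤ a then s.nat 10 0 else 0 := by
    by_cases hc : h ≤ a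
    · simp [SortProgram.emitLeft, hia, I.thr, hc]
    · simp [SortProgram.emitLeft, hia, I.thr, hc, not_le.1 hc]
  have s2 : ∀ k, (SortProgram.emitLeft.step s).nat 2 k =
      if k = s.nat 5 0 then a else s.nat 2 k := by
    intro k; simp [SortProgram.emitLeft, hia]
  have h1 := I.out_eq
  have h2 := I.hi_eq
  have h3 := I.i_eq
  have hsl := List.pairwise_cons.1 I.l_sorted
  constructor
  · rw [RamProgram.step_nat _ _ rfl, I.idx]
  · rw [← I.key]; unfold lexKey; rw [RamProgram.step_real _ _ rfl]
  · rw [RamProgram.step_nat _ _ rfl, I.len]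
  · rw [RamProgram.step_nat _ _ rfl, I.width]
  · rw [RamProgram.step_nat _ _ rfl, I.thr]
  · simp [s5]; omega
  · rw [s6, RamProgram.step_nat _ _ rfl]; simp at h3; omega
  · rw [RamProgram.step_nat (a := 8) _ _ rfl, RamProgram.step_nat (a := 9) _ _ rfl, I.j_eq]
  · rw [RamProgram.step_nat _ _ rfl]; simp at h2 ⊢; omega
  · rw [s6]; exact hl.2
  · rw [RamProgram.step_nat _ _ rfl]; exact I.hr
  · rw [RamProgram.step_nat _ _ rfl]; exact I.hrest
  · rw [← List.append_assoc, holds_append]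
    refine ⟨I.hout.congr fun k _ hk => ?_, ?_⟩
    · simp at hk
      rw [s2, if_neg (by omega)]
    · simp [s2, h1]
  · exact I.full
  · have := I.cur_le
    simp at this ⊢; omega
  · rcases I.cur_eq with h | h | h
    · exact .inl h
    · right; left; simp at h ⊢; omega
    · simp at h
  · rw [List.pairwise_append]
    refine ⟨I.cur_sorted, by simp, fun x hx y hy => ?_⟩
    rw [List.mem_singleton.1 hy]
    exact I.cur_l x hx a (by simp)
  · intro x hx y hy
    rcases List.mem_append.1 hx with hx | hx
    · exact I.cur_l x hx y (by simp [hy])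
    · rw [List.mem_singleton.1 hx]; exact hsl.1 y hy
  · intro x hx y hy
    rcases List.mem_append.1 hx with hx | hx
    · exact I.cur_r x hx y hy
    · rw [List.mem_singleton.1 hx]; exact har y hy
  · exact hsl.2
  · exact I.r_sorted
  · exact I.chunks
  · simpa using I.perm
  · have := I.inv
    rw [s11, RamProgram.step_nat (a := 10) _ _ rfl, ← this]
    by_cases hc : h ≤ a
    · simp [hc]; ring
    · simp [hc]

theorem PassInv.emitRight {g : ℕ → ℝ ×ₗ ℕ} {L : List ℕ} {w h total : ℕ} {f : ℕ → ℕ}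
    {done cur l r rest : List ℕ} {b : ℕ} {s : RamState}
    (I : PassInv g L w h total f done cur l (b :: r) rest s) (hbl : ∀ a ∈ l, g b < g a) :
    PassInv g L w h total f done (cur ++ [b]) l r rest (emitRight.step s) := by
  have hr := I.hr
  rw [holds_cons] at hr
  have hib : s.nat 1 (s.nat 8 0) = b := by rw [I.idx]; exact hr.1
  have s5 : (SortProgram.emitRight.step s).nat 5 0 = s.nat 5 0 + 1 := by
    simp [SortProgram.emitRight]
  have s8 : (SortProgram.emitRight.step s).nat 8 0 = s.nat 8 0 + 1 := by
    simp [SortProgram.emitRight]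
  have s10 : (SortProgram.emitRight.step s).nat 10 0 =
      s.nat 10 0 + if b < h then 1 else 0 := by
    by_cases hc : b < h
    · simp [SortProgram.emitRight, hib, I.thr, hc]
    · simp [SortProgram.emitRight, hib, I.thr, hc]
  have s2 : ∀ k, (SortProgram.emitRight.step s).nat 2 k =
      if k = s.nat 5 0 then b else s.nat 2 k := by
    intro k
    simp [SortProgram.emitRight, hib]
  have h1 := I.out_eq
  have h2 := I.hi_eq
  have h3 := I.j_eq
  have hsr := List.pairwise_cons.1 I.r_sorted
  constructor
  · rw [RamProgram.step_nat _ _ rfl, I.idx]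
  · rw [← I.key]; unfold lexKey; rw [RamProgram.step_real _ _ rfl]
  · rw [RamProgram.step_nat _ _ rfl, I.len]
  · rw [RamProgram.step_nat _ _ rfl, I.width]
  · rw [RamProgram.step_nat _ _ rfl, I.thr]
  · simp [s5]; omega
  · rw [RamProgram.step_nat (a := 6) _ _ rfl, RamProgram.step_nat (a := 7) _ _ rfl, I.i_eq]
  · rw [s8, RamProgram.step_nat _ _ rfl]; simp at h3; omega
  · rw [RamProgram.step_nat _ _ rfl]; simp at h2 ⊢; omega
  · rw [RamProgram.step_nat _ _ rfl]; exact I.hl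
  · rw [s8]; exact hr.2
  · rw [RamProgram.step_nat _ _ rfl]; exact I.hrest
  · rw [← List.append_assoc, holds_append]
    refine ⟨I.hout.congr fun k _ hk => ?_, ?_⟩
    · simp at hk
      rw [s2, if_neg (by omega)]
    · simp [s2, h1]
  · exact I.full
  · have := I.cur_le
    simp at this ⊢; omega
  · rcases I.cur_eq with h | h | h
    · exact .inl h
    · right; left; simp at h ⊢; omega
    · simp at h
  · rw [List.pairwise_append]
    refine ⟨I.cur_sorted, by simp, fun x hx y hy => ?_⟩
    rw [List.mem_singleton.1 hy]
    exact I.cur_r x hx b (by simp)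
  · intro x hx y hy
    rcases List.mem_append.1 hx with hx | hx
    · exact I.cur_l x hx y hy
    · rw [List.mem_singleton.1 hx]; exact (hbl y hy).le
  · intro x hx y hy
    rcases List.mem_append.1 hx with hx | hx
    · exact I.cur_r x hx y (by simp [hy])
    · rw [List.mem_singleton.1 hx]; exact hsr.1 y hy
  · exact I.l_sorted
  · exact hsr.2
  · exact I.chunks
  · refine List.Perm.trans ?_ I.perm
    simp only [List.append_assoc, List.cons_append, List.nil_append]
    exact ((List.perm_middle (l₁ := l) (a := b) (l₂ := r ++ rest)).symm.append_left _).append_left _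
  · have := I.inv
    have hsw := crossInversions_swap g h b (done ++ cur) l (r ++ rest) hbl
    simp only [List.append_assoc, List.cons_append, List.nil_append] at this hsw ⊢
    rw [s10, RamProgram.step_nat (a := 11) _ _ rfl, ← this, hsw]
    by_cases hc : b < h
    · simp [hc]; ring
    · simp [hc]

theorem PassInv.emit {g : ℕ → ℝ ×ₗ ℕ} {L : List ℕ} {w h total : ℕ} {f : ℕ → ℕ}
    {done cur l r rest : List ℕ} {s : RamState} (I : PassInv g L w h total f done cur l r rest s) (ho : s.nat 5 0 < s.nat 9 0) :
    ∃ cur' l' r', PassInv g L w h total f done cur' l' r' rest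
        ((RamProgram.ite takeLeft SortProgram.emitLeft SortProgram.emitRight).step s) ∧
      cur'.length = cur.length + 1 := by
  have h1 := I.out_eq
  have h2 := I.hi_eq
  have h3 := I.i_eq
  have h4 := I.j_eq
  have hl := I.hl
  have hr := I.hr
  have hT := takeLeft_eval s
  rw [I.key, I.idx] at hT
  by_cases hc : takeLeft.eval s
  · have hc' := hT.1 hc
    match l, I with
    | [], I => simp at h3; omega
    | a :: l, I =>
      refine ⟨cur ++ [a], l, r, ?_, by simp⟩
      rw [RamProgram.step, if_pos hc]
      refine I.emitLeft fun b hb => ?_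
      have hl := I.hl
      match r, I with
      | c :: r, I =>
        have hsr := I.r_sorted
        rw [List.pairwise_cons] at hsr
        have hca : g a ≤ g c := by
          rw [← hl.1, ← hr.1]
          refine not_lt.1 fun hlt => hc'.2 ⟨by simp at h4; omega, hlt⟩
        rcases List.mem_cons.1 hb with rfl | hb
        · exact hca
        · exact hca.trans (hsr.1 b hb)
  · have hc' := fun h => hc (hT.2 h)
    match r, I with
    | [], I =>
      exfalso
      apply hc'
      simp at h2 h4
      exact ⟨by omega, fun h => by omega⟩
    | b :: r, I =>
      refine ⟨cur ++ [b], l, r, ?_, by simp⟩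
      rw [RamProgram.step, if_neg hc]
      refine I.emitRight fun a ha => ?_
      match l, I with
      | c :: l, I =>
        have hsl := I.l_sorted
        rw [List.pairwise_cons] at hsl
        have hbc : g b < g c := by
          rw [← hl.1, ← hr.1]
          by_contra hlt
          exact hc' ⟨by simp at h3; omega, fun h => hlt h.2⟩
        rcases List.mem_cons.1 ha with rfl | ha
        · exact hbc
        · exact hbc.trans_le (hsl.1 a ha)

theorem runs_pass : ∃ C : ℕ, ∀ (s : RamState) (L : List ℕ) (w h : ℕ), 0 < w →
    s.nat 3 0 = L.length → s.nat 4 0 = w → s.nat 12 0 = h → Holds (s.nat 1) 0 L →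
    Chunks (lexKey s) w L →
    pass.Runs s (C * (L.length + 1)) (fun s' => ∃ L', L'.Perm L ∧ Chunks (lexKey s) (2 * w) L' ∧
      Holds (s'.nat 2) 0 L' ∧
      s'.nat 11 0 + crossInversions (lexKey s) h L' =
        s.nat 11 0 + crossInversions (lexKey s) h L) := by
  refine ⟨passInit.maxCost + (passBody.maxCost + (BoolExpr.natLt (.var 5) (.var 3)).cost), ?_⟩
  intro s L w h hw hN hW hh hL hch
  set g := lexKey s with hg
  set total := s.nat 11 0 + crossInversions g h L with htotal
  let I : ℕ → RamState → Prop := fun n s' => (∃ done cur l r rest,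
    PassInv g L w h total (s.nat 1) done cur l r rest s') ∧ s'.nat 5 0 + n = L.length
  have hinit : passInit.Runs s passInit.maxCost (fun s' => I L.length s') := by
    refine RamProgram.runs_of_step rfl ⟨⟨[], [], [], [], L, ?_⟩, by simp [passInit]⟩
    constructor <;> try (simp [passInit]; done)
    · rw [RamProgram.step_nat _ _ rfl]
    · rw [hg]; unfold lexKey; rw [RamProgram.step_real _ _ rfl]
    · simpa [passInit] using hN
    · simpa [passInit] using hW
    · simpa [passInit] using hh
    · simpa [passInit] using hL
    · exact .nil
    · exact hch
    · simp [passInit, total]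
  refine (hinit.seq fun s' hs' => RamProgram.runs_while I id passBody.maxCost ?_ _ s' hs').mono
    ?_ ?_
  · rintro n s' ⟨⟨done, cur, l, r, rest, P⟩, hn⟩ hc
    refine RamProgram.runs_of_step rfl ?_
    have hlt : s'.nat 5 0 < s'.nat 3 0 := hc
    have hlen := P.len
    rw [passBody, RamProgram.step_seq]
    obtain ⟨done', cur', l', r', rest', P', ho, h5⟩ : ∃ done' cur' l' r' rest',
        PassInv g L w h total (s.nat 1) done' cur' l' r' rest'
          ((RamProgram.ite (.natLt (.var 5) (.var 9)) .skip openBlocks).step s') ∧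
        ((RamProgram.ite (.natLt (.var 5) (.var 9)) .skip openBlocks).step s').nat 5 0 <
          ((RamProgram.ite (.natLt (.var 5) (.var 9)) .skip openBlocks).step s').nat 9 0 ∧
        ((RamProgram.ite (.natLt (.var 5) (.var 9)) .skip openBlocks).step s').nat 5 0 =
          s'.nat 5 0 := by
      by_cases ho : s'.nat 5 0 < s'.nat 9 0
      · have e : (RamProgram.ite (.natLt (.var 5) (.var 9)) .skip openBlocks).step s' = s' := by
          rw [RamProgram.step, if_pos (show BoolExpr.eval s' (.natLt (.var 5) (.var 9)) from ho),
            RamProgram.step]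
        rw [e]
        exact ⟨done, cur, l, r, rest, P, ho, rfl⟩
      · have e : (RamProgram.ite (.natLt (.var 5) (.var 9)) .skip openBlocks).step s' =
            openBlocks.step s' := by
          rw [RamProgram.step, if_neg (show ¬ BoolExpr.eval s' (.natLt (.var 5) (.var 9)) from ho)]
        rw [e]
        obtain ⟨d, c, l, r, t, P', h'⟩ := P.open hw hlt ho
        exact ⟨d, c, l, r, t, P', h', by rw [RamProgram.step_nat _ _ rfl]⟩
    obtain ⟨cur'', l'', r'', P'', hcur⟩ := P'.emit ho
    have e1 := P'.out_eq
    have e2 := P''.out_eq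
    refine ⟨n - 1, ⟨⟨_, _, _, _, _, P''⟩, by omega⟩, ?_⟩
    simp only [id]; omega
  · simp only [id]
    nlinarith [Nat.zero_le (L.length * passInit.maxCost)]
  · rintro s' ⟨n, ⟨⟨done, cur, l, r, rest, P⟩, hn⟩, hc⟩
    have hge : ¬ s'.nat 5 0 < s'.nat 3 0 := hc
    have h1 := P.len
    have h2 := P.out_eq
    have h3 := P.perm.length_eq
    simp at h3
    obtain rfl : l = [] := List.length_eq_zero_iff.1 (by omega)
    obtain rfl : r = [] := List.length_eq_zero_iff.1 (by omega)
    obtain rfl : rest = [] := List.length_eq_zero_iff.1 (by omega)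
    -- The block under construction may be shorter than `2 * w`; it becomes the last chunk.
    refine ⟨done ++ cur, by simpa using P.perm, P.full.append (.last ?_ P.cur_sorted), P.hout, ?_⟩
    · simpa using P.cur_le
    · simpa using P.inv

theorem runs_copyBack : ∃ C : ℕ, ∀ (s : RamState) (L : List ℕ), s.nat 3 0 = L.length →
    Holds (s.nat 2) 0 L →
    copyBack.Runs s (C * (L.length + 1)) (fun s' => Holds (s'.nat 1) 0 L) := by
  refine ⟨(RamProgram.letNat 5 (.const 0)).maxCost +
    (copyBody.maxCost + (BoolExpr.natLt (.var 5) (.var 3)).cost), ?_⟩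
  intro s L hN hL
  let I : ℕ → RamState → Prop := fun n s' => s'.nat 2 = s.nat 2 ∧ s'.nat 3 = s.nat 3 ∧
    s'.nat 5 0 + n = L.length ∧ ∀ j < s'.nat 5 0, s'.nat 1 j = s.nat 2 j
  have hinit : (RamProgram.letNat 5 (.const 0)).Runs s (RamProgram.letNat 5 (.const 0)).maxCost
      (fun s' => I L.length s') := by
    refine RamProgram.runs_of_step rfl ⟨?_, ?_, by simp, by simp⟩
    · rw [RamProgram.step_nat _ _ rfl]
    · rw [RamProgram.step_nat _ _ rfl]
  refine (hinit.seq fun s' hs' => RamProgram.runs_while I id copyBody.maxCost ?_ _ s' hs').mono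
    ?_ ?_
  · rintro n s' ⟨h2, h3, hn, hj⟩ hc
    have hlt : s'.nat 5 0 < s'.nat 3 0 := hc
    rw [h3] at hlt
    refine RamProgram.runs_of_step rfl ⟨n - 1, ⟨?_, ?_, ?_, ?_⟩, ?_⟩
    · rw [RamProgram.step_nat _ _ rfl, h2]
    · rw [RamProgram.step_nat _ _ rfl, h3]
    · simp [copyBody]; omega
    · intro j hj'
      simp [copyBody] at hj' ⊢
      by_cases hj'' : j = s'.nat 5 0
      · simp [hj'', h2]
      · simp [hj'']; exact hj j (by omega)
    · simp only [id]; omega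
  · simp only [id]
    nlinarith [Nat.zero_le (L.length * (RamProgram.letNat 5 (.const 0)).maxCost)]
  · rintro s' ⟨n, ⟨h2, h3, hn, hj⟩, hc⟩
    have hge : ¬ s'.nat 5 0 < s'.nat 3 0 := hc
    rw [h3] at hge
    exact hL.congr fun j _ hj' => hj j (by omega)

/-- Every pass doubles the block width and preserves the counter plus the inversions left in the
array. After `Nat.clog 2` passes the array is sorted and has no inversions, so the counter holds the
original number. The ghost state is the exponent of the block width. -/
theorem runs_sort : ∃ C : ℕ, ∀ (s : RamState) (L : List ℕ) (h : ℕ),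
    s.nat 3 0 = L.length → s.nat 12 0 = h → Holds (s.nat 1) 0 L →
    sort.Runs s (C * ((L.length + 1) * (Nat.clog 2 L.length + 1))) (fun s' => ∃ L', L'.Perm L ∧
      L'.Pairwise (fun a b => lexKey s a ≤ lexKey s b) ∧ Holds (s'.nat 1) 0 L' ∧
      s'.nat 11 0 = crossInversions (lexKey s) h L) := by
  obtain ⟨C₁, hpass⟩ := runs_pass
  obtain ⟨C₂, hcopy⟩ := runs_copyBack
  refine ⟨sortInit.maxCost + (C₁ + (C₂ + (RamProgram.letNat 4 (.add (.var 4) (.var 4))).maxCost) +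
    (BoolExpr.natLt (.var 4) (.var 3)).cost), ?_⟩
  intro s L h hN hh hL
  set g := lexKey s with hg
  let I : ℕ → RamState → Prop := fun e s' => s'.nat 3 = s.nat 3 ∧ s'.nat 12 = s.nat 12 ∧
    s'.real 9 = s.real 9 ∧ s'.nat 4 0 = 2 ^ e ∧ ∃ L', L'.Perm L ∧ Chunks g (2 ^ e) L' ∧
      Holds (s'.nat 1) 0 L' ∧ s'.nat 11 0 + crossInversions g h L' = crossInversions g h L
  have hinit : sortInit.Runs s sortInit.maxCost (fun s' => I 0 s') := by
    refine RamProgram.runs_of_step rfl ⟨?_, ?_, ?_, by simp [sortInit], L, .refl _, ?_, ?_, ?_⟩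
    · rw [RamProgram.step_nat _ _ rfl]
    · rw [RamProgram.step_nat _ _ rfl]
    · rw [RamProgram.step_real _ _ rfl]
    · exact chunks_one g L
    · rwa [RamProgram.step_nat _ _ rfl]
    · simp [sortInit]
  refine (hinit.seq fun s' hs' => RamProgram.runs_while I (fun e => Nat.clog 2 L.length - e)
    (C₁ * (L.length + 1) + (C₂ * (L.length + 1) +
      (RamProgram.letNat 4 (.add (.var 4) (.var 4))).maxCost)) ?_ _ s' hs').mono ?_ ?_
  · rintro e s' ⟨h3, h12, h9, h4, L₁, hp, hch, hidx, hinv⟩ hc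
    have hlt : s'.nat 4 0 < s'.nat 3 0 := hc
    have hkey : lexKey s' = g := by rw [hg]; unfold lexKey; rw [h9]
    have hlen := hp.length_eq
    have hpass := hpass s' L₁ (2 ^ e) h (by positivity) (by rw [h3, hN, hlen]) h4
      (by rw [h12, hh]) hidx (by rwa [hkey])
    rw [hlen] at hpass
    refine hpass.frame.seq ?_
    rintro s₁ ⟨⟨L₂, hp₂, hch₂, hidx₂, hinv₂⟩, fn, fr⟩
    have hlen₂ := (hp₂.trans hp).length_eq
    have hcopy := hcopy s₁ L₂ (by rw [fn 3 rfl, h3, hN, hlen₂]) hidx₂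
    rw [hlen₂] at hcopy
    refine hcopy.frame.seq ?_
    rintro s₂ ⟨hidx₃, fn', fr'⟩
    refine RamProgram.runs_of_step rfl ⟨e + 1, ⟨?_, ?_, ?_, ?_, L₂, hp₂.trans hp, ?_, ?_, ?_⟩, ?_⟩
    · rw [RamProgram.step_nat _ _ rfl, fn' 3 rfl, fn 3 rfl, h3]
    · rw [RamProgram.step_nat _ _ rfl, fn' 12 rfl, fn 12 rfl, h12]
    · rw [RamProgram.step_real _ _ rfl, fr' 9 rfl, fr 9 rfl, h9]
    · simp [fn' 4 rfl, fn 4 rfl, h4]; ring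
    · rw [hkey, mul_comm, ← pow_succ] at hch₂; exact hch₂
    · rwa [RamProgram.step_nat _ _ rfl]
    · rw [RamProgram.step_nat _ _ rfl, fn' 11 rfl]
      rw [hkey] at hinv₂; omega
    · rw [h3, hN, h4] at hlt
      have : e < Nat.clog 2 L.length := (Nat.lt_clog_iff_pow_lt (by norm_num)).2 hlt
      omega
  · generalize L.length = N
    generalize Nat.clog 2 N = c
    generalize sortInit.maxCost = c1
    generalize (RamProgram.letNat 4 (.add (.var 4) (.var 4))).maxCost = c2
    generalize (BoolExpr.natLt (.var 4) (.var 3)).cost = c3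
    have h1 : c1 ≤ c1 * ((N + 1) * (c + 1)) := Nat.le_mul_of_pos_right _ (by positivity)
    have h2 : c2 ≤ c2 * (N + 1) := Nat.le_mul_of_pos_right _ (by positivity)
    have h3 : c3 ≤ c3 * (N + 1) := Nat.le_mul_of_pos_right _ (by positivity)
    have h4 : (c - 0 + 1) * (C₁ * (N + 1) + (C₂ * (N + 1) + c2) + c3) ≤
        (c + 1) * (C₁ * (N + 1) + (C₂ * (N + 1) + c2 * (N + 1)) + c3 * (N + 1)) := by
      rw [Nat.sub_zero]
      gcongr
    calc _ ≤ c1 * ((N + 1) * (c + 1)) +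
        (c + 1) * (C₁ * (N + 1) + (C₂ * (N + 1) + c2 * (N + 1)) + c3 * (N + 1)) :=
          Nat.add_le_add h1 h4
      _ = _ := by ring
  · rintro s' ⟨e, ⟨h3, h12, h9, h4, L₁, hp, hch, hidx, hinv⟩, hc⟩
    have hge : ¬ s'.nat 4 0 < s'.nat 3 0 := hc
    rw [h3, hN, h4] at hge
    have hs := hch.pairwise (by rw [hp.length_eq]; omega)
    rw [crossInversions_eq_zero g h hs, add_zero] at hinv
    exact ⟨L₁, hp, hs, hidx, hinv⟩

end SortProgram

/-! ## Counting the sums in the intersection of two half-planes -/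

section InversionCount

variable {β γ : Type*} [LinearOrder β] [LinearOrder γ]

/-- In a list that is strictly sorted by `g₁`, standing later is the same as having the larger `g₁`.
The count thus becomes independent of the arrangement of the list. -/
theorem crossInversions_eq_sum (g₁ : ℕ → β) (g₂ : ℕ → γ) (h : ℕ) {L : List ℕ}
    (hL : L.Pairwise (fun a b => g₁ a < g₁ b)) :
    crossInversions g₂ h L = (L.map (fun a =>
      L.countP (fun b => g₁ a < g₁ b ∧ h ≤ a ∧ b < h ∧ g₂ b < g₂ a))).sum := by
  induction L with
  | nil => rfl
  | cons a L ih =>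
    rw [List.pairwise_cons] at hL
    rw [crossInversions, List.map_cons, List.sum_cons, ih hL.2]
    congr 1
    · rw [List.countP_cons_of_neg (by simp)]
      refine List.countP_congr fun b hb => ?_
      simp [hL.1 b hb]
    · congr 1
      refine List.map_congr_left fun b hb => ?_
      rw [List.countP_cons_of_neg]
      simp [(hL.1 b hb).not_gt]

theorem List.countP_range_eq_card (p : ℕ → Prop) [DecidablePred p] (m : ℕ) :
    (List.range m).countP (fun a => p a) = ((Finset.range m).filter p).card := by
  rw [Finset.card_def, Finset.filter_val, ← Multiset.countP_eq_card_filter]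
  rfl

-- An inversion for `g₂` in a list sorted by `g₁` is a pair on which the two orders disagree. In the
-- application the index `n + i` stands for the point `P i` and the index `j < n` for `Q j`, so the
-- threshold `n` selects mixed pairs.
open Classical in
theorem crossInversions_eq_card (g₁ : ℕ → β) (g₂ : ℕ → γ) (hg : Function.Injective g₁) {n : ℕ}
    {L : List ℕ} (hL : L.Perm (List.range (n + n))) (hs : L.Pairwise (fun a b => g₁ a ≤ g₁ b)) :
    crossInversions g₂ n L = (Finset.univ.filter (fun x : Fin n × Fin n =>
      g₁ (n + x.1) < g₁ x.2 ∧ g₂ x.2 < g₂ (n + x.1))).card := by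
  have hlt : L.Pairwise (fun a b => g₁ a < g₁ b) := by
    have hnd : L.Nodup := hL.nodup_iff.2 List.nodup_range
    refine (hs.and hnd).imp fun h => lt_of_le_of_ne h.1 fun he => h.2 (hg he)
  rw [crossInversions_eq_sum g₁ g₂ n hlt, (hL.map _).sum_eq]
  simp only [hL.countP_eq]
  have h1 : ∀ a, (List.range (n + n)).countP
      (fun b => g₁ a < g₁ b ∧ n ≤ a ∧ b < n ∧ g₂ b < g₂ a) = ((Finset.range (n + n)).filter
        (fun b => g₁ a < g₁ b ∧ n ≤ a ∧ b < n ∧ g₂ b < g₂ a)).card := fun a => by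
    rw [← List.countP_range_eq_card]
  simp only [h1]
  rw [← List.sum_toFinset _ List.nodup_range, List.toFinset_range, Finset.sum_range_add,
    Finset.sum_eq_zero, zero_add]
  · rw [Finset.card_filter, Fintype.sum_prod_type, ← Fin.sum_univ_eq_sum_range
      (fun i => ((Finset.range (n + n)).filter
        (fun b => g₁ (n + i) < g₁ b ∧ n ≤ n + i ∧ b < n ∧ g₂ b < g₂ (n + i))).card)]
    refine Finset.sum_congr rfl fun i _ => ?_
    rw [← Finset.card_filter]
    symm
    refine Finset.card_bij (fun j _ => (j : ℕ)) ?_ ?_ ?_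
    · intro j hj
      have := j.2
      simp only [Finset.mem_filter, Finset.mem_univ, true_and] at hj
      simp only [Finset.mem_filter, Finset.mem_range]
      exact ⟨by omega, hj.1, by omega, by omega, hj.2⟩
    · intro a _ b _ h
      exact Fin.ext h
    · intro b hb
      simp only [Finset.mem_filter, Finset.mem_range] at hb
      exact ⟨⟨b, hb.2.2.2.1⟩, by simp [hb.2.1, hb.2.2.2.2], rfl⟩
  · intro a ha
    have := Finset.mem_range.1 ha
    rw [Finset.card_eq_zero, Finset.filter_eq_empty_iff]
    rintro b - ⟨-, h, -⟩
    omega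

end InversionCount

open Classical in
/-- The number of pairs of indices whose points have a sum with the property `S`. -/
noncomputable def pairCount {n : ℕ} (P Q : Fin n → Fin 2 → ℝ) (S : (Fin 2 → ℝ) → Prop) : ℕ :=
  (Finset.univ.filter (fun x : Fin n × Fin n => S (P x.1 + Q x.2))).card

/-- The memory holds the point sets `P` and `Q`. -/
structure HoldsPoints {n : ℕ} (s : RamState) (P Q : Fin n → Fin 2 → ℝ) : Prop where
  n_eq : s.nat 0 1 = n
  P_eq : ∀ (i : Fin n) (j : Fin 2), s.real j i = P i j
  Q_eq : ∀ (i : Fin n) (j : Fin 2), s.real (2 + j) i = Q i j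

theorem HoldsPoints.of_frame {n : ℕ} {P Q : Fin n → Fin 2 → ℝ} {s s' : RamState}
    (h : HoldsPoints s P Q) (h0 : s'.nat 0 = s.nat 0) (hr : ∀ j < 4, s'.real j = s.real j) :
    HoldsPoints s' P Q := by
  refine ⟨by rw [h0, h.n_eq], fun i j => ?_, fun i j => ?_⟩
  · rw [hr j (by omega), h.P_eq]
  · rw [hr (2 + j) (by omega), h.Q_eq]

namespace CountProgram

open SortProgram

def initIdxHead : RamProgram :=
  .letNat 13 (.const 0) ;;
  .letNat 3 (.add (.get 0 (.const 1)) (.get 0 (.const 1))) ;;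
  .letNat 12 (.get 0 (.const 1))

def initIdxBody : RamProgram :=
  .setNat 1 (.var 13) (.var 13) ;; .letNat 13 (.add (.var 13) (.const 1))

/-- The indices `0, …, 2n - 1` in the array `1`. -/
def initIdx : RamProgram := initIdxHead ;; .while (.natLt (.var 13) (.var 3)) initIdxBody

/-- The linear form with the coefficients in the variables `u`, `v`, at the entry number `i` of the
point set in the arrays `a` and `a + 1`. -/
@[reducible] def formExpr (u v a : ℕ) (i : NatExpr) : RealExpr :=
  .add (.mul (.var u) (.get a i)) (.mul (.var v) (.get (a + 1) i))

/-- The index `i` gets the key `c - u (Q i)` and the index `n + i` the key `u (P i)`, so that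
comparing the keys of a point of `P` and a point of `Q` compares `u (p + q)` with `c`. -/
def loadBody (u v c : ℕ) : RamProgram :=
  .setReal 9 (.var 13) (.sub (.var c) (formExpr u v 2 (.var 13))) ;;
  .setReal 9 (.add (.get 0 (.const 1)) (.var 13)) (formExpr u v 0 (.var 13)) ;;
  .letNat 13 (.add (.var 13) (.const 1))

/-- Loading the keys for the comparison of the linear form with the variable `c`. -/
def load (u v c : ℕ) : RamProgram :=
  .letNat 13 (.const 0) ;; .while (.natLt (.var 13) (.get 0 (.const 1))) (loadBody u v c)

/-- Counting the sums `r` with `u r < c` and `c' ≤ u' r`; `u` and `c` are in the variables `10`,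
`11` and `12`, and `u'` and `c'` in `13`, `14` and `15`; the result is in the variable `11`. -/
def count : RamProgram := initIdx ;; load 10 11 12 ;; sort ;; load 13 14 15 ;; sort

theorem runs_initIdx : ∃ C : ℕ, ∀ s : RamState,
    initIdx.Runs s (C * (s.nat 0 1 + 1)) (fun s' => s'.nat 3 0 = s.nat 0 1 + s.nat 0 1 ∧
      s'.nat 12 0 = s.nat 0 1 ∧ Holds (s'.nat 1) 0 (List.range (s.nat 0 1 + s.nat 0 1))) := by
  refine ⟨initIdxHead.maxCost +
    2 * (initIdxBody.maxCost + (BoolExpr.natLt (.var 13) (.var 3)).cost), ?_⟩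
  intro s
  let I : ℕ → RamState → Prop := fun k s' => s'.nat 3 0 = s.nat 0 1 + s.nat 0 1 ∧
    s'.nat 12 0 = s.nat 0 1 ∧ s'.nat 13 0 + k = s.nat 0 1 + s.nat 0 1 ∧
    ∀ j < s'.nat 13 0, s'.nat 1 j = j
  have hinit : initIdxHead.Runs s initIdxHead.maxCost
      (fun s' => I (s.nat 0 1 + s.nat 0 1) s') :=
    RamProgram.runs_of_step rfl (by simp [I, initIdxHead])
  refine (hinit.seq fun s' hs' => RamProgram.runs_while I id initIdxBody.maxCost ?_ _ s' hs').mono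
    ?_ ?_
  · rintro k s' ⟨h3, h12, hk, hj⟩ hc
    have hlt : s'.nat 13 0 < s'.nat 3 0 := hc
    refine RamProgram.runs_of_step rfl ⟨k - 1, ⟨?_, ?_, ?_, ?_⟩, ?_⟩
    · rw [RamProgram.step_nat _ _ rfl, h3]
    · rw [RamProgram.step_nat _ _ rfl, h12]
    · simp [initIdxBody]; omega
    · intro j hj'
      simp [initIdxBody] at hj' ⊢
      split_ifs with hne
      · exact hne.symm
      · exact hj j (by omega)
    · simp only [id]; omega
  · simp only [id]
    generalize s.nat 0 1 = n
    nlinarith [Nat.zero_le (n * initIdxHead.maxCost)]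
  · rintro s' ⟨k, ⟨h3, h12, hk, hj⟩, hc⟩
    have hge : ¬ s'.nat 13 0 < s'.nat 3 0 := hc
    refine ⟨h3, h12, (holds_iff_getElem _ _ _).2 fun j hj' => ?_⟩
    simp at hj'
    simpa using hj j (by omega)

theorem runs_load (u v c : ℕ) (hu : u ≠ 9) (hv : v ≠ 9) (hc : c ≠ 9) : ∃ C : ℕ,
    ∀ s : RamState, (load u v c).Runs s (C * (s.nat 0 1 + 1)) (fun s' => ∀ i < s.nat 0 1,
      s'.real 9 i = s.real c 0 - (s.real u 0 * s.real 2 i + s.real v 0 * s.real 3 i) ∧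
      s'.real 9 (s.nat 0 1 + i) = s.real u 0 * s.real 0 i + s.real v 0 * s.real 1 i) := by
  refine ⟨(RamProgram.letNat 13 (.const 0)).maxCost +
    ((loadBody u v c).maxCost + (BoolExpr.natLt (.var 13) (.get 0 (.const 1))).cost), ?_⟩
  intro s
  let I : ℕ → RamState → Prop := fun k s' => s'.nat 0 = s.nat 0 ∧
    (∀ a ≠ 9, s'.real a = s.real a) ∧ s'.nat 13 0 + k = s.nat 0 1 ∧
    ∀ i < s'.nat 13 0,
      s'.real 9 i = s.real c 0 - (s.real u 0 * s.real 2 i + s.real v 0 * s.real 3 i) ∧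
      s'.real 9 (s.nat 0 1 + i) = s.real u 0 * s.real 0 i + s.real v 0 * s.real 1 i
  have hinit : (RamProgram.letNat 13 (.const 0)).Runs s
      (RamProgram.letNat 13 (.const 0)).maxCost (fun s' => I (s.nat 0 1) s') := by
    refine RamProgram.runs_of_step rfl ⟨?_, fun a _ => ?_, ?_, ?_⟩
    · rw [RamProgram.step_nat _ _ rfl]
    · rw [RamProgram.step_real _ _ rfl]
    · simp
    · simp
  refine (hinit.seq fun s' hs' =>
    RamProgram.runs_while I id (loadBody u v c).maxCost ?_ _ s' hs').mono ?_ ?_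
  · rintro k s' ⟨h0, hr, hk, hj⟩ hc'
    have hlt : s'.nat 13 0 < s'.nat 0 1 := hc'
    refine RamProgram.runs_of_step rfl ⟨k - 1, ⟨?_, fun a ha => ?_, ?_, ?_⟩, ?_⟩
    · rw [RamProgram.step_nat _ _ rfl, h0]
    · rw [RamProgram.step_real _ _ (by simp [loadBody, RamProgram.writesReal, ha]), hr a ha]
    · simp [loadBody]
      rw [h0] at hlt; omega
    · intro i hi
      rw [h0] at hlt
      simp [loadBody] at hi ⊢
      simp only [hu, hv, h0, hr _ (show (0 : ℕ) ≠ 9 by norm_num),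
        hr _ (show (1 : ℕ) ≠ 9 by norm_num), hr _ (show (2 : ℕ) ≠ 9 by norm_num),
        hr _ (show (3 : ℕ) ≠ 9 by norm_num), hr _ hu, hr _ hv, hr _ hc, false_and, if_false]
      by_cases hi' : i = s'.nat 13 0
      · subst hi'
        simp [show s.nat 0 1 ≠ 0 by omega]
      · have h1 : i ≠ s.nat 0 1 + s'.nat 13 0 := by omega
        have h2 : s.nat 0 1 + i ≠ s'.nat 13 0 := by omega
        simp [hi', h1, h2]
        exact hj i (by omega)
    · rw [h0] at hlt
      simp only [id]; omega
  · simp only [id]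
    generalize s.nat 0 1 = n
    nlinarith [Nat.zero_le (n * (RamProgram.letNat 13 (.const 0)).maxCost)]
  · rintro s' ⟨k, ⟨h0, hr, hk, hj⟩, hc'⟩
    have hge : ¬ s'.nat 13 0 < s'.nat 0 1 := hc'
    rw [h0] at hge
    exact fun i hi => hj i (by omega)

/-- The running time of `count`, up to a constant factor. -/
def countCost (n : ℕ) : ℕ := (n + n + 1) * (Nat.clog 2 (n + n) + 1)

/-- The first sort only establishes the order of the first keys; the second counts the inversions
against it. Ties are broken by the index, and points of `Q` have the smaller indices. An equality
thus puts `q` before `p` in both orders, which makes the first condition strict and the second one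
weak. -/
theorem runs_count : ∃ C : ℕ, ∀ (n : ℕ) (P Q : Fin n → Fin 2 → ℝ) (s : RamState),
    HoldsPoints s P Q → count.Runs s (C * countCost n) (fun s' =>
      s'.nat 11 0 = pairCount P Q (fun r =>
        s.real 10 0 * r 0 + s.real 11 0 * r 1 < s.real 12 0 ∧
        s.real 15 0 ≤ s.real 13 0 * r 0 + s.real 14 0 * r 1)) := by
  obtain ⟨C₁, h₁⟩ := runs_initIdx
  obtain ⟨C₂, h₂⟩ := runs_load 10 11 12 (by norm_num) (by norm_num) (by norm_num)
  obtain ⟨C₃, h₃⟩ := runs_load 13 14 15 (by norm_num) (by norm_num) (by norm_num)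
  obtain ⟨C₄, h₄⟩ := runs_sort
  refine ⟨C₁ + (C₂ + (C₄ + (C₃ + C₄))), ?_⟩
  intro n P Q s hPQ
  have hn := hPQ.n_eq
  have cost : ∀ (p : RamProgram) (s : RamState) (C : ℕ) (R : RamState → Prop),
      p.Runs s (C * (n + 1)) R → p.Runs s (C * countCost n) R := fun p s C R h => by
    refine h.mono (Nat.mul_le_mul_left _ ?_) (fun _ h => h)
    rw [countCost]
    calc n + 1 ≤ n + n + 1 := by omega
      _ ≤ _ := Nat.le_mul_of_pos_right _ (by omega)
  simp only [add_mul]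
  refine (cost _ _ _ _ (hn ▸ h₁ s)).frame.seq ?_
  rintro s₁ ⟨⟨a3, a12, aidx⟩, fn₁, fr₁⟩
  have hn₁ : s₁.nat 0 1 = n := by rw [fn₁ 0 rfl, hn]
  refine (cost _ _ _ _ (hn₁ ▸ h₂ s₁)).frame.seq ?_
  rintro s₂ ⟨hk₂, fn₂, fr₂⟩
  have hn₂ : s₂.nat 0 1 = n := by rw [fn₂ 0 rfl, hn₁]
  have hsort₂ := h₄ s₂ (List.range (n + n)) n (by rw [fn₂ 3 rfl, a3, List.length_range])
    (by rw [fn₂ 12 rfl, a12]) (by rwa [fn₂ 1 rfl])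
  rw [List.length_range] at hsort₂
  refine hsort₂.frame.seq ?_
  rintro s₃ ⟨⟨L, hL, hs, hidx, -⟩, fn₃, fr₃⟩
  have hn₃ : s₃.nat 0 1 = n := by rw [fn₃ 0 rfl, hn₂]
  refine (cost _ _ _ _ (hn₃ ▸ h₃ s₃)).frame.seq ?_
  rintro s₄ ⟨hk₄, fn₄, fr₄⟩
  have hlen : L.length = n + n := by rw [hL.length_eq, List.length_range]
  have hsort₄ := h₄ s₄ L n (by rw [fn₄ 3 rfl, fn₃ 3 rfl, fn₂ 3 rfl, a3, hlen])
    (by rw [fn₄ 12 rfl, fn₃ 12 rfl, fn₂ 12 rfl, a12]) (by rwa [fn₄ 1 rfl])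
  rw [hlen] at hsort₄
  refine hsort₄.mono le_rfl ?_
  rintro s₅ ⟨-, -, -, -, h11⟩
  rw [h11, crossInversions_eq_card (lexKey s₂) (lexKey s₄) (lexKey_injective s₂) hL hs, pairCount]
  refine congrArg Finset.card (Finset.ext fun x => ?_)
  simp only [Finset.mem_filter, Finset.mem_univ, true_and]
  have hp0 : s.real 0 x.1 = P x.1 0 := hPQ.P_eq x.1 0
  have hp1 : s.real 1 x.1 = P x.1 1 := hPQ.P_eq x.1 1
  have hq0 : s.real 2 x.2 = Q x.2 0 := hPQ.Q_eq x.2 0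
  have hq1 : s.real 3 x.2 = Q x.2 1 := hPQ.Q_eq x.2 1
  have e1 := (hk₂ x.1 x.1.2).2
  have e2 := (hk₂ x.2 x.2.2).1
  have e3 := (hk₄ x.1 x.1.2).2
  have e4 := (hk₄ x.2 x.2.2).1
  simp only [fr₃ _ (show sort.writesReal _ = false from rfl)] at e3 e4
  have f2 : ∀ a ≠ 9, s₂.real a = s₁.real a := fun a ha =>
    fr₂ a (by simp [load, loadBody, RamProgram.writesReal, ha])
  have f1 : ∀ a, s₁.real a = s.real a := fun a => fr₁ a rfl
  simp only [f2 _ (show (0 : ℕ) ≠ 9 by norm_num), f2 _ (show (1 : ℕ) ≠ 9 by norm_num),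
    f2 _ (show (2 : ℕ) ≠ 9 by norm_num), f2 _ (show (3 : ℕ) ≠ 9 by norm_num),
    f2 _ (show (13 : ℕ) ≠ 9 by norm_num), f2 _ (show (14 : ℕ) ≠ 9 by norm_num),
    f2 _ (show (15 : ℕ) ≠ 9 by norm_num), f1, hp0, hp1, hq0, hq1] at e1 e2 e3 e4
  have hx := x.2.2
  rw [lexKey_lt, lexKey_lt, e1, e2, e3, e4]
  simp only [Pi.add_apply]
  constructor
  · rintro ⟨h | h, h'⟩
    · refine ⟨by linarith, ?_⟩
      rcases h' with h' | h' <;> linarith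
    · omega
  · rintro ⟨h, h'⟩
    refine ⟨.inl (by linarith), ?_⟩
    rcases h'.lt_or_eq with h' | h'
    · exact .inl (by linarith)
    · exact .inr ⟨by linarith, by omega⟩

end CountProgram

/-! ## Upper envelopes of lines -/

/-- The stack `idx 0, …, idx (r - 1)` of lines with the breakpoints `x 0 < … < x (r - 1)` describes
the upper envelope, to the right of `x₀`, of the lines `y ↦ m i * y + c i` with `i ∈ S`. -/
structure IsEnvelope (m c : ℕ → ℝ) (S : Set ℕ) (x₀ : ℝ) (r : ℕ) (idx : ℕ → ℕ) (x : ℕ → ℝ) :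
    Prop where
  pos : ∀ i ∈ S, 0 < r
  bottom : 0 < r → x 0 = x₀
  lt : ∀ j, j + 1 < r → x j < x (j + 1)
  mem : ∀ j < r, idx j ∈ S
  le : ∀ i ∈ S, ∀ j < r, ∀ y, x j ≤ y → (j + 1 < r → y ≤ x (j + 1)) →
    m i * y + c i ≤ m (idx j) * y + c (idx j)

namespace IsEnvelope

variable {m c : ℕ → ℝ} {S : Set ℕ} {x₀ : ℝ} {r : ℕ} {idx : ℕ → ℕ} {x : ℕ → ℝ}

/-- Popping the line `r'` from the stack: the new line `k` lies above all lines to the right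
of `x r'`. -/
theorem pop (h : IsEnvelope m c S x₀ r idx x) {k r' : ℕ} (hk : ∀ i ∈ S, m i ≤ m k) (hr : r' < r)
    (hpop : r' + 1 < r → ∀ i ∈ S, ∀ y, x (r' + 1) ≤ y → m i * y + c i ≤ m k * y + c k)
    (hx : m (idx r') * x r' + c (idx r') ≤ m k * x r' + c k) :
    ∀ i ∈ S, ∀ y, x r' ≤ y → m i * y + c i ≤ m k * y + c k := by
  intro i hi y hy
  -- On the interval of the line `r'`, the line `k` starts at least as high and is at least as steep
  -- as the line `r'`, which dominates there; further right, the earlier pops apply.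
  by_cases hy' : r' + 1 < r → y ≤ x (r' + 1)
  · have h1 := h.le i hi r' hr y hy hy'
    have h2 := hk _ (h.mem r' hr)
    nlinarith
  · push Not at hy'
    exact hpop hy'.1 i hi y hy'.2.le

theorem push_bottom (h : IsEnvelope m c S x₀ r idx x) {k : ℕ}
    (hpop : 0 < r → ∀ i ∈ S, ∀ y, x 0 ≤ y → m i * y + c i ≤ m k * y + c k)
    {idx' : ℕ → ℕ} {x' : ℕ → ℝ} (hidx : idx' 0 = k) (hx : x' 0 = x₀) :
    IsEnvelope m c (insert k S) x₀ 1 idx' x' := by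
  refine ⟨fun _ _ => one_pos, fun _ => hx, fun j hj => by omega, fun j hj => ?_, ?_⟩
  · obtain rfl : j = 0 := by omega
    simp [hidx]
  · rintro i hi j hj y hy -
    obtain rfl : j = 0 := by omega
    rw [hidx]
    rcases hi with rfl | hi
    · exact le_rfl
    · exact hpop (h.pos i hi) i hi y (by rwa [h.bottom (h.pos i hi), ← hx])

/-- The slopes are equal here, so the new line is parallel to the top line and strictly below it and
never shows. Nothing was popped before either: a pop would put the new line at or above this
parallel line at the next breakpoint. -/
theorem push_skip (h : IsEnvelope m c S x₀ r idx x) {k r' : ℕ} (hk : ∀ i ∈ S, m i ≤ m k)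
    (hr : r' + 1 ≤ r)
    (hpop : r' + 1 < r → ∀ i ∈ S, ∀ y, x (r' + 1) ≤ y → m i * y + c i ≤ m k * y + c k)
    (hx : m k * x r' + c k < m (idx r') * x r' + c (idx r')) (hm : ¬ m (idx r') < m k) :
    IsEnvelope m c (insert k S) x₀ (r' + 1) idx x := by
  have hm' : m (idx r') = m k := le_antisymm (hk _ (h.mem r' hr)) (not_lt.1 hm)
  have hrr : r' + 1 = r := by
    by_contra hne
    have := hpop (by omega) _ (h.mem r' hr) _ le_rfl
    rw [hm'] at this hx
    linarith
  subst hrr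
  refine ⟨fun _ _ => Nat.succ_pos _, h.bottom, h.lt, fun j hj => Or.inr (h.mem j hj), ?_⟩
  rintro i (rfl | hi) j hj y hy hy'
  · have hkt : m i * y + c i ≤ m (idx r') * y + c (idx r') := by rw [hm'] at hx ⊢; linarith
    exact hkt.trans (h.le _ (h.mem r' hr) j hj y hy hy')
  · exact h.le i hi j hj y hy hy'

/-- The new breakpoint is the intersection of the line `k` with the line `r'`. It lies to the right
of `x r'`, where `k` is still lower; left of it the old envelope persists, and right of it `k`
dominates. -/
theorem push (h : IsEnvelope m c S x₀ r idx x) {k r' : ℕ} (hr : r' + 1 ≤ r)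
    (hpop : r' + 1 < r → ∀ i ∈ S, ∀ y, x (r' + 1) ≤ y → m i * y + c i ≤ m k * y + c k)
    (hx : m k * x r' + c k < m (idx r') * x r' + c (idx r')) (hm : m (idx r') < m k)
    {idx' : ℕ → ℕ} {x' : ℕ → ℝ} (hidx : ∀ j ≤ r', idx' j = idx j) (hxx : ∀ j ≤ r', x' j = x j)
    (hidx' : idx' (r' + 1) = k)
    (hx' : x' (r' + 1) = (c (idx r') - c k) / (m k - m (idx r'))) :
    IsEnvelope m c (insert k S) x₀ (r' + 2) idx' x' := by
  have hpos : 0 < m k - m (idx r') := by linarith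
  have hval : ∀ y, y ≤ x' (r' + 1) ↔ m k * y + c k ≤ m (idx r') * y + c (idx r') := by
    intro y
    rw [hx', le_div_iff₀ hpos]
    constructor <;> intro h <;> nlinarith
  have hval' : ∀ y, y < x' (r' + 1) ↔ m k * y + c k < m (idx r') * y + c (idx r') := by
    intro y
    rw [hx', lt_div_iff₀ hpos]
    constructor <;> intro h <;> nlinarith
  have hlt : x r' < x' (r' + 1) := (hval' _).2 hx
  refine ⟨fun _ _ => Nat.succ_pos _, fun _ => ?_, fun j hj => ?_, fun j hj => ?_, ?_⟩
  · rw [hxx 0 (Nat.zero_le _), h.bottom (by omega)]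
  · rcases (show j < r' ∨ j = r' by omega) with hj' | rfl
    · rw [hxx j (by omega), hxx (j + 1) (by omega)]
      exact h.lt j (by omega)
    · rwa [hxx j le_rfl]
  · rcases (show j ≤ r' ∨ j = r' + 1 by omega) with hj' | rfl
    · rw [hidx j hj']; exact Or.inr (h.mem j (by omega))
    · rw [hidx']; exact Or.inl rfl
  · intro i hi j hj y hy hy'
    rcases (show j < r' ∨ j = r' ∨ j = r' + 1 by omega) with hj' | rfl | rfl
    · have hy' := hy' (by omega)
      rw [hxx j (by omega)] at hy
      rw [hxx (j + 1) (by omega)] at hy'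
      rw [hidx j (by omega)]
      rcases hi with rfl | hi
      · have h1 : x (j + 1) ≤ x r' := by
          have : ∀ d, j + 1 + d ≤ r' → x (j + 1) ≤ x (j + 1 + d) := by
            intro d
            induction d with
            | zero => intro _; exact le_rfl
            | succ d ih => intro hd; exact (ih (by omega)).trans (h.lt _ (by omega)).le
          have := this (r' - (j + 1)) (by omega)
          rwa [show j + 1 + (r' - (j + 1)) = r' by omega] at this
        exact ((hval y).1 (by linarith)).trans
          (h.le _ (h.mem r' (by omega)) j (by omega) y hy (fun _ => hy'))
      · exact h.le i hi j (by omega) y hy (fun _ => hy')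
    · have hy' := hy' (by omega)
      rw [hxx j le_rfl] at hy
      rw [hidx j le_rfl]
      rcases hi with rfl | hi
      · exact (hval y).1 hy'
      · refine h.le i hi j (by omega) y hy fun hr' => ?_
        -- The new breakpoint is not to the right of the old `x (r' + 1)`, because by the pops the
        -- line `k` has caught up with the line `r'` there.
        refine hy'.trans (not_lt.1 fun hlt' => ?_)
        exact ((hval' _).1 hlt').not_ge (hpop hr' _ (h.mem j (by omega)) _ le_rfl)
    · rw [hidx']
      rcases hi with rfl | hi
      · exact le_rfl
      · have hk : m (idx r') * y + c (idx r') ≤ m k * y + c k := by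
          exact not_lt.1 ((hval' y).not.1 (not_lt.2 hy))
        by_cases hy2 : r' + 1 < r → y ≤ x (r' + 1)
        · exact (h.le i hi r' (by omega) y (by linarith) hy2).trans hk
        · push Not at hy2
          exact hpop hy2.1 i hi y hy2.2.le

end IsEnvelope

/-! ### Computing an upper envelope with a stack. -/

namespace EnvelopeProgram

/-- The arrays (line stack, stack height, breakpoints) and the side code of the envelope of the
left or the right constraints. -/
def IsSide (si r sx σ : ℕ) : Prop :=
  (si = 15 ∧ r = 16 ∧ sx = 19 ∧ σ = 1) ∨ (si = 17 ∧ r = 18 ∧ sx = 20 ∧ σ = 2)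

/-- The value at `x` of the line number `i`; slopes and intercepts are in the real arrays `17` and
`18`. -/
@[reducible] def lineExpr (i : NatExpr) (x : RealExpr) : RealExpr :=
  .add (.mul (.get 17 i) x) (.get 18 i)

@[reducible] def topExpr (r : ℕ) : NatExpr := .sub (.var r) (.const 1)

/-- Lines arrive in the order of their slopes. A new line that reaches the top line at the left end
of its interval stays above it from there on, so the top line is obsolete. -/
def popCond (si r sx : ℕ) : BoolExpr :=
  .and (.natLt (.const 0) (.var r))
    (.not (.realLt (lineExpr (.var 28) (.get sx (topExpr r)))
      (lineExpr (.get si (topExpr r)) (.get sx (topExpr r)))))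

def popBody (r : ℕ) : RamProgram := .letNat r (topExpr r)

def pushBottom (si r sx : ℕ) : RamProgram :=
  .setNat si (.const 0) (.var 28) ;;
  .letReal sx (.sub (.const 0) (.var 16)) ;;
  .letNat r (.const 1)

def push (si r sx : ℕ) : RamProgram :=
  .setReal sx (.var r) (.div (.sub (.get 18 (.get si (topExpr r))) (.get 18 (.var 28)))
    (.sub (.get 17 (.var 28)) (.get 17 (.get si (topExpr r))))) ;;
  .setNat si (.var r) (.var 28) ;;
  .letNat r (.add (.var r) (.const 1))

def pushLine (si r sx : ℕ) : RamProgram :=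
  .ite (.natLt (.var r) (.const 1)) (pushBottom si r sx)
    (.ite (.realLt (.get 17 (.get si (topExpr r))) (.get 17 (.var 28))) (push si r sx) .skip)

def sideCond (σ : ℕ) : BoolExpr :=
  .and (.not (.natLt (.get 14 (.var 28)) (.const σ))) (.not (.natLt (.const σ) (.get 14 (.var 28))))

def fetch : RamProgram := .letNat 28 (.get 1 (.var 24))

def advance : RamProgram := .letNat 24 (.add (.var 24) (.const 1))

def body (si r sx σ : ℕ) : RamProgram :=
  fetch ;;
  .ite (sideCond σ) (.while (popCond si r sx) (popBody r) ;; pushLine si r sx) .skip ;;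
  advance

def head (r : ℕ) : RamProgram := .letNat r (.const 0) ;; .letNat 24 (.const 0)

/-- The upper envelope, to the right of `-B`, of the lines of the side `σ`, taken in the order of
the array `1`; their number is in the variable `27`, the bound `B` in the variable `16` and the
sides of the lines in the array `14`. -/
def envelope (si r sx σ : ℕ) : RamProgram :=
  head r ;; .while (.natLt (.var 24) (.var 27)) (body si r sx σ)

/-- The states that agree with `s` outside of the arrays that `envelope` uses. -/
def Agrees (si r sx : ℕ) (s s' : RamState) : Prop :=
  (∀ a, a ≠ si → a ≠ r → a ≠ 24 → a ≠ 28 → s'.nat a = s.nat a) ∧ ∀ a ≠ sx, s'.real a = s.real a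

theorem Agrees.step {si r sx : ℕ} {s s' : RamState} (h : Agrees si r sx s s') (p : RamProgram)
    (hn : ∀ a, a ≠ si → a ≠ r → a ≠ 24 → a ≠ 28 → p.writesNat a = false)
    (hr : ∀ a ≠ sx, p.writesReal a = false) : Agrees si r sx s (p.step s') :=
  ⟨fun a h1 h2 h3 h4 => by rw [p.step_nat _ (hn a h1 h2 h3 h4), h.1 a h1 h2 h3 h4],
    fun a h1 => by rw [p.step_real _ (hr a h1), h.2 a h1]⟩

variable {si r sx σ : ℕ}

/-- Popping the lines below the line `k`. -/
theorem exec_pop (h : IsSide si r sx σ) {s₀ s : RamState} (hs : Agrees si r sx s₀ s) {S : Set ℕ}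
    {x₀ : ℝ} {k : ℕ} (hk28 : s.nat 28 0 = k) (hk : ∀ i ∈ S, s₀.real 17 i ≤ s₀.real 17 k)
    (hE : IsEnvelope (s₀.real 17) (s₀.real 18) S x₀ (s.nat r 0) (s.nat si) (s.real sx)) :
    ∃ t s', Exec (.while (popCond si r sx) (popBody r)) s t s' ∧ Agrees si r sx s₀ s' ∧
      s'.nat 28 = s.nat 28 ∧ s'.nat 24 = s.nat 24 ∧ s'.nat si = s.nat si ∧
      s'.real sx = s.real sx ∧ s'.nat r 0 ≤ s.nat r 0 ∧
      (s'.nat r 0 < s.nat r 0 → ∀ i ∈ S, ∀ y, s.real sx (s'.nat r 0) ≤ y →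
        s₀.real 17 i * y + s₀.real 18 i ≤ s₀.real 17 k * y + s₀.real 18 k) ∧
      ¬ (popCond si r sx).eval s' ∧
      t + s'.nat r 0 * ((popBody r).maxCost + (popCond si r sx).cost) ≤
        s.nat r 0 * ((popBody r).maxCost + (popCond si r sx).cost) + (popCond si r sx).cost := by
  have hne : r ≠ 28 ∧ r ≠ 24 ∧ r ≠ si ∧ sx ≠ 17 ∧ sx ≠ 18 := by
    rcases h with ⟨rfl, rfl, rfl, rfl⟩ | ⟨rfl, rfl, rfl, rfl⟩ <;> decide
  obtain ⟨n28, n24, nsi, n17, n18⟩ := hne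
  let I : ℕ → RamState → Prop := fun r' s' => Agrees si r sx s₀ s' ∧
      s'.nat 28 = s.nat 28 ∧ s'.nat 24 = s.nat 24 ∧ s'.nat si = s.nat si ∧
      s'.real sx = s.real sx ∧ s'.nat r 0 = r' ∧ r' ≤ s.nat r 0 ∧
      (r' < s.nat r 0 → ∀ i ∈ S, ∀ y, s.real sx r' ≤ y →
        s₀.real 17 i * y + s₀.real 18 i ≤ s₀.real 17 k * y + s₀.real 18 k)
  have hstep : ∀ g s', I g s' → (popCond si r sx).eval s' → ∃ t s'' g', Exec (popBody r) s' t s'' ∧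
      I g' s'' ∧ t + (popCond si r sx).cost + g' * ((popBody r).maxCost + (popCond si r sx).cost) ≤
        g * ((popBody r).maxCost + (popCond si r sx).cost) := by
    rintro g s' ⟨hA, h28, h24, hsi, hsx, hr, hle, hpop⟩ hc
    obtain ⟨hpos, hx⟩ := hc
    simp only [NatExpr.eval, RealExpr.eval, BoolExpr.eval, hr, h28, hk28, hsi, hsx,
      hA.2 17 n17.symm, hA.2 18 n18.symm, not_lt] at hpos hx
    obtain ⟨t, s'', he, ht, hs''⟩ := (popBody r).runs_step rfl s'
    refine ⟨t, s'', g - 1, he, ?_, ?_⟩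
    · subst hs''
      refine ⟨hA.step _ ?_ ?_, ?_, ?_, ?_, ?_, ?_, by omega, fun hlt => ?_⟩
      · intro a h1 h2 h3 h4
        simp [popBody, RamProgram.writesNat, h2]
      · intro a _; rfl
      · rw [RamProgram.step_nat _ _ (by simp [popBody, RamProgram.writesNat, n28.symm]), h28]
      · rw [RamProgram.step_nat _ _ (by simp [popBody, RamProgram.writesNat, n24.symm]), h24]
      · rw [RamProgram.step_nat _ _ (by simp [popBody, RamProgram.writesNat, nsi.symm]), hsi]
      · rw [RamProgram.step_real _ _ rfl, hsx]
      · simp [popBody, hr]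
      · refine hE.pop hk hlt (fun hlt' => ?_) hx
        rw [Nat.sub_add_cancel hpos] at hlt' ⊢
        exact hpop hlt'
    · calc t + (popCond si r sx).cost +
          (g - 1) * ((popBody r).maxCost + (popCond si r sx).cost)
          ≤ (popBody r).maxCost + (popCond si r sx).cost +
            (g - 1) * ((popBody r).maxCost + (popCond si r sx).cost) := by omega
        _ = (g - 1 + 1) * ((popBody r).maxCost + (popCond si r sx).cost) := by ring
        _ = _ := by rw [Nat.sub_add_cancel hpos]
  obtain ⟨t, s', r', he, ⟨hA, h28, h24, hsi, hsx, hr, hle, hpop⟩, hc, ht⟩ :=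
    RamProgram.exec_while I _ hstep (s.nat r 0) s
      ⟨hs, rfl, rfl, rfl, rfl, rfl, le_rfl, fun h => absurd h (lt_irrefl _)⟩
  subst hr
  exact ⟨t, s', he, hA, h28, h24, hsi, hsx, hle, hpop, hc, ht⟩

theorem pushLine_step (h : IsSide si r sx σ) {s₀ s : RamState} (hs : Agrees si r sx s₀ s)
    {S : Set ℕ} {k r₀ : ℕ} (hk28 : s.nat 28 0 = k)
    (hk : ∀ i ∈ S, s₀.real 17 i ≤ s₀.real 17 k)
    (hE : IsEnvelope (s₀.real 17) (s₀.real 18) S (-s₀.real 16 0) r₀ (s.nat si) (s.real sx))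
    (hr : s.nat r 0 ≤ r₀)
    (hpop : s.nat r 0 < r₀ → ∀ i ∈ S, ∀ y, s.real sx (s.nat r 0) ≤ y →
        s₀.real 17 i * y + s₀.real 18 i ≤ s₀.real 17 k * y + s₀.real 18 k)
    (hc : ¬ (popCond si r sx).eval s) :
    Agrees si r sx s₀ ((pushLine si r sx).step s) ∧
      ((pushLine si r sx).step s).nat 24 0 = s.nat 24 0 ∧
      ((pushLine si r sx).step s).nat r 0 ≤ s.nat r 0 + 1 ∧
      IsEnvelope (s₀.real 17) (s₀.real 18) (insert k S) (-s₀.real 16 0)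
        (((pushLine si r sx).step s).nat r 0) (((pushLine si r sx).step s).nat si)
        (((pushLine si r sx).step s).real sx) := by
  refine ⟨hs.step _ ?_ ?_, ?_, ?_⟩
  · intro a h1 h2 h3 h4
    simp [pushLine, pushBottom, push, RamProgram.writesNat, h1, h2]
  · intro a h1
    simp [pushLine, pushBottom, push, RamProgram.writesReal, h1]
  · rw [RamProgram.step_nat]
    rcases h with ⟨rfl, rfl, rfl, rfl⟩ | ⟨rfl, rfl, rfl, rfl⟩ <;> rfl
  have h16 : s.real 16 = s₀.real 16 := hs.2 16 (by
    rcases h with ⟨rfl, rfl, rfl, rfl⟩ | ⟨rfl, rfl, rfl, rfl⟩ <;> decide)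
  have h17 : s.real 17 = s₀.real 17 := hs.2 17 (by
    rcases h with ⟨rfl, rfl, rfl, rfl⟩ | ⟨rfl, rfl, rfl, rfl⟩ <;> decide)
  have h18 : s.real 18 = s₀.real 18 := hs.2 18 (by
    rcases h with ⟨rfl, rfl, rfl, rfl⟩ | ⟨rfl, rfl, rfl, rfl⟩ <;> decide)
  by_cases h0 : s.nat r 0 < 1
  · have e : (pushLine si r sx).step s = (pushBottom si r sx).step s := by
      rw [pushLine, RamProgram.step, if_pos (show BoolExpr.eval s (.natLt (.var r) (.const 1)) from h0)]
    have h0' : s.nat r 0 = 0 := by omega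
    rw [e]
    have e1 : ((pushBottom si r sx).step s).nat r 0 = 1 := by simp [pushBottom]
    have e2 : ((pushBottom si r sx).step s).nat si 0 = k := by
      rcases h with ⟨rfl, rfl, rfl, rfl⟩ | ⟨rfl, rfl, rfl, rfl⟩ <;> simp [pushBottom, hk28]
    have e3 : ((pushBottom si r sx).step s).real sx 0 = -s₀.real 16 0 := by
      simp [pushBottom, h16]
    rw [e1]
    exact ⟨by omega, hE.push_bottom (fun hr => by rw [h0'] at hpop; exact hpop hr) e2 e3⟩
  · obtain ⟨r', hr'⟩ : ∃ r', s.nat r 0 = r' + 1 := ⟨s.nat r 0 - 1, by omega⟩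
    have hx : s₀.real 17 k * s.real sx r' + s₀.real 18 k <
        s₀.real 17 (s.nat si r') * s.real sx r' + s₀.real 18 (s.nat si r') := by
      by_contra hx
      refine hc ⟨?_, ?_⟩
      · simp [BoolExpr.eval, NatExpr.eval, hr']
      · simpa [BoolExpr.eval, hr', hk28, h17, h18] using hx
    rw [hr'] at hpop hr
    by_cases hm : s₀.real 17 (s.nat si r') < s₀.real 17 k
    · have e : (pushLine si r sx).step s = (push si r sx).step s := by
        rw [pushLine, RamProgram.step, if_neg (show ¬ BoolExpr.eval s (.natLt (.var r) (.const 1))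
          from h0), RamProgram.step, if_pos]
        simpa [hr', hk28, h17] using hm
      rw [e]
      have e1 : ((push si r sx).step s).nat r 0 = r' + 2 := by
        rcases h with ⟨rfl, rfl, rfl, rfl⟩ | ⟨rfl, rfl, rfl, rfl⟩ <;> simp [push, hr']
      have e2 : ∀ j, ((push si r sx).step s).nat si j =
          if j = r' + 1 then k else s.nat si j := by
        intro j
        rcases h with ⟨rfl, rfl, rfl, rfl⟩ | ⟨rfl, rfl, rfl, rfl⟩ <;> simp [push, hr', hk28]
      have e3 : ∀ j, ((push si r sx).step s).real sx j = if j = r' + 1 then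
          (s₀.real 18 (s.nat si r') - s₀.real 18 k) / (s₀.real 17 k - s₀.real 17 (s.nat si r'))
          else s.real sx j := by
        intro j
        simp [push, hr', hk28, h17, h18]
      rw [e1]
      refine ⟨by omega, hE.push hr hpop hx hm (fun j hj => ?_) (fun j hj => ?_) ?_ ?_⟩
      · rw [e2, if_neg (by omega)]
      · rw [e3, if_neg (by omega)]
      · rw [e2, if_pos rfl]
      · rw [e3, if_pos rfl]
    · have e : (pushLine si r sx).step s = s := by
        rw [pushLine, RamProgram.step, if_neg (show ¬ BoolExpr.eval s (.natLt (.var r) (.const 1))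
          from h0), RamProgram.step, if_neg]
        · rfl
        · simpa [hr', hk28, h17] using hm
      rw [e, hr']
      exact ⟨by omega, hE.push_skip hk hr hpop hx hm⟩

/-- Linear time by amortization: one line may cause many pops, but each pop removes an earlier push.
The potential charges `K` for every line still to come and `W` for every line on the stack; `K`
contains a `W` that prepays the later pop of the pushed line. -/
theorem runs_envelope (h : IsSide si r sx σ) : ∃ C : ℕ, ∀ (s : RamState) (L : List ℕ),
    s.nat 27 0 = L.length → Holds (s.nat 1) 0 L →
    L.Pairwise (fun a b => s.real 17 a ≤ s.real 17 b) →
    (envelope si r sx σ).Runs s (C * (L.length + 1)) (fun s' =>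
      IsEnvelope (s.real 17) (s.real 18) {i | i ∈ L ∧ s.nat 14 i = σ} (-s.real 16 0)
        (s'.nat r 0) (s'.nat si) (s'.real sx) ∧ s'.nat r 0 ≤ L.length) := by
  set W := (popBody r).maxCost + (popCond si r sx).cost with hW
  set D := (BoolExpr.natLt (.var 24) (.var 27)).cost with hD
  set K := fetch.maxCost + (sideCond σ).cost + (popCond si r sx).cost + (pushLine si r sx).maxCost +
    1 + advance.maxCost + D + W with hK
  have hne : si ≠ 24 ∧ r ≠ 24 ∧ si ≠ 28 ∧ r ≠ 28 ∧ si ≠ 1 ∧ r ≠ 1 ∧ si ≠ 14 ∧ r ≠ 14 ∧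
      si ≠ 27 ∧ r ≠ 27 ∧ r ≠ si := by
    rcases h with ⟨rfl, rfl, rfl, rfl⟩ | ⟨rfl, rfl, rfl, rfl⟩ <;> decide
  obtain ⟨nsi24, nr24, nsi28, nr28, nsi1, nr1, nsi14, nr14, nsi27, nr27, nrsi⟩ := hne
  refine ⟨(head r).maxCost + K + D, ?_⟩
  intro s L hN hL hs
  let S : ℕ → Set ℕ := fun t => {i | i ∈ L.take t ∧ s.nat 14 i = σ}
  let I : ℕ × ℕ → RamState → Prop := fun g s' => Agrees si r sx s s' ∧
    s'.nat 24 0 + g.1 = L.length ∧ s'.nat r 0 = g.2 ∧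
    IsEnvelope (s.real 17) (s.real 18) (S (s'.nat 24 0)) (-s.real 16 0)
        (s'.nat r 0) (s'.nat si) (s'.real sx) ∧ s'.nat r 0 ≤ s'.nat 24 0
  have hinit : (head r).Runs s (head r).maxCost (fun s' => I (L.length, 0) s') := by
    have e1 : ((head r).step s).nat 24 0 = 0 := by simp [head]
    have e2 : ((head r).step s).nat r 0 = 0 := by simp [head, nr24]
    refine RamProgram.runs_of_step rfl ⟨?_, by rw [e1]; simp, e2, ?_, by rw [e1, e2]⟩
    · refine Agrees.step ⟨fun _ _ _ _ _ => rfl, fun _ _ => rfl⟩ _ ?_ ?_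
      · intro a h1 h2 h3 h4
        simp [head, RamProgram.writesNat, h2, h3]
      · intro a _; rfl
    · rw [e1, e2]
      refine ⟨?_, ?_, ?_, ?_, ?_⟩ <;> simp [S]
  refine (hinit.seq (T₂ := L.length * K + D) fun s₁ hs₁ => ?_).mono ?_ (fun s' h => h)
  · have hstep : ∀ g s', I g s' → (BoolExpr.natLt (.var 24) (.var 27)).eval s' →
        ∃ t s'' g', Exec (body si r sx σ) s' t s'' ∧ I g' s'' ∧
          t + D + (g'.1 * K + g'.2 * W) ≤ g.1 * K + g.2 * W := by
      rintro ⟨n, ρ⟩ s' ⟨hA, hn, hr, hE, hrt⟩ hc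
      have hlt : s'.nat 24 0 < s'.nat 27 0 := hc
      rw [hA.1 27 nsi27.symm nr27.symm (by decide) (by decide), hN] at hlt
      simp only at hn hr
      obtain ⟨n, rfl⟩ : ∃ n', n = n' + 1 := ⟨n - 1, by omega⟩
      set t := s'.nat 24 0 with ht
      set k := L[t] with hkdef
      have hk1 : s'.nat 1 t = k := by
        rw [hA.1 1 nsi1.symm nr1.symm (by decide) (by decide)]
        simpa using (holds_iff_getElem _ _ _).1 hL t hlt
      obtain ⟨t₂, s₂, e₂, ht₂, rfl⟩ := fetch.runs_step rfl s'
      set s₂ := fetch.step s' with hs₂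
      have hA₂ : Agrees si r sx s s₂ := hA.step _ (fun a h1 h2 h3 h4 => by
        simp [fetch, RamProgram.writesNat, h4]) (fun _ _ => rfl)
      have k28 : s₂.nat 28 0 = k := by simp [hs₂, fetch, ← ht, hk1]
      have k24 : s₂.nat 24 = s'.nat 24 := RamProgram.step_nat _ _ rfl
      have ksi : s₂.nat si = s'.nat si :=
        RamProgram.step_nat _ _ (by simp [fetch, RamProgram.writesNat, nsi28])
      have kr : s₂.nat r = s'.nat r :=
        RamProgram.step_nat _ _ (by simp [fetch, RamProgram.writesNat, nr28])
      have ksx : s₂.real sx = s'.real sx := RamProgram.step_real _ _ rfl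
      have htake : ∀ i, i ∈ L.take (t + 1) ↔ i = k ∨ i ∈ L.take t := by
        intro i
        rw [List.take_succ_eq_append_getElem hlt, List.mem_append, List.mem_singleton, or_comm]
      have h14 : s₂.nat 14 k = s.nat 14 k := by
        rw [hA₂.1 14 nsi14.symm nr14.symm (by decide) (by decide)]
      have hside : (sideCond σ).eval s₂ ↔ s.nat 14 k = σ := by
        simp only [sideCond, BoolExpr.eval, NatExpr.eval, k28, h14]; omega
      obtain ⟨t₃, s₃, e₃, hA₃, h24, hr₃, hE₃, hcost⟩ : ∃ t₃ s₃,
          Exec (.ite (sideCond σ) (.while (popCond si r sx) (popBody r) ;; pushLine si r sx) .skip)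
            s₂ t₃ s₃ ∧ Agrees si r sx s s₃ ∧ s₃.nat 24 0 = t ∧ s₃.nat r 0 ≤ t + 1 ∧
          IsEnvelope (s.real 17) (s.real 18) (S (t + 1)) (-s.real 16 0)
            (s₃.nat r 0) (s₃.nat si) (s₃.real sx) ∧
          t₃ + s₃.nat r 0 * W ≤ (sideCond σ).cost + (popCond si r sx).cost +
            (pushLine si r sx).maxCost + 1 + W + ρ * W := by
        by_cases hσ : s.nat 14 k = σ
        · have hkS : ∀ i ∈ S t, s.real 17 i ≤ s.real 17 k := by
            rintro i ⟨hi, -⟩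
            obtain ⟨j, hj, rfl⟩ := List.mem_iff_getElem.1 hi
            rw [List.length_take] at hj
            rw [List.getElem_take]
            exact List.pairwise_iff_getElem.1 hs j t (by omega) hlt (by omega)
          have hE₂ : IsEnvelope (s.real 17) (s.real 18) (S t) (-s.real 16 0)
              (s₂.nat r 0) (s₂.nat si) (s₂.real sx) := by rw [kr, ksi, ksx]; exact hE
          obtain ⟨t₄, s₄, e₄, hA₄, f28, f24, fsi, fsx, hle, hpop, hc₄, hcost₄⟩ :=
            exec_pop h hA₂ k28 hkS hE₂
          obtain ⟨t₅, s₅, e₅, ht₅, rfl⟩ := (pushLine si r sx).runs_step rfl s₄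
          obtain ⟨hA₅, f24', hr₅, hE₅⟩ := pushLine_step h hA₄ (by rw [f28, k28]) hkS
            (by rw [fsi, fsx]; exact hE₂) hle (by rw [fsx]; exact hpop) hc₄
          refine ⟨_, _, .iteTrue (hside.2 hσ) (.seq e₄ e₅), hA₅, by rw [f24', f24, k24],
            by rw [kr] at hle; omega,
            ?_, ?_⟩
          · have : S (t + 1) = insert k (S t) := by
              ext i
              simp only [S, Set.mem_ofPred_eq, htake, Set.mem_insert_iff]
              constructor
              · rintro ⟨rfl | hi, hi'⟩
                · exact .inl rfl
                · exact .inr ⟨hi, hi'⟩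
              · rintro (rfl | hi)
                · exact ⟨.inl rfl, hσ⟩
                · exact ⟨.inr hi.1, hi.2⟩
            rw [this]; exact hE₅
          · rw [kr, hr, ← hW] at hcost₄
            have := Nat.mul_le_mul_right W hr₅
            rw [add_mul, one_mul] at this
            omega
        · refine ⟨_, _, .iteFalse (fun hc => hσ (hside.1 hc)) (.skip s₂), hA₂, by rw [k24],
            by rw [kr]; omega,
            ?_, ?_⟩
          · have : S (t + 1) = S t := by
              ext i
              simp only [S, Set.mem_ofPred_eq, htake]
              constructor
              · rintro ⟨rfl | hi, hi'⟩
                · exact absurd hi' hσ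
                · exact ⟨hi, hi'⟩
              · rintro hi
                exact ⟨.inr hi.1, hi.2⟩
            rw [this, kr, ksi, ksx]; exact hE
          · rw [kr, hr]; omega
      obtain ⟨t₆, s₆, e₆, ht₆, rfl⟩ := advance.runs_step rfl s₃
      have f24 : (advance.step s₃).nat 24 0 = t + 1 := by simp [advance, h24]
      have fr : (advance.step s₃).nat r = s₃.nat r :=
        RamProgram.step_nat _ _ (by simp [advance, RamProgram.writesNat, nr24])
      have fsi : (advance.step s₃).nat si = s₃.nat si :=
        RamProgram.step_nat _ _ (by simp [advance, RamProgram.writesNat, nsi24])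
      have fsx : (advance.step s₃).real sx = s₃.real sx := RamProgram.step_real _ _ rfl
      refine ⟨_, _, (n, s₃.nat r 0), .seq e₂ (.seq e₃ e₆), ⟨hA₃.step _ (fun a h1 h2 h3 h4 => by
        simp [advance, RamProgram.writesNat, h3]) (fun _ _ => rfl), ?_, ?_, ?_, by rw [f24, fr]; exact hr₃⟩, ?_⟩
      · rw [f24]; simp only; omega
      · rw [fr]
      · rw [f24, fr, fsi, fsx]; exact hE₃
      · simp only
        rw [add_mul, one_mul]
        omega
    obtain ⟨t, s', ⟨n, ρ⟩, he, ⟨hA, hn, hr, hE, hrt⟩, hc, ht⟩ :=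
      RamProgram.exec_while I (fun g => g.1 * K + g.2 * W) hstep (L.length, 0) s₁ hs₁
    refine ⟨t, s', he, ?_, ?_⟩
    · simp only [zero_mul, add_zero] at ht
      rw [hD]; omega
    · have hge : ¬ s'.nat 24 0 < s'.nat 27 0 := hc
      rw [hA.1 27 nsi27.symm nr27.symm (by decide) (by decide), hN] at hge
      have : S (s'.nat 24 0) = {i | i ∈ L ∧ s.nat 14 i = σ} := by
        simp only [S]
        rw [List.take_of_length_le (by omega)]
      rw [this] at hE
      exact ⟨hE, by omega⟩
  · nlinarith [Nat.zero_le (L.length * (head r).maxCost), Nat.zero_le (L.length * D)]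

end EnvelopeProgram

/-! ## The constraints as lines over the axis of the objective values -/

/-- The coefficient of the objective value in the linear form with the coefficients `a₀`, `a₁`. -/
def alongCoeff (f₀ f₁ a₀ a₁ : ℝ) : ℝ := a₀ * f₀ + a₁ * f₁

/-- The coefficient of the direction orthogonal to the objective function. -/
def acrossCoeff (f₀ f₁ a₀ a₁ : ℝ) : ℝ := a₁ * f₀ - a₀ * f₁

/-- `1` for a constraint that bounds the orthogonal direction from below, `2` for one that bounds
it from above, `0` otherwise. -/
noncomputable def lineSide (f₀ f₁ a₀ a₁ : ℝ) : ℕ :=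
  if 0 < acrossCoeff f₀ f₁ a₀ a₁ then 1 else if acrossCoeff f₀ f₁ a₀ a₁ < 0 then 2 else 0

/-- Constraints of side `1` are solved for the orthogonal coordinate `x`, those of side `2` for
`-x`. Both kinds become lower bounds, and one algorithm for upper envelopes serves both. The value
`0` for the other constraints is a placeholder. -/
noncomputable def lineSlope (f₀ f₁ a₀ a₁ : ℝ) : ℝ :=
  if 0 < acrossCoeff f₀ f₁ a₀ a₁ then (0 - alongCoeff f₀ f₁ a₀ a₁) / acrossCoeff f₀ f₁ a₀ a₁
  else if acrossCoeff f₀ f₁ a₀ a₁ < 0 then alongCoeff f₀ f₁ a₀ a₁ / acrossCoeff f₀ f₁ a₀ a₁ else 0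

noncomputable def lineIntercept (f₀ f₁ a₀ a₁ b : ℝ) : ℝ :=
  if 0 < acrossCoeff f₀ f₁ a₀ a₁ then b * (f₀ * f₀ + f₁ * f₁) / acrossCoeff f₀ f₁ a₀ a₁
  else if acrossCoeff f₀ f₁ a₀ a₁ < 0 then
    (0 - b * (f₀ * f₀ + f₁ * f₁)) / acrossCoeff f₀ f₁ a₀ a₁ else 0

section Lines

variable {f₀ f₁ a₀ a₁ b r₀ r₁ : ℝ}

/-- The expansion of `r` in the orthogonal basis `(f₀, f₁)`, `(-f₁, f₀)`, multiplied by the squared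
length of the basis vectors. -/
theorem norm_mul_form (f₀ f₁ a₀ a₁ r₀ r₁ : ℝ) : (a₀ * r₀ + a₁ * r₁) * (f₀ * f₀ + f₁ * f₁) =
    alongCoeff f₀ f₁ a₀ a₁ * (f₀ * r₀ + f₁ * r₁) +
      acrossCoeff f₀ f₁ a₀ a₁ * (f₀ * r₁ - f₁ * r₀) := by
  rw [alongCoeff, acrossCoeff]; ring

theorem le_form_iff (hf : 0 < f₀ * f₀ + f₁ * f₁) : b ≤ a₀ * r₀ + a₁ * r₁ ↔
    b * (f₀ * f₀ + f₁ * f₁) ≤ alongCoeff f₀ f₁ a₀ a₁ * (f₀ * r₀ + f₁ * r₁) +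
      acrossCoeff f₀ f₁ a₀ a₁ * (f₀ * r₁ - f₁ * r₀) := by
  rw [← norm_mul_form, mul_le_mul_iff_left₀ hf]

theorem le_form_iff_of_side_eq_one (hf : 0 < f₀ * f₀ + f₁ * f₁)
    (h : lineSide f₀ f₁ a₀ a₁ = 1) : b ≤ a₀ * r₀ + a₁ * r₁ ↔
    lineSlope f₀ f₁ a₀ a₁ * (f₀ * r₀ + f₁ * r₁) + lineIntercept f₀ f₁ a₀ a₁ b ≤
      f₀ * r₁ - f₁ * r₀ := by
  have hpos : 0 < acrossCoeff f₀ f₁ a₀ a₁ := by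
    by_contra hn
    rw [lineSide, if_neg hn] at h
    split_ifs at h
    omega
  rw [le_form_iff hf, lineSlope, lineIntercept, if_pos hpos, if_pos hpos, div_mul_eq_mul_div,
    ← add_div, div_le_iff₀ hpos]
  constructor <;> intro h <;> linarith

theorem le_form_iff_of_side_eq_two (hf : 0 < f₀ * f₀ + f₁ * f₁)
    (h : lineSide f₀ f₁ a₀ a₁ = 2) : b ≤ a₀ * r₀ + a₁ * r₁ ↔
    lineSlope f₀ f₁ a₀ a₁ * (f₀ * r₀ + f₁ * r₁) + lineIntercept f₀ f₁ a₀ a₁ b ≤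
      -(f₀ * r₁ - f₁ * r₀) := by
  have hneg : ¬ 0 < acrossCoeff f₀ f₁ a₀ a₁ ∧ acrossCoeff f₀ f₁ a₀ a₁ < 0 := by
    have hn : ¬ 0 < acrossCoeff f₀ f₁ a₀ a₁ := fun hp => by
      rw [lineSide, if_pos hp] at h; omega
    refine ⟨hn, by_contra fun hn' => ?_⟩
    rw [lineSide, if_neg hn, if_neg hn'] at h
    omega
  rw [le_form_iff hf, lineSlope, lineIntercept, if_neg hneg.1, if_neg hneg.1, if_pos hneg.2,
    if_pos hneg.2, div_mul_eq_mul_div, ← add_div, div_le_iff_of_neg hneg.2]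
  constructor <;> intro h <;> linarith

theorem acrossCoeff_eq_zero (h₁ : lineSide f₀ f₁ a₀ a₁ ≠ 1) (h₂ : lineSide f₀ f₁ a₀ a₁ ≠ 2) :
    acrossCoeff f₀ f₁ a₀ a₁ = 0 := by
  unfold lineSide at h₁ h₂
  split_ifs at h₁ h₂ with h h'
  · exact absurd rfl h₁
  · exact absurd rfl h₂
  · exact le_antisymm (not_lt.1 h) (not_lt.1 h')

theorem lineSide_le_two : lineSide f₀ f₁ a₀ a₁ ≤ 2 := by
  unfold lineSide; split_ifs <;> omega

end Lines

/-! ### Translating the constraints into lines, with artificial bounds. -/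

namespace PrepareProgram

@[reducible] def f0Expr : RealExpr := .get 7 (.const 0)
@[reducible] def f1Expr : RealExpr := .get 7 (.const 1)
@[reducible] def sqExpr (a : ℕ) : RealExpr := .mul (.get a (.var 24)) (.get a (.var 24))

def boundHead : RamProgram :=
  .letReal 16 (.add (.const 1) (.var 24)) ;; .letNat 24 (.const 0)

def boundBody : RamProgram :=
  .letReal 16 (.add (.var 16)
    (.add (.add (sqExpr 0) (sqExpr 1)) (.add (sqExpr 2) (sqExpr 3)))) ;;
  .letNat 24 (.add (.var 24) (.const 1))

/-- A bound on the objective values, in the real variable `16`. -/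
def bound : RamProgram := boundHead ;; .while (.natLt (.var 24) (.get 0 (.const 1))) boundBody

/-- Two constraints that all points satisfy, one for each side, and the number of the constraints
in the variable `27`. -/
def addRows : RamProgram :=
  -- The new rows say `-B ≤ x` and `-B ≤ -x` for the orthogonal coordinate `x`. They keep both
  -- envelopes nonempty.
  .setReal 4 (.get 0 (.const 0)) (.sub (.const 0) f1Expr) ;;
  .setReal 5 (.get 0 (.const 0)) f0Expr ;;
  .setReal 6 (.get 0 (.const 0)) (.sub (.const 0) (.var 16)) ;;
  .setReal 4 (.add (.get 0 (.const 0)) (.const 1)) f1Expr ;;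
  .setReal 5 (.add (.get 0 (.const 0)) (.const 1)) (.sub (.const 0) f0Expr) ;;
  .setReal 6 (.add (.get 0 (.const 0)) (.const 1)) (.sub (.const 0) (.var 16)) ;;
  .letNat 27 (.add (.get 0 (.const 0)) (.const 2))

def linesHead : RamProgram :=
  .letReal 23 (.var 16) ;; .letNat 3 (.var 27) ;; .letNat 24 (.const 0)

def coeffs : RamProgram :=
  .letReal 25 (.add (.mul (.get 4 (.var 24)) f0Expr) (.mul (.get 5 (.var 24)) f1Expr)) ;;
  .letReal 26 (.sub (.mul (.get 5 (.var 24)) f0Expr) (.mul (.get 4 (.var 24)) f1Expr)) ;;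
  .letReal 27 (.mul (.get 6 (.var 24)) (.var 24)) ;;
  .setNat 1 (.var 24) (.var 24)

def setLine (σ : ℕ) (m c : RealExpr) : RamProgram :=
  .setNat 14 (.var 24) (.const σ) ;; .setReal 17 (.var 24) m ;; .setReal 18 (.var 24) c

/-- Without an orthogonal component, a constraint reads `γ ≤ α y`. For `α < 0` it bounds `y` from
above by `γ / α`, which is merged into variable `23`. For `α ≥ 0` it is inherited by every point
with a larger `y` than a feasible one, and nothing has to be recorded. -/
def classify : RamProgram :=
  .ite (.realLt (.const 0) (.var 26))
    (setLine 1 (.div (.sub (.const 0) (.var 25)) (.var 26)) (.div (.var 27) (.var 26)))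
    (.ite (.realLt (.var 26) (.const 0))
      (setLine 2 (.div (.var 25) (.var 26)) (.div (.sub (.const 0) (.var 27)) (.var 26)))
      (setLine 0 (.const 0) (.const 0) ;;
        .ite (.and (.realLt (.var 25) (.const 0)) (.realLt (.div (.var 27) (.var 25)) (.var 23)))
          (.letReal 23 (.div (.var 27) (.var 25))) .skip))

def linesBody : RamProgram :=
  -- The slope is duplicated in array `9`, from which the sort takes its keys.
  coeffs ;; classify ;; .setReal 9 (.var 24) (.get 17 (.var 24)) ;;
  .letNat 24 (.add (.var 24) (.const 1))

/-- The lines of the constraints, and the least upper bound that the constraints put on the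
objective value, in the real variable `23`. -/
def lines : RamProgram := linesHead ;; .while (.natLt (.var 24) (.var 27)) linesBody

theorem runs_bound : ∃ C : ℕ, ∀ s : RamState, bound.Runs s (C * (s.nat 0 1 + 1)) (fun s' =>
    s'.real 16 0 = 1 + s.real 24 0 + ∑ i ∈ Finset.range (s.nat 0 1),
      (s.real 0 i * s.real 0 i + s.real 1 i * s.real 1 i +
        (s.real 2 i * s.real 2 i + s.real 3 i * s.real 3 i))) := by
  refine ⟨boundHead.maxCost +
    (boundBody.maxCost + (BoolExpr.natLt (.var 24) (.get 0 (.const 1))).cost), ?_⟩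
  intro s
  let I : ℕ → RamState → Prop := fun k s' => s'.nat 0 = s.nat 0 ∧
    (∀ a < 4, s'.real a = s.real a) ∧ s'.nat 24 0 + k = s.nat 0 1 ∧
    s'.real 16 0 = 1 + s.real 24 0 + ∑ i ∈ Finset.range (s'.nat 24 0),
      (s.real 0 i * s.real 0 i + s.real 1 i * s.real 1 i +
        (s.real 2 i * s.real 2 i + s.real 3 i * s.real 3 i))
  have hinit : boundHead.Runs s boundHead.maxCost (fun s' => I (s.nat 0 1) s') := by
    refine RamProgram.runs_of_step rfl ⟨?_, fun a ha => ?_, ?_, ?_⟩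
    · rw [RamProgram.step_nat _ _ rfl]
    · rw [RamProgram.step_real _ _ (by simp [boundHead, RamProgram.writesReal]; omega)]
    · simp [boundHead]
    · simp [boundHead]
  refine (hinit.seq fun s' hs' =>
    RamProgram.runs_while I id boundBody.maxCost ?_ _ s' hs').mono ?_ ?_
  · rintro k s' ⟨h0, hr, hk, hB⟩ hc
    have hlt : s'.nat 24 0 < s'.nat 0 1 := hc
    rw [h0] at hlt
    have e24 : (boundBody.step s').nat 24 0 = s'.nat 24 0 + 1 := by simp [boundBody]
    refine RamProgram.runs_of_step rfl ⟨k - 1, ⟨?_, fun a ha => ?_, ?_, ?_⟩, ?_⟩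
    · rw [RamProgram.step_nat _ _ rfl, h0]
    · rw [RamProgram.step_real _ _ (by simp [boundBody, RamProgram.writesReal]; omega), hr a ha]
    · omega
    · rw [e24, Finset.sum_range_succ, ← add_assoc, ← hB]
      simp [boundBody, hr 0, hr 1, hr 2, hr 3]
    · simp only [id]; omega
  · simp only [id]
    generalize s.nat 0 1 = n
    nlinarith [Nat.zero_le (n * boundHead.maxCost)]
  · rintro s' ⟨k, ⟨h0, hr, hk, hB⟩, hc⟩
    have hge : ¬ s'.nat 24 0 < s'.nat 0 1 := hc
    rw [h0] at hge
    rw [hB, show s'.nat 24 0 = s.nat 0 1 by omega]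

/-- The lines number `i < t` are computed. -/
structure HasLines (s s' : RamState) (t : ℕ) : Prop where
  side : ∀ i < t, s'.nat 14 i = lineSide (s.real 7 0) (s.real 7 1) (s.real 4 i) (s.real 5 i)
  slope : ∀ i < t, s'.real 17 i = lineSlope (s.real 7 0) (s.real 7 1) (s.real 4 i) (s.real 5 i)
  icpt : ∀ i < t, s'.real 18 i =
    lineIntercept (s.real 7 0) (s.real 7 1) (s.real 4 i) (s.real 5 i) (s.real 6 i)
  key : ∀ i < t, s'.real 9 i = s'.real 17 i
  idx : ∀ i < t, s'.nat 1 i = i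
  top : ∀ y, y ≤ s'.real 23 0 ↔ y ≤ s.real 16 0 ∧ ∀ i < t,
    lineSide (s.real 7 0) (s.real 7 1) (s.real 4 i) (s.real 5 i) = 0 →
      alongCoeff (s.real 7 0) (s.real 7 1) (s.real 4 i) (s.real 5 i) < 0 →
      s.real 6 i * (s.real 7 0 * s.real 7 0 + s.real 7 1 * s.real 7 1) ≤
        alongCoeff (s.real 7 0) (s.real 7 1) (s.real 4 i) (s.real 5 i) * y

theorem linesBody_step {s s' : RamState} {t : ℕ} (ht : s'.nat 24 0 = t)
    (hD : s'.real 24 0 = s.real 7 0 * s.real 7 0 + s.real 7 1 * s.real 7 1)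
    (h4 : s'.real 4 = s.real 4) (h5 : s'.real 5 = s.real 5) (h6 : s'.real 6 = s.real 6)
    (h7 : s'.real 7 = s.real 7) (h : HasLines s s' t) :
    HasLines s (linesBody.step s') (t + 1) := by
  set α := alongCoeff (s.real 7 0) (s.real 7 1) (s.real 4 t) (s.real 5 t) with hα
  set β := acrossCoeff (s.real 7 0) (s.real 7 1) (s.real 4 t) (s.real 5 t) with hβ
  set γ := s.real 6 t * (s.real 7 0 * s.real 7 0 + s.real 7 1 * s.real 7 1) with hγ
  have e25 : (coeffs.step s').real 25 0 = α := by simp [coeffs, ht, h4, h5, h7, hα, alongCoeff]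
  have e26 : (coeffs.step s').real 26 0 = β := by simp [coeffs, ht, h4, h5, h7, hβ, acrossCoeff]
  have e27 : (coeffs.step s').real 27 0 = γ := by simp [coeffs, ht, h6, hD, hγ]
  have e1 : ∀ i, (linesBody.step s').nat 1 i = if i = t then t else s'.nat 1 i := by
    intro i
    have : (linesBody.step s').nat 1 i = (coeffs.step s').nat 1 i := by
      rw [linesBody, RamProgram.step_seq, RamProgram.step_nat _ _ rfl]
    rw [this]; simp [coeffs, ht]
  have c24 : (coeffs.step s').nat 24 0 = t := by simp [coeffs, ht]
  have c14 : (coeffs.step s').nat 14 = s'.nat 14 := RamProgram.step_nat _ _ rfl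
  have c17 : (coeffs.step s').real 17 = s'.real 17 := RamProgram.step_real _ _ rfl
  have c18 : (coeffs.step s').real 18 = s'.real 18 := RamProgram.step_real _ _ rfl
  have c23 : (coeffs.step s').real 23 = s'.real 23 := RamProgram.step_real _ _ rfl
  have c9 : (coeffs.step s').real 9 = s'.real 9 := RamProgram.step_real _ _ rfl
  have e14 : ∀ i, (linesBody.step s').nat 14 i =
      if i = t then (if 0 < β then 1 else if β < 0 then 2 else 0) else s'.nat 14 i := by
    intro i
    simp [linesBody, classify, setLine, e26, c24, c14]
    split_ifs <;> rfl
  have e17 : ∀ i, (linesBody.step s').real 17 i =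
      if i = t then (if 0 < β then (0 - α) / β else if β < 0 then α / β else 0)
      else s'.real 17 i := by
    intro i
    simp [linesBody, classify, setLine, e25, e26, e27, c24, c17]
    split_ifs <;> rfl
  have e18 : ∀ i, (linesBody.step s').real 18 i =
      if i = t then (if 0 < β then γ / β else if β < 0 then (0 - γ) / β else 0)
      else s'.real 18 i := by
    intro i
    simp [linesBody, classify, setLine, e25, e26, e27, c24, c18]
    split_ifs <;> rfl
  have e9 : ∀ i, (linesBody.step s').real 9 i =
      if i = t then (linesBody.step s').real 17 i else s'.real 9 i := by
    intro i
    simp [linesBody, classify, setLine, e25, e26, e27, c24, c17, c9]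
    split_ifs <;> simp_all
  have e23 : (linesBody.step s').real 23 0 = if 0 < β then s'.real 23 0 else
      if β < 0 then s'.real 23 0 else if α < 0 ∧ γ / α < s'.real 23 0 then γ / α
      else s'.real 23 0 := by
    simp [linesBody, classify, setLine, e25, e26, e27, c24, c23]
  have hlast : ∀ i, i < t + 1 → i = t ∨ (i ≠ t ∧ i < t) := fun i hi => by omega
  constructor
  · intro i hi
    rw [e14]
    rcases hlast i hi with rfl | ⟨hne, hi⟩
    · rw [if_pos rfl]; rfl
    · rw [if_neg hne, h.side i hi]
  · intro i hi
    rw [e17]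
    rcases hlast i hi with rfl | ⟨hne, hi⟩
    · rw [if_pos rfl]; rfl
    · rw [if_neg hne, h.slope i hi]
  · intro i hi
    rw [e18]
    rcases hlast i hi with rfl | ⟨hne, hi⟩
    · rw [if_pos rfl]; rfl
    · rw [if_neg hne, h.icpt i hi]
  · intro i hi
    rw [e9]
    rcases hlast i hi with rfl | ⟨hne, hi⟩
    · rw [if_pos rfl]
    · rw [if_neg hne, e17, if_neg hne, h.key i hi]
  · intro i hi
    rw [e1]
    rcases hlast i hi with rfl | ⟨hne, hi⟩
    · rw [if_pos rfl]
    · rw [if_neg hne, h.idx i hi]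
  · intro y
    have hmin : y ≤ (linesBody.step s').real 23 0 ↔ y ≤ s'.real 23 0 ∧
        (lineSide (s.real 7 0) (s.real 7 1) (s.real 4 t) (s.real 5 t) = 0 → α < 0 →
          γ ≤ α * y) := by
      rw [e23, lineSide, ← hβ]
      split_ifs with h1 h2 h3
      · simp
      · simp
      · have : y ≤ γ / α ↔ γ ≤ α * y := by rw [le_div_iff_of_neg h3.1, mul_comm]
        rw [← this]
        exact ⟨fun hy => ⟨hy.trans h3.2.le, fun _ _ => hy⟩, fun hy => hy.2 rfl h3.1⟩
      · refine ⟨fun hy => ⟨hy, fun _ hα0 => ?_⟩, fun hy => hy.1⟩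
        have : y ≤ γ / α ↔ γ ≤ α * y := by rw [le_div_iff_of_neg hα0, mul_comm]
        rw [← this]
        exact hy.trans (not_lt.1 fun h4 => h3 ⟨hα0, h4⟩)
    rw [hmin, h.top y, and_assoc]
    refine and_congr_right fun _ => ⟨fun hy i hi => ?_, fun hy => ⟨fun i hi => hy i (by omega),
      hy t (by omega)⟩⟩
    rcases hlast i hi with rfl | ⟨hne, hi⟩
    · exact hy.2
    · exact hy.1 i hi

theorem runs_lines : ∃ C : ℕ, ∀ s : RamState,
    s.real 24 0 = s.real 7 0 * s.real 7 0 + s.real 7 1 * s.real 7 1 →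
    lines.Runs s (C * (s.nat 27 0 + 1)) (fun s' =>
      HasLines s s' (s.nat 27 0) ∧ s'.nat 3 0 = s.nat 27 0) := by
  refine ⟨linesHead.maxCost + (linesBody.maxCost + (BoolExpr.natLt (.var 24) (.var 27)).cost), ?_⟩
  intro s hD
  let I : ℕ → RamState → Prop := fun k s' => s'.nat 27 = s.nat 27 ∧ s'.nat 3 0 = s.nat 27 0 ∧
    s'.real 24 = s.real 24 ∧ s'.real 4 = s.real 4 ∧ s'.real 5 = s.real 5 ∧ s'.real 6 = s.real 6 ∧
    s'.real 7 = s.real 7 ∧ s'.nat 24 0 + k = s.nat 27 0 ∧ HasLines s s' (s'.nat 24 0)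
  have hinit : linesHead.Runs s linesHead.maxCost (fun s' => I (s.nat 27 0) s') := by
    have e24 : (linesHead.step s).nat 24 0 = 0 := by simp [linesHead]
    refine RamProgram.runs_of_step rfl ⟨?_, by simp [linesHead], ?_, ?_, ?_, ?_, ?_, by rw [e24]; simp, ?_⟩
    · rw [RamProgram.step_nat _ _ rfl]
    · rw [RamProgram.step_real _ _ rfl]
    · rw [RamProgram.step_real _ _ rfl]
    · rw [RamProgram.step_real _ _ rfl]
    · rw [RamProgram.step_real _ _ rfl]
    · rw [RamProgram.step_real _ _ rfl]
    · rw [e24]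
      constructor
      iterate 5 (intro i hi; omega)
      intro y
      simp [linesHead]
  refine (hinit.seq fun s' hs' =>
    RamProgram.runs_while I id linesBody.maxCost ?_ _ s' hs').mono ?_ ?_
  · rintro k s' ⟨h27, h3, h24, h4, h5, h6, h7, hk, hl⟩ hc
    have hlt : s'.nat 24 0 < s'.nat 27 0 := hc
    rw [h27] at hlt
    have e24 : (linesBody.step s').nat 24 0 = s'.nat 24 0 + 1 := by
      simp [linesBody, RamProgram.step_nat classify _ (show classify.writesNat 24 = false from rfl),
        RamProgram.step_nat coeffs _ (show coeffs.writesNat 24 = false from rfl)]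
    refine RamProgram.runs_of_step rfl
      ⟨k - 1, ⟨?_, ?_, ?_, ?_, ?_, ?_, ?_, by omega, ?_⟩, by simp only [id]; omega⟩
    · rw [RamProgram.step_nat _ _ rfl, h27]
    · rw [RamProgram.step_nat _ _ rfl, h3]
    · rw [RamProgram.step_real _ _ rfl, h24]
    · rw [RamProgram.step_real _ _ rfl, h4]
    · rw [RamProgram.step_real _ _ rfl, h5]
    · rw [RamProgram.step_real _ _ rfl, h6]
    · rw [RamProgram.step_real _ _ rfl, h7]
    · rw [e24]
      exact linesBody_step rfl (by rw [h24, hD]) h4 h5 h6 h7 hl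
  · simp only [id]
    generalize s.nat 27 0 = n
    generalize linesHead.maxCost = c₁
    generalize linesBody.maxCost = c₂
    generalize (BoolExpr.natLt (.var 24) (.var 27)).cost = c₃
    nlinarith [Nat.zero_le (n * c₁)]
  · rintro s' ⟨k, ⟨h27, h3, h24, h4, h5, h6, h7, hk, hl⟩, hc⟩
    have hge : ¬ s'.nat 24 0 < s'.nat 27 0 := hc
    rw [h27] at hge
    rw [show s'.nat 24 0 = s.nat 27 0 by omega] at hl
    exact ⟨hl, h3⟩

end PrepareProgram

/-! ### Additivity and monotonicity of pair counts. -/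

section PairCount

variable {n : ℕ} {P Q : Fin n → Fin 2 → ℝ}

theorem pairCount_congr {S T : (Fin 2 → ℝ) → Prop} (h : ∀ i j, S (P i + Q j) ↔ T (P i + Q j)) :
    pairCount P Q S = pairCount P Q T := by
  unfold pairCount
  refine congrArg Finset.card (Finset.ext fun x => ?_)
  simp [h]

theorem pairCount_mono {S T : (Fin 2 → ℝ) → Prop} (h : ∀ i j, S (P i + Q j) → T (P i + Q j)) :
    pairCount P Q S ≤ pairCount P Q T := by
  classical
  unfold pairCount
  exact Finset.card_le_card (Finset.monotone_filter_right _ fun x _ hx => h _ _ hx)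

theorem pairCount_eq_add {S T U : (Fin 2 → ℝ) → Prop}
    (h : ∀ i j, U (P i + Q j) ↔ S (P i + Q j) ∨ T (P i + Q j))
    (hd : ∀ i j, S (P i + Q j) → ¬ T (P i + Q j)) :
    pairCount P Q U = pairCount P Q S + pairCount P Q T := by
  classical
  unfold pairCount
  rw [← Finset.card_union_of_disjoint]
  · refine congrArg Finset.card (Finset.ext fun x => ?_)
    simp [h]
  · rw [Finset.disjoint_filter]
    exact fun x _ => hd x.1 x.2

theorem pairCount_eq_zero {S : (Fin 2 → ℝ) → Prop} (h : ∀ i j, ¬ S (P i + Q j)) :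
    pairCount P Q S = 0 := by
  classical
  unfold pairCount
  rw [Finset.card_eq_zero, Finset.filter_eq_empty_iff]
  exact fun x _ => h x.1 x.2

end PairCount

/-! ### Counting the sums above a height that satisfy two constraints. -/

namespace WedgeProgram

open CountProgram PrepareProgram

/-- The constraint whose number is in the variable `q`, as the lower condition of `count`. -/
def lowerRow (q : ℕ) : RamProgram :=
  .letReal 13 (.get 4 (.var q)) ;; .letReal 14 (.get 5 (.var q)) ;; .letReal 15 (.get 6 (.var q))

def lowerTrue : RamProgram :=
  .letReal 13 (.const 0) ;; .letReal 14 (.const 0) ;; .letReal 15 (.const 0)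

/-- The violation of the constraint whose number is in the variable `q`, as the upper condition of
`count`. -/
def upperRow (q : ℕ) : RamProgram :=
  .letReal 10 (.get 4 (.var q)) ;; .letReal 11 (.get 5 (.var q)) ;; .letReal 12 (.get 6 (.var q))

/-- An objective value greater than the variable `28`, as the upper condition of `count`. -/
def upperAbove : RamProgram :=
  .letReal 10 (.sub (.const 0) f0Expr) ;; .letReal 11 (.sub (.const 0) f1Expr) ;;
  .letReal 12 (.sub (.const 0) (.var 28))

def upperTrue : RamProgram :=
  .letReal 10 (.const 0) ;; .letReal 11 (.const 0) ;; .letReal 12 (.const 1)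

/-- Counting with the conditions `lo` and `up`; the result is in the variable `res`. -/
def test (lo up : RamProgram) (res : ℕ) : RamProgram := (lo ;; up) ;; count ;; .letNat res (.var 11)

theorem runs_test (lo up : RamProgram) (res : ℕ) (h : (lo ;; up).straight = true)
    (hn : (lo ;; up).writesNat 0 = false) (hr : ∀ j < 4, (lo ;; up).writesReal j = false) :
    ∃ C : ℕ, ∀ (n : ℕ) (P Q : Fin n → Fin 2 → ℝ) (s : RamState), HoldsPoints s P Q →
      (test lo up res).Runs s (C * countCost n) (fun s' => (s'.nat res 0 = pairCount P Q (fun r =>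
        ((lo ;; up).step s).real 10 0 * r 0 + ((lo ;; up).step s).real 11 0 * r 1 <
          ((lo ;; up).step s).real 12 0 ∧
        ((lo ;; up).step s).real 15 0 ≤
          ((lo ;; up).step s).real 13 0 * r 0 + ((lo ;; up).step s).real 14 0 * r 1)) ∧
        (test lo up res).Frame s s') := by
  obtain ⟨C, hC⟩ := runs_count
  refine ⟨(lo ;; up).maxCost + (C + (RamProgram.letNat res (.var 11)).maxCost), ?_⟩
  intro n P Q s hPQ
  have hpos : 0 < countCost n := by unfold countCost; positivity
  refine RamProgram.Runs.frame ?_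
  have h1 := (lo ;; up).runs_step h s
  refine (h1.seq (T₂ := C * countCost n + (RamProgram.letNat res (.var 11)).maxCost) ?_).mono
    ?_ (fun _ h => h)
  · rintro s₁ rfl
    refine (hC n P Q _ (hPQ.of_frame (RamProgram.step_nat _ _ hn)
      (fun j hj => RamProgram.step_real _ _ (hr j hj)))).seq ?_
    intro s₂ hs₂
    refine RamProgram.runs_of_step rfl ?_
    simpa using hs₂
  · rw [add_mul, add_mul]
    have := Nat.le_mul_of_pos_right (lo ;; up).maxCost hpos
    have := Nat.le_mul_of_pos_right (RamProgram.letNat res (.var 11)).maxCost hpos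
    omega

/-- Whether the sum of the values of the lines `28` and `29` at the variable `28` is positive. -/
def gapCond : BoolExpr :=
  .realLt (.const 0) (.add (EnvelopeProgram.lineExpr (.var 28) (.var 28))
    (EnvelopeProgram.lineExpr (.var 29) (.var 28)))

def slopeCond : BoolExpr :=
  .realLt (.const 0) (.add (.get 17 (.var 28)) (.get 17 (.var 29)))

/-- `count` handles one satisfied and one violated constraint, so two satisfied ones are obtained by
complement: all sums with `i`, minus those with `i` and not `j`. -/
def countBoth : RamProgram :=
  test (lowerRow 28) upperTrue 30 ;; test (lowerRow 28) (upperRow 29) 31 ;;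
  .letNat 23 (.sub (.var 30) (.var 31))

/-- Again by complement: all sums violating `j`, minus those that violate `j` but satisfy `i`. -/
def countNeither : RamProgram :=
  test lowerTrue (upperRow 29) 30 ;; test (lowerRow 28) (upperRow 29) 31 ;;
  .letNat 23 (.add (.var 23) (.sub (.var 30) (.var 31)))

/-- Inclusion-exclusion above the height `v`: both = `i` + `j` + neither - all. The term "neither
and above `v`" would involve three half-planes, but in the case where this program runs it is either
everything in "neither" or empty, according to the sign of the sum of the slopes. -/
def countAbove : RamProgram :=
  test (lowerRow 28) upperAbove 30 ;; test (lowerRow 29) upperAbove 31 ;;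
  .letNat 23 (.add (.var 30) (.var 31)) ;;
  .ite slopeCond countNeither .skip ;;
  test lowerTrue upperAbove 32 ;;
  .letNat 23 (.sub (.var 23) (.var 32))

/-- The number of the sums that satisfy the constraints number `28` and `29` and have an objective
value greater than the variable `28`; the result is in the variable `23`. -/
def wedge : RamProgram :=
  .ite gapCond (.ite slopeCond (.letNat 23 (.const 0)) countBoth) countAbove

/-- The constraint number `i` holds for the point `r`. -/
def RowHolds (s : RamState) (i : ℕ) (r : Fin 2 → ℝ) : Prop :=
  s.real 6 i ≤ s.real 4 i * r 0 + s.real 5 i * r 1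

/-- The states that agree on everything that the counting programs read. -/
def SameInput (s s' : RamState) : Prop :=
  s'.nat 0 = s.nat 0 ∧ s'.nat 28 = s.nat 28 ∧ s'.nat 29 = s.nat 29 ∧
    (∀ j < 8, s'.real j = s.real j) ∧ s'.real 28 = s.real 28 ∧ s'.real 17 = s.real 17

theorem SameInput.of_frame {p : RamProgram} {s s' s'' : RamState} (h : SameInput s s')
    (hf : p.Frame s' s'') (h0 : p.writesNat 0 = false) (h28 : p.writesNat 28 = false)
    (h29 : p.writesNat 29 = false) (hr : ∀ j < 8, p.writesReal j = false)
    (h28' : p.writesReal 28 = false) (h17 : p.writesReal 17 = false) : SameInput s s'' := by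
  obtain ⟨e0, e28, e29, er, er28, er17⟩ := h
  refine ⟨by rw [hf.1 _ h0, e0], by rw [hf.1 _ h28, e28], by rw [hf.1 _ h29, e29],
    fun j hj => by rw [hf.2 _ (hr j hj), er j hj], by rw [hf.2 _ h28', er28],
    by rw [hf.2 _ h17, er17]⟩

theorem SameInput.holdsPoints {s s' : RamState} (h : SameInput s s') {n : ℕ}
    {P Q : Fin n → Fin 2 → ℝ} (hPQ : HoldsPoints s P Q) : HoldsPoints s' P Q :=
  hPQ.of_frame h.1 fun j hj => h.2.2.2.1 j (by omega)

theorem SameInput.refl (s : RamState) : SameInput s s := ⟨rfl, rfl, rfl, fun _ _ => rfl, rfl, rfl⟩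

/-- A form of `runs_test` with the conditions read off the initial state of the caller. -/
theorem runs_test' (lo up : RamProgram) (res : ℕ) (h : (lo ;; up).straight = true)
    (hn : ∀ a, (lo ;; up).writesNat a = false)
    (hr : ∀ j, j < 8 ∨ 16 < j → (lo ;; up).writesReal j = false)
    (hres : res = 30 ∨ res = 31 ∨ res = 32) (S : RamState → (Fin 2 → ℝ) → Prop)
    (hS : ∀ s₀ s r, SameInput s₀ s → (S s₀ r ↔
      ((lo ;; up).step s).real 10 0 * r 0 + ((lo ;; up).step s).real 11 0 * r 1 <
          ((lo ;; up).step s).real 12 0 ∧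
        ((lo ;; up).step s).real 15 0 ≤
          ((lo ;; up).step s).real 13 0 * r 0 + ((lo ;; up).step s).real 14 0 * r 1)) :
    ∃ C : ℕ, ∀ (n : ℕ) (P Q : Fin n → Fin 2 → ℝ) (s₀ s : RamState), HoldsPoints s₀ P Q →
      SameInput s₀ s → (test lo up res).Runs s (C * countCost n) (fun s' =>
        s'.nat res 0 = pairCount P Q (S s₀) ∧ SameInput s₀ s' ∧ s'.nat 23 = s.nat 23 ∧
          (∀ a, 29 < a → a ≠ res → s'.nat a = s.nat a)) := by
  obtain ⟨C, hC⟩ := runs_test lo up res h (hn 0) (fun j hj => hr j (by omega))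
  refine ⟨C, fun n P Q s₀ s hPQ hs => (hC n P Q s (hs.holdsPoints hPQ)).mono le_rfl ?_⟩
  rintro s' ⟨h1, h2⟩
  have hw : ∀ a, a ≠ res → count.writesNat a = false → (test lo up res).writesNat a = false := by
    intro a ha hc
    simp only [test, RamProgram.writesNat, Bool.or_eq_false_iff] at hn ⊢
    exact ⟨hn a, hc, by simpa using ha⟩
  have hw' : ∀ a, a < 8 ∨ 16 < a → count.writesReal a = false →
      (test lo up res).writesReal a = false := by
    intro a ha hc
    have := hr a ha
    simp only [test, RamProgram.writesReal, Bool.or_eq_false_iff] at this ⊢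
    exact ⟨this, hc, trivial⟩
  have hcr : ∀ j < 8, count.writesReal j = false := by decide
  refine ⟨?_, hs.of_frame h2 (hw 0 (by omega) rfl) (hw 28 (by omega) rfl) (hw 29 (by omega) rfl)
    (fun j hj => hw' j (by omega) (hcr j hj)) (hw' 28 (by omega) rfl) (hw' 17 (by omega) rfl),
    h2.1 23 (hw 23 (by omega) rfl), fun a ha hne => h2.1 a (hw a hne ?_)⟩
  · rw [h1]
    exact pairCount_congr fun i j => (hS s₀ s _ hs).symm
  · simp [count, initIdx, initIdxHead, initIdxBody, load, loadBody, SortProgram.sort,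
      SortProgram.sortInit, SortProgram.sortBody, SortProgram.pass, SortProgram.passInit,
      SortProgram.passBody, SortProgram.openBlocks, SortProgram.emitLeft, SortProgram.emitRight,
      SortProgram.copyBack, SortProgram.copyBody, RamProgram.writesNat]
    omega

/-- The objective value. -/
def objective (s : RamState) (r : Fin 2 → ℝ) : ℝ := s.real 7 0 * r 0 + s.real 7 1 * r 1

theorem runs_lowerRow_upperTrue : ∃ C : ℕ, ∀ (n : ℕ) (P Q : Fin n → Fin 2 → ℝ) (s₀ s : RamState),
    HoldsPoints s₀ P Q → SameInput s₀ s →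
      (test (lowerRow 28) upperTrue 30).Runs s (C * countCost n) (fun s' =>
        s'.nat 30 0 = pairCount P Q (fun r => RowHolds s₀ (s₀.nat 28 0) r) ∧ SameInput s₀ s' ∧
        s'.nat 23 = s.nat 23 ∧ (∀ a, 29 < a → a ≠ 30 → s'.nat a = s.nat a)) := by
  refine runs_test' _ _ _ rfl (fun _ => rfl) (fun j hj => ?_) (by simp)
    (fun s r => RowHolds s (s.nat 28 0) r) ?_
  · simp [lowerRow, upperTrue, RamProgram.writesReal]; omega
  · rintro s₀ s r ⟨e0, e28, e29, er, er28, er17⟩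
    simp [lowerRow, upperTrue, RowHolds, e28, er 4, er 5, er 6]

theorem runs_lowerRow_upperRow : ∃ C : ℕ, ∀ (n : ℕ) (P Q : Fin n → Fin 2 → ℝ) (s₀ s : RamState),
    HoldsPoints s₀ P Q → SameInput s₀ s →
      (test (lowerRow 28) (upperRow 29) 31).Runs s (C * countCost n) (fun s' =>
        s'.nat 31 0 = pairCount P Q
          (fun r => RowHolds s₀ (s₀.nat 28 0) r ∧ ¬ RowHolds s₀ (s₀.nat 29 0) r) ∧
        SameInput s₀ s' ∧ s'.nat 23 = s.nat 23 ∧ (∀ a, 29 < a → a ≠ 31 → s'.nat a = s.nat a)) := by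
  refine runs_test' _ _ _ rfl (fun _ => rfl) (fun j hj => ?_) (by simp)
    (fun s r => RowHolds s (s.nat 28 0) r ∧ ¬ RowHolds s (s.nat 29 0) r) ?_
  · simp [lowerRow, upperRow, RamProgram.writesReal]; omega
  · rintro s₀ s r ⟨e0, e28, e29, er, er28, er17⟩
    simp [lowerRow, upperRow, RowHolds, e28, e29, er 4, er 5, er 6, and_comm]

theorem runs_lowerTrue_upperRow : ∃ C : ℕ, ∀ (n : ℕ) (P Q : Fin n → Fin 2 → ℝ) (s₀ s : RamState),
    HoldsPoints s₀ P Q → SameInput s₀ s →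
      (test lowerTrue (upperRow 29) 30).Runs s (C * countCost n) (fun s' =>
        s'.nat 30 0 = pairCount P Q (fun r => ¬ RowHolds s₀ (s₀.nat 29 0) r) ∧
        SameInput s₀ s' ∧ s'.nat 23 = s.nat 23 ∧ (∀ a, 29 < a → a ≠ 30 → s'.nat a = s.nat a)) := by
  refine runs_test' _ _ _ rfl (fun _ => rfl) (fun j hj => ?_) (by simp)
    (fun s r => ¬ RowHolds s (s.nat 29 0) r) ?_
  · simp [lowerTrue, upperRow, RamProgram.writesReal]; omega
  · rintro s₀ s r ⟨e0, e28, e29, er, er28, er17⟩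
    simp [lowerTrue, upperRow, RowHolds, e29, er 4, er 5, er 6]

theorem runs_lowerRow_upperAbove (q res : ℕ) (hq : q = 28 ∨ q = 29) (hres : res = 30 ∨ res = 31) :
    ∃ C : ℕ, ∀ (n : ℕ) (P Q : Fin n → Fin 2 → ℝ) (s₀ s : RamState),
    HoldsPoints s₀ P Q → SameInput s₀ s →
      (test (lowerRow q) upperAbove res).Runs s (C * countCost n) (fun s' =>
        s'.nat res 0 = pairCount P Q
          (fun r => RowHolds s₀ (s₀.nat q 0) r ∧ s₀.real 28 0 < objective s₀ r) ∧
        SameInput s₀ s' ∧ s'.nat 23 = s.nat 23 ∧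
        (∀ a, 29 < a → a ≠ res → s'.nat a = s.nat a)) := by
  refine runs_test' _ _ _ rfl (fun _ => rfl) (fun j hj => ?_) (by omega)
    (fun s r => RowHolds s (s.nat q 0) r ∧ s.real 28 0 < objective s r) ?_
  · simp [lowerRow, upperAbove, RamProgram.writesReal]; omega
  · rintro s₀ s r ⟨e0, e28, e29, er, er28, er17⟩
    have hq' : s.nat q = s₀.nat q := by rcases hq with rfl | rfl <;> assumption
    simp [lowerRow, upperAbove, RowHolds, objective, hq', er 4, er 5, er 6, er 7, er28]
    constructor <;> rintro ⟨h1, h2⟩ <;> constructor <;> linarith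

theorem runs_lowerTrue_upperAbove :
    ∃ C : ℕ, ∀ (n : ℕ) (P Q : Fin n → Fin 2 → ℝ) (s₀ s : RamState),
    HoldsPoints s₀ P Q → SameInput s₀ s →
      (test lowerTrue upperAbove 32).Runs s (C * countCost n) (fun s' =>
        s'.nat 32 0 = pairCount P Q (fun r => s₀.real 28 0 < objective s₀ r) ∧
        SameInput s₀ s' ∧ s'.nat 23 = s.nat 23 ∧
        (∀ a, 29 < a → a ≠ 32 → s'.nat a = s.nat a)) := by
  refine runs_test' _ _ _ rfl (fun _ => rfl) (fun j hj => ?_) (by omega)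
    (fun s r => s.real 28 0 < objective s r) ?_
  · simp [lowerTrue, upperAbove, RamProgram.writesReal]; omega
  · rintro s₀ s r ⟨e0, e28, e29, er, er28, er17⟩
    simp [lowerTrue, upperAbove, objective, er 7, er28]
    constructor <;> intro h <;> linarith

end WedgeProgram

namespace WedgeProgram

open CountProgram PrepareProgram

theorem one_le_countCost (n : ℕ) : 1 ≤ countCost n := Nat.succ_le_of_lt (by unfold countCost; positivity)

theorem SameInput.step {s s' : RamState} (h : SameInput s s') (p : RamProgram)
    (h0 : p.writesNat 0 = false) (h28 : p.writesNat 28 = false)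
    (h29 : p.writesNat 29 = false) (hr : ∀ j < 8, p.writesReal j = false)
    (h28' : p.writesReal 28 = false) (h17 : p.writesReal 17 = false) :
    SameInput s (p.step s') :=
  h.of_frame ⟨fun _ ha => p.step_nat _ ha, fun _ ha => p.step_real _ ha⟩ h0 h28 h29 hr h28' h17

theorem runs_countBoth : ∃ C : ℕ, ∀ (n : ℕ) (P Q : Fin n → Fin 2 → ℝ) (s : RamState),
    HoldsPoints s P Q → countBoth.Runs s (C * countCost n) (fun s' =>
      s'.nat 23 0 = pairCount P Q (fun r =>
        RowHolds s (s.nat 28 0) r ∧ RowHolds s (s.nat 29 0) r)) := by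
  obtain ⟨C₁, h₁⟩ := runs_lowerRow_upperTrue
  obtain ⟨C₂, h₂⟩ := runs_lowerRow_upperRow
  refine ⟨C₁ + (C₂ + (RamProgram.letNat 23 (.sub (.var 30) (.var 31))).maxCost), ?_⟩
  intro n P Q s hPQ
  rw [add_mul, add_mul]
  refine (h₁ n P Q s s hPQ (.refl s)).seq ?_
  rintro s₁ ⟨a₁, i₁, -, k₁⟩
  refine (h₂ n P Q s s₁ hPQ i₁).seq ?_
  rintro s₂ ⟨a₂, i₂, -, k₂⟩
  refine (RamProgram.runs_of_step rfl ?_).mono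
    (Nat.le_mul_of_pos_right _ (one_le_countCost n)) (fun _ h => h)
  have : pairCount P Q (fun r => RowHolds s (s.nat 28 0) r) =
      pairCount P Q (fun r => RowHolds s (s.nat 28 0) r ∧ RowHolds s (s.nat 29 0) r) +
      pairCount P Q (fun r => RowHolds s (s.nat 28 0) r ∧ ¬ RowHolds s (s.nat 29 0) r) :=
    pairCount_eq_add (fun i j => by tauto) (fun i j h h' => h'.2 h.2)
  have a₁ : s₂.nat 30 0 = _ := (congrFun (k₂ 30 (by norm_num) (by norm_num)) 0).trans a₁
  simp [a₁, a₂]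
  omega

theorem runs_countNeither : ∃ C : ℕ, ∀ (n : ℕ) (P Q : Fin n → Fin 2 → ℝ) (s₀ s : RamState),
    HoldsPoints s₀ P Q → SameInput s₀ s → countNeither.Runs s (C * countCost n) (fun s' =>
      s'.nat 23 0 = s.nat 23 0 + pairCount P Q (fun r =>
        ¬ RowHolds s₀ (s₀.nat 28 0) r ∧ ¬ RowHolds s₀ (s₀.nat 29 0) r) ∧ SameInput s₀ s') := by
  obtain ⟨C₁, h₁⟩ := runs_lowerTrue_upperRow
  obtain ⟨C₂, h₂⟩ := runs_lowerRow_upperRow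
  refine ⟨C₁ + (C₂ + (RamProgram.letNat 23
    (.add (.var 23) (.sub (.var 30) (.var 31)))).maxCost), ?_⟩
  intro n P Q s₀ s hPQ hs
  rw [add_mul, add_mul]
  refine (h₁ n P Q s₀ s hPQ hs).seq ?_
  rintro s₁ ⟨a₁, i₁, b₁, k₁⟩
  refine (h₂ n P Q s₀ s₁ hPQ i₁).seq ?_
  rintro s₂ ⟨a₂, i₂, b₂, k₂⟩
  refine (RamProgram.runs_of_step rfl ⟨?_, i₂.step _ rfl rfl rfl (fun _ _ => rfl) rfl rfl⟩).mono
    (Nat.le_mul_of_pos_right _ (one_le_countCost n)) (fun _ h => h)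
  have : pairCount P Q (fun r => ¬ RowHolds s₀ (s₀.nat 29 0) r) =
      pairCount P Q (fun r => RowHolds s₀ (s₀.nat 28 0) r ∧ ¬ RowHolds s₀ (s₀.nat 29 0) r) +
      pairCount P Q (fun r => ¬ RowHolds s₀ (s₀.nat 28 0) r ∧ ¬ RowHolds s₀ (s₀.nat 29 0) r) :=
    pairCount_eq_add (fun i j => by tauto) (fun i j h h' => h'.1 h.1)
  have a₁ : s₂.nat 30 0 = _ := (congrFun (k₂ 30 (by norm_num) (by norm_num)) 0).trans a₁
  have e23 : s₂.nat 23 0 = s.nat 23 0 := by rw [b₂, b₁]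
  simp [a₁, a₂, e23]
  omega

open Classical in
theorem runs_countAbove : ∃ C : ℕ, ∀ (n : ℕ) (P Q : Fin n → Fin 2 → ℝ) (s : RamState),
    HoldsPoints s P Q → countAbove.Runs s (C * countCost n) (fun s' =>
      s'.nat 23 0 = (pairCount P Q (fun r => RowHolds s (s.nat 28 0) r ∧
          s.real 28 0 < objective s r) +
        pairCount P Q (fun r => RowHolds s (s.nat 29 0) r ∧ s.real 28 0 < objective s r)) +
        (if 0 < s.real 17 (s.nat 28 0) + s.real 17 (s.nat 29 0) then pairCount P Q (fun r =>
          ¬ RowHolds s (s.nat 28 0) r ∧ ¬ RowHolds s (s.nat 29 0) r) else 0) -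
        pairCount P Q (fun r => s.real 28 0 < objective s r)) := by
  obtain ⟨C₁, h₁⟩ := runs_lowerRow_upperAbove 28 30 (by simp) (by simp)
  obtain ⟨C₂, h₂⟩ := runs_lowerRow_upperAbove 29 31 (by simp) (by simp)
  obtain ⟨C₃, h₃⟩ := runs_countNeither
  obtain ⟨C₄, h₄⟩ := runs_lowerTrue_upperAbove
  refine ⟨C₁ + (C₂ + ((RamProgram.letNat 23 (.add (.var 30) (.var 31))).maxCost +
    ((slopeCond.cost + (C₃ + 1)) +
      (C₄ + (RamProgram.letNat 23 (.sub (.var 23) (.var 32))).maxCost)))), ?_⟩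
  intro n P Q s hPQ
  have hpos := one_le_countCost n
  simp only [add_mul _ _ (countCost n)]
  refine (h₁ n P Q s s hPQ (.refl s)).seq ?_
  rintro s₁ ⟨a₁, i₁, -, k₁⟩
  refine (h₂ n P Q s s₁ hPQ i₁).seq ?_
  rintro s₂ ⟨a₂, i₂, -, k₂⟩
  have a₁ : s₂.nat 30 0 = _ := (congrFun (k₂ 30 (by norm_num) (by norm_num)) 0).trans a₁
  have step₃ := RamProgram.runs_step (RamProgram.letNat 23 (.add (.var 30) (.var 31))) rfl s₂
  refine (step₃.mono (Nat.le_mul_of_pos_right _ hpos) (fun _ h => h)).seq ?_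
  intro s₃ hs₃
  have i₃ : SameInput s s₃ := by
    rw [hs₃]; exact i₂.step _ rfl rfl rfl (fun _ _ => rfl) rfl rfl
  have a₃ : s₃.nat 23 0 = pairCount P Q (fun r => RowHolds s (s.nat 28 0) r ∧
          s.real 28 0 < objective s r) +
        pairCount P Q (fun r => RowHolds s (s.nat 29 0) r ∧ s.real 28 0 < objective s r) := by
    rw [hs₃]; simp [a₁, a₂]
  have hsl : slopeCond.eval s₃ ↔ 0 < s.real 17 (s.nat 28 0) + s.real 17 (s.nat 29 0) := by
    obtain ⟨e0, e28, e29, er, er28, er17⟩ := i₃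
    simp [slopeCond, e28, e29, er17]
  have step₄ : (RamProgram.ite slopeCond countNeither .skip).Runs s₃
      (slopeCond.cost + (C₃ * countCost n + 1)) (fun s' => s'.nat 23 0 = s₃.nat 23 0 +
        (if 0 < s.real 17 (s.nat 28 0) + s.real 17 (s.nat 29 0) then pairCount P Q (fun r =>
          ¬ RowHolds s (s.nat 28 0) r ∧ ¬ RowHolds s (s.nat 29 0) r) else 0) ∧
        SameInput s s') := by
    refine RamProgram.Runs.ite (fun hc => ?_) (fun hc => ?_)
    · rw [if_pos (hsl.1 hc)]
      exact (h₃ n P Q s s₃ hPQ i₃).mono (by omega) (fun _ h => h)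
    · rw [if_neg (fun h => hc (hsl.2 h))]
      exact (RamProgram.runs_of_step (p := .skip) rfl ⟨rfl, i₃⟩).mono
        (show 1 ≤ _ by omega) (fun _ h => h)
  refine (step₄.mono (T' := slopeCond.cost * countCost n + (C₃ * countCost n + 1 * countCost n)) ?_
    (fun _ h => h)).seq ?_
  · have := Nat.le_mul_of_pos_right slopeCond.cost hpos
    omega
  rintro s₄ ⟨a₄, i₄⟩
  refine (h₄ n P Q s s₄ hPQ i₄).seq ?_
  rintro s₅ ⟨a₅, i₅, b₅, -⟩
  refine (RamProgram.runs_of_step rfl ?_).mono (Nat.le_mul_of_pos_right _ hpos) (fun _ h => h)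
  have e23 : s₅.nat 23 0 = s₄.nat 23 0 := by rw [b₅]
  simp [a₅, e23, a₄, a₃]

/-- Let `G y` be the sum of the values of the two lines at `y`. Adding the two bounds shows that `G
≤ 0` at a point satisfying both constraints and `G > 0` at a point violating both. Since `G` is
affine, its sign at `v` and its slope decide the matter. If `G v > 0` and `G` increases, no point
satisfying both lies above `v`; if `G v > 0` and `G` does not increase, all of them do. If `G v ≤
0`, the points violating both are all above `v` when `G` increases, and none of them is above `v`
otherwise. -/
theorem runs_wedge : ∃ C : ℕ, ∀ (n : ℕ) (P Q : Fin n → Fin 2 → ℝ) (s : RamState)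
    (x : (Fin 2 → ℝ) → ℝ), HoldsPoints s P Q →
    (∀ r, RowHolds s (s.nat 28 0) r ↔
      s.real 17 (s.nat 28 0) * objective s r + s.real 18 (s.nat 28 0) ≤ x r) →
    (∀ r, RowHolds s (s.nat 29 0) r ↔
      s.real 17 (s.nat 29 0) * objective s r + s.real 18 (s.nat 29 0) ≤ -x r) →
    wedge.Runs s (C * countCost n) (fun s' => s'.nat 23 0 = pairCount P Q (fun r =>
      RowHolds s (s.nat 28 0) r ∧ RowHolds s (s.nat 29 0) r ∧ s.real 28 0 < objective s r)) := by
  obtain ⟨C₁, h₁⟩ := runs_countBoth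
  obtain ⟨C₂, h₂⟩ := runs_countAbove
  set c₀ := (RamProgram.letNat 23 (.const 0)).maxCost with hc₀
  refine ⟨gapCond.cost + ((slopeCond.cost + (c₀ + C₁)) + C₂), ?_⟩
  intro n P Q s x hPQ hi hj
  set i := s.nat 28 0 with hi0
  set j := s.nat 29 0 with hj0
  set v := s.real 28 0 with hv
  have hpos := one_le_countCost n
  have hgap : gapCond.eval s ↔ 0 < (s.real 17 i * v + s.real 18 i) +
      (s.real 17 j * v + s.real 18 j) := by simp [gapCond, ← hi0, ← hj0, ← hv]
  have hsl : slopeCond.eval s ↔ 0 < s.real 17 i + s.real 17 j := by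
    simp [slopeCond, ← hi0, ← hj0]
  have m1 := Nat.le_mul_of_pos_right slopeCond.cost hpos
  have m2 := Nat.le_mul_of_pos_right gapCond.cost hpos
  have m3 := Nat.le_mul_of_pos_right c₀ hpos
  refine (RamProgram.Runs.ite (T := slopeCond.cost + (c₀ + C₁ * countCost n) + C₂ * countCost n)
    (fun hg => ?_) (fun hg => ?_)).mono (by simp only [add_mul]; omega) (fun _ h => h)
  · rw [hgap] at hg
    refine RamProgram.Runs.mono (T := slopeCond.cost + (c₀ + C₁ * countCost n))
      (RamProgram.Runs.ite (fun hs => ?_) (fun hs => ?_)) (by omega) (fun _ h => h)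
    · rw [hsl] at hs
      refine (RamProgram.runs_of_step rfl ?_).mono (Nat.le_add_right _ _) (fun _ h => h)
      rw [pairCount_eq_zero]
      · simp
      · rintro a b ⟨h1, h2, h3⟩
        rw [hi] at h1
        rw [hj] at h2
        linarith [mul_pos hs (sub_pos.2 h3)]
    · rw [hsl] at hs
      refine (h₁ n P Q s hPQ).mono (by omega) (fun s' h => h.trans ?_)
      refine pairCount_congr fun a b => ⟨fun ⟨h1, h2⟩ => ⟨h1, h2, ?_⟩, fun h => ⟨h.1, h.2.1⟩⟩
      rw [← hi0, hi] at h1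
      rw [← hj0, hj] at h2
      by_contra h3
      linarith [mul_nonneg (sub_nonneg.2 (not_lt.1 hs)) (sub_nonneg.2 (not_lt.1 h3))]
  · rw [hgap] at hg
    refine (h₂ n P Q s hPQ).mono (by omega) (fun s' h => h.trans ?_)
    rw [← hi0, ← hj0, ← hv]
    have e0 : pairCount P Q (fun r => RowHolds s i r ∧ v < objective s r) =
        pairCount P Q (fun r => RowHolds s i r ∧ RowHolds s j r ∧ v < objective s r) +
        pairCount P Q (fun r => RowHolds s i r ∧ ¬ RowHolds s j r ∧ v < objective s r) :=
      pairCount_eq_add (fun a b => by tauto) (fun a b h h' => h'.2.1 h.2.1)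
    have e1 : pairCount P Q (fun r => v < objective s r) =
        pairCount P Q (fun r => RowHolds s i r ∧ ¬ RowHolds s j r ∧ v < objective s r) +
        pairCount P Q (fun r => ¬ (RowHolds s i r ∧ ¬ RowHolds s j r) ∧ v < objective s r) :=
      pairCount_eq_add (fun a b => by tauto) (fun a b h h' => h'.1 ⟨h.1, h.2.1⟩)
    have e2 : pairCount P Q (fun r => ¬ (RowHolds s i r ∧ ¬ RowHolds s j r) ∧ v < objective s r) =
        pairCount P Q (fun r => RowHolds s j r ∧ v < objective s r) +
        pairCount P Q (fun r => (¬ RowHolds s i r ∧ ¬ RowHolds s j r) ∧ v < objective s r) :=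
      pairCount_eq_add (fun a b => by tauto) (fun a b h h' => h'.1.2 h.1)
    have e3 : pairCount P Q (fun r => (¬ RowHolds s i r ∧ ¬ RowHolds s j r) ∧
        v < objective s r) = if 0 < s.real 17 i + s.real 17 j then pairCount P Q (fun r =>
          ¬ RowHolds s i r ∧ ¬ RowHolds s j r) else 0 := by
      split_ifs with hs
      · refine pairCount_congr fun a b => ⟨fun h => h.1, fun h => ⟨h, ?_⟩⟩
        have h1 := h.1
        have h2 := h.2
        rw [hi, not_le] at h1
        rw [hj, not_le] at h2
        by_contra h3
        linarith [mul_nonneg hs.le (sub_nonneg.2 (not_lt.1 h3))]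
      · refine pairCount_eq_zero fun a b => ?_
        rintro ⟨⟨h1, h2⟩, h3⟩
        rw [hi, not_le] at h1
        rw [hj, not_le] at h2
        linarith [mul_nonneg (sub_nonneg.2 (not_lt.1 hs)) (sub_nonneg.2 h3.le)]
    rw [← e3]
    omega

end WedgeProgram

/-! ## The search for the slab of the solution -/

namespace WalkProgram

open CountProgram WedgeProgram

def head : RamProgram :=
  .letNat 19 (.sub (.var 16) (.const 1)) ;; .letNat 20 (.sub (.var 18) (.const 1)) ;;
  .letNat 21 (.const 0) ;; .letNat 22 (.const 0) ;; .letReal 21 (.var 23)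

/-- The current breakpoint of the left envelope lies below that of the right one. -/
def leftLow : BoolExpr := .realLt (.get 19 (.var 19)) (.get 20 (.var 20))

/-- The current slab ends below at the higher of the two current breakpoints, where one of the
envelopes changes its line. -/
def select : RamProgram :=
  .letNat 28 (.get 15 (.var 19)) ;; .letNat 29 (.get 17 (.var 20)) ;;
  .ite leftLow (.letReal 22 (.get 20 (.var 20))) (.letReal 22 (.get 19 (.var 19)))

@[reducible] def nextExpr : NatExpr := .add (.var 21) (.sub (.var 25) (.var 26))

/-- Variables `25` and `26` are the wedge counts at the lower and the upper end of the slab, so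
their difference is the number of feasible sums in the slab. If rank `k` is reached, the new rank
adds `26`: sums above the slab that satisfy the two chosen constraints precede the solution in the
new instance, feasible or not. -/
def conclude : RamProgram :=
  .ite (.natLt nextExpr (.get 0 (.const 2)))
    (.letNat 21 nextExpr ;; .letReal 21 (.var 22))
    (.letNat 25 (.add (.sub (.get 0 (.const 2)) (.var 21)) (.var 26)) ;; .letNat 22 (.const 1))

def setLow : RamProgram := .letReal 28 (.var 22)

def setHigh : RamProgram := .letNat 25 (.var 23) ;; .letReal 28 (.var 21)

def saveHigh : RamProgram := .letNat 26 (.var 23)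

def slab : RamProgram := setLow ;; wedge ;; setHigh ;; wedge ;; saveHigh ;; conclude

def move : RamProgram :=
  .ite leftLow (.letNat 20 (.sub (.var 20) (.const 1))) (.letNat 19 (.sub (.var 19) (.const 1)))

/-- A slab can be empty, when breakpoints of the two envelopes coincide or when it lies above the
bound in variable `23`. It is then skipped, and the upper end stays where it is. -/
def body : RamProgram := select ;; .ite (.realLt (.var 22) (.var 21)) slab .skip ;; move

/-- Walking down the slabs between the breakpoints until the solution is reached. -/
def walk : RamProgram := head ;; .while (.natLt (.var 22) (.const 1)) body

/-- Agreement on the arrays that the walk does not change. -/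
def Static (s s' : RamState) : Prop :=
  s'.nat 0 = s.nat 0 ∧ s'.nat 15 = s.nat 15 ∧ s'.nat 17 = s.nat 17 ∧
    (∀ j < 8, s'.real j = s.real j) ∧ s'.real 17 = s.real 17 ∧ s'.real 18 = s.real 18 ∧
    s'.real 19 = s.real 19 ∧ s'.real 20 = s.real 20

theorem Static.of_frame {p : RamProgram} {s s' s'' : RamState} (h : Static s s')
    (hf : p.Frame s' s'') (h0 : p.writesNat 0 = false) (h15 : p.writesNat 15 = false)
    (h17 : p.writesNat 17 = false) (hr : ∀ j < 8, p.writesReal j = false)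
    (h17' : p.writesReal 17 = false) (h18' : p.writesReal 18 = false)
    (h19' : p.writesReal 19 = false) (h20' : p.writesReal 20 = false) : Static s s'' := by
  obtain ⟨e0, e15, e17, er, er17, er18, er19, er20⟩ := h
  exact ⟨by rw [hf.1 _ h0, e0], by rw [hf.1 _ h15, e15], by rw [hf.1 _ h17, e17],
    fun j hj => by rw [hf.2 _ (hr j hj), er j hj], by rw [hf.2 _ h17', er17],
    by rw [hf.2 _ h18', er18], by rw [hf.2 _ h19', er19], by rw [hf.2 _ h20', er20]⟩

theorem frame_step (p : RamProgram) (s : RamState) : p.Frame s (p.step s) :=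
  ⟨fun _ ha => p.step_nat _ ha, fun _ ha => p.step_real _ ha⟩

theorem Static.rowHolds {s s' : RamState} (h : Static s s') (i : ℕ) (r : Fin 2 → ℝ) :
    RowHolds s' i r ↔ RowHolds s i r := by
  rw [RowHolds, RowHolds, h.2.2.2.1 4 (by norm_num), h.2.2.2.1 5 (by norm_num),
    h.2.2.2.1 6 (by norm_num)]

theorem Static.objective_eq {s s' : RamState} (h : Static s s') (r : Fin 2 → ℝ) :
    objective s' r = objective s r := by
  rw [objective, objective, h.2.2.2.1 7 (by norm_num)]

/-- The input of the walk: the envelopes of the left and of the right constraints, to the right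
of `x₀`. -/
structure Input {n : ℕ} (s : RamState) (P Q : Fin n → Fin 2 → ℝ) (x : (Fin 2 → ℝ) → ℝ)
    (SL SR : Set ℕ) (x₀ : ℝ) : Prop where
  points : HoldsPoints s P Q
  envL : IsEnvelope (s.real 17) (s.real 18) SL x₀ (s.nat 16 0) (s.nat 15) (s.real 19)
  envR : IsEnvelope (s.real 17) (s.real 18) SR x₀ (s.nat 18 0) (s.nat 17) (s.real 20)
  posL : 0 < s.nat 16 0
  posR : 0 < s.nat 18 0
  left : ∀ i ∈ SL, ∀ r, RowHolds s i r ↔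
    s.real 17 i * objective s r + s.real 18 i ≤ x r
  right : ∀ i ∈ SR, ∀ r, RowHolds s i r ↔
    s.real 17 i * objective s r + s.real 18 i ≤ -x r

/-- The points that satisfy the constraints in `SL` and `SR`. -/
def Feasible (s : RamState) (SL SR : Set ℕ) (r : Fin 2 → ℝ) : Prop :=
  (∀ i ∈ SL, RowHolds s i r) ∧ ∀ i ∈ SR, RowHolds s i r

/-- The number of the feasible sums with objective values between `h` and the variable `23`. -/
noncomputable def countFrom {n : ℕ} (s : RamState) (P Q : Fin n → Fin 2 → ℝ) (SL SR : Set ℕ)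
    (h : ℝ) : ℕ :=
  pairCount P Q (fun r => Feasible s SL SR r ∧ h < objective s r ∧ objective s r ≤ s.real 23 0)

/-- The number of the sums above `v` that satisfy the constraints `i` and `j`. -/
noncomputable def wedgeCount {n : ℕ} (s : RamState) (P Q : Fin n → Fin 2 → ℝ) (i j : ℕ) (v : ℝ) :
    ℕ :=
  pairCount P Q (fun r => RowHolds s i r ∧ RowHolds s j r ∧ v < objective s r)

/-- The result of the walk: the constraints `28` and `29` and the rank `25` determine the
solution. -/
def Output {n : ℕ} (s s' : RamState) (P Q : Fin n → Fin 2 → ℝ) (SL SR : Set ℕ) : Prop :=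
  s'.nat 28 0 ∈ SL ∧ s'.nat 29 0 ∈ SR ∧ ∃ lo hi, hi ≤ s.real 23 0 ∧
    countFrom s P Q SL SR hi < s.nat 0 2 ∧ s.nat 0 2 ≤ countFrom s P Q SL SR lo ∧
    (∀ r, lo < objective s r → objective s r ≤ hi → (Feasible s SL SR r ↔
      RowHolds s (s'.nat 28 0) r ∧ RowHolds s (s'.nat 29 0) r)) ∧
    s'.nat 25 0 + countFrom s P Q SL SR hi =
      s.nat 0 2 + wedgeCount s P Q (s'.nat 28 0) (s'.nat 29 0) hi

variable {n : ℕ} {P Q : Fin n → Fin 2 → ℝ} {x : (Fin 2 → ℝ) → ℝ} {SL SR : Set ℕ} {x₀ : ℝ}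

theorem countFrom_antitone (s : RamState) (P Q : Fin n → Fin 2 → ℝ) (SL SR : Set ℕ) {h h' : ℝ}
    (hh : h ≤ h') : countFrom s P Q SL SR h' ≤ countFrom s P Q SL SR h :=
  pairCount_mono fun _ _ hr => ⟨hr.1, hh.trans_lt hr.2.1, hr.2.2⟩

/-- In the slab between `lo` and `hi`, the constraints `i` and `j` are decisive. -/
theorem countFrom_add_wedgeCount {s : RamState} {i j : ℕ} {lo hi : ℝ} (hlh : lo ≤ hi)
    (htop : hi ≤ s.real 23 0)
    (h : ∀ r, lo < objective s r → objective s r ≤ hi → (Feasible s SL SR r ↔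
      RowHolds s i r ∧ RowHolds s j r)) :
    countFrom s P Q SL SR lo + wedgeCount s P Q i j hi =
      countFrom s P Q SL SR hi + wedgeCount s P Q i j lo := by
  have e1 : countFrom s P Q SL SR lo = countFrom s P Q SL SR hi +
      pairCount P Q (fun r => Feasible s SL SR r ∧ lo < objective s r ∧ objective s r ≤ hi) := by
    refine pairCount_eq_add (fun a b => ⟨fun ⟨h1, h2, h3⟩ => ?_, ?_⟩) (fun a b h1 h2 => ?_)
    · rcases le_or_gt (objective s (P a + Q b)) hi with h4 | h4
      · exact .inr ⟨h1, h2, h4⟩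
      · exact .inl ⟨h1, h4, h3⟩
    · rintro (⟨h1, h2, h3⟩ | ⟨h1, h2, h3⟩)
      · exact ⟨h1, hlh.trans_lt h2, h3⟩
      · exact ⟨h1, h2, h3.trans htop⟩
    · exact absurd h1.2.1 (not_lt.2 h2.2.2)
  have e2 : wedgeCount s P Q i j lo = wedgeCount s P Q i j hi +
      pairCount P Q (fun r => Feasible s SL SR r ∧ lo < objective s r ∧ objective s r ≤ hi) := by
    refine pairCount_eq_add (fun a b => ⟨fun ⟨h1, h2, h3⟩ => ?_, ?_⟩) (fun a b h1 h2 => ?_)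
    · rcases le_or_gt (objective s (P a + Q b)) hi with h4 | h4
      · exact .inr ⟨(h _ h3 h4).2 ⟨h1, h2⟩, h3, h4⟩
      · exact .inl ⟨h1, h2, h4⟩
    · rintro (⟨h1, h2, h3⟩ | ⟨h1, h2, h3⟩)
      · exact ⟨h1, h2, hlh.trans_lt h3⟩
      · exact ⟨((h _ h2 h3).1 h1).1, ((h _ h2 h3).1 h1).2, h2⟩
    · exact absurd h1.2.2 (not_lt.2 h2.2.2)
  omega

theorem runs_slab : ∃ C : ℕ, ∀ (n : ℕ) (P Q : Fin n → Fin 2 → ℝ) (x : (Fin 2 → ℝ) → ℝ)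
    (SL SR : Set ℕ) (x₀ : ℝ) (s₀ s : RamState), Input s₀ P Q x SL SR x₀ → Static s₀ s →
    s.nat 28 0 ∈ SL → s.nat 29 0 ∈ SR →
    slab.Runs s (C * countCost n) (fun s' =>
      (s.nat 21 0 + (wedgeCount s₀ P Q (s.nat 28 0) (s.nat 29 0) (s.real 22 0) -
          wedgeCount s₀ P Q (s.nat 28 0) (s.nat 29 0) (s.real 21 0)) < s₀.nat 0 2 ∧
        s'.nat 21 0 = s.nat 21 0 +
          (wedgeCount s₀ P Q (s.nat 28 0) (s.nat 29 0) (s.real 22 0) -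
            wedgeCount s₀ P Q (s.nat 28 0) (s.nat 29 0) (s.real 21 0)) ∧
        s'.real 21 0 = s.real 22 0 ∧ s'.nat 22 0 = s.nat 22 0 ∨
      s₀.nat 0 2 ≤ s.nat 21 0 + (wedgeCount s₀ P Q (s.nat 28 0) (s.nat 29 0) (s.real 22 0) -
          wedgeCount s₀ P Q (s.nat 28 0) (s.nat 29 0) (s.real 21 0)) ∧
        s'.nat 25 0 = s₀.nat 0 2 - s.nat 21 0 +
          wedgeCount s₀ P Q (s.nat 28 0) (s.nat 29 0) (s.real 21 0) ∧ s'.nat 22 0 = 1) ∧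
      slab.Frame s s') := by
  obtain ⟨C, hC⟩ := runs_wedge
  refine ⟨setLow.maxCost + (C + (setHigh.maxCost + (C + (saveHigh.maxCost + conclude.maxCost)))), ?_⟩
  intro n P Q x SL SR x₀ s₀ s hin hs hL hR
  have hpos := one_le_countCost n
  refine RamProgram.Runs.frame ?_
  have hwedge : ∀ s₁, Static s₀ s₁ → s₁.nat 28 = s.nat 28 → s₁.nat 29 = s.nat 29 →
      wedge.Runs s₁ (C * countCost n) (fun s' => (s'.nat 23 0 =
        wedgeCount s₀ P Q (s.nat 28 0) (s.nat 29 0) (s₁.real 28 0)) ∧ wedge.Frame s₁ s') := by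
    intro s₁ h₁ h28 h29
    refine ((hC n P Q s₁ x (hin.points.of_frame h₁.1 fun j hj => h₁.2.2.2.1 j (by omega))
      (fun r => ?_) (fun r => ?_)).frame).mono le_rfl (fun s' h => ⟨h.1.trans ?_, h.2⟩)
    · rw [h₁.rowHolds, h₁.objective_eq, h₁.2.2.2.2.1, h₁.2.2.2.2.2.1, h28]
      exact hin.left _ hL r
    · rw [h₁.rowHolds, h₁.objective_eq, h₁.2.2.2.2.1, h₁.2.2.2.2.2.1, h29]
      exact hin.right _ hR r
    · rw [h28, h29]
      refine pairCount_congr fun a b => ?_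
      rw [h₁.rowHolds, h₁.rowHolds, h₁.objective_eq]
  simp only [add_mul]
  refine ((setLow.runs_step rfl s).mono (Nat.le_mul_of_pos_right _ hpos) (fun _ h => h)).seq ?_
  rintro s₁ rfl
  have st₁ : Static s₀ (setLow.step s) :=
    hs.of_frame (frame_step _ _) rfl rfl rfl (by decide) rfl rfl rfl rfl
  refine (hwedge _ st₁ (RamProgram.step_nat _ _ rfl) (RamProgram.step_nat _ _ rfl)).seq ?_
  rintro s₂ ⟨a₂, f₂⟩
  have st₂ : Static s₀ s₂ := st₁.of_frame f₂ rfl rfl rfl (by decide) rfl rfl rfl rfl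
  refine ((setHigh.runs_step rfl s₂).mono (Nat.le_mul_of_pos_right _ hpos) (fun _ h => h)).seq ?_
  intro s₃ hs₃
  have f₃ : setHigh.Frame s₂ s₃ := hs₃ ▸ frame_step _ _
  have st₃ : Static s₀ s₃ := st₂.of_frame f₃ rfl rfl rfl (by decide) rfl rfl rfl rfl
  have e28 : s₃.nat 28 = s.nat 28 := by
    rw [f₃.1 28 rfl, f₂.1 28 rfl, RamProgram.step_nat _ _ rfl]
  have e29 : s₃.nat 29 = s.nat 29 := by
    rw [f₃.1 29 rfl, f₂.1 29 rfl, RamProgram.step_nat _ _ rfl]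
  refine (hwedge _ st₃ e28 e29).seq ?_
  rintro s₄ ⟨a₄, f₄⟩
  have st₄ : Static s₀ s₄ := st₃.of_frame f₄ rfl rfl rfl (by decide) rfl rfl rfl rfl
  refine ((saveHigh.runs_step rfl s₄).mono (Nat.le_mul_of_pos_right _ hpos) (fun _ h => h)).seq ?_
  intro s₅ hs₅
  have f₅ : saveHigh.Frame s₄ s₅ := hs₅ ▸ frame_step _ _
  have r₂₁ : s₂.real 21 = s.real 21 := by rw [f₂.2 21 rfl, RamProgram.step_real _ _ rfl]
  have r28 : s₃.real 28 0 = s.real 21 0 := by rw [hs₃]; simp [setHigh, r₂₁]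
  have r28' : (setLow.step s).real 28 0 = s.real 22 0 := by simp [setLow]
  have n25 : s₃.nat 25 0 = s₂.nat 23 0 := by rw [hs₃]; simp [setHigh]
  rw [r28'] at a₂
  rw [r28] at a₄
  have n25' : s₅.nat 25 0 = wedgeCount s₀ P Q (s.nat 28 0) (s.nat 29 0) (s.real 22 0) := by
    rw [f₅.1 25 rfl, f₄.1 25 rfl, n25, a₂]
  have n26 : s₅.nat 26 0 = wedgeCount s₀ P Q (s.nat 28 0) (s.nat 29 0) (s.real 21 0) := by
    rw [hs₅]; simp [saveHigh, a₄]
  have n21 : s₅.nat 21 = s.nat 21 := by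
    rw [f₅.1 21 rfl, f₄.1 21 rfl, f₃.1 21 rfl, f₂.1 21 rfl, RamProgram.step_nat _ _ rfl]
  have n22 : s₅.nat 22 = s.nat 22 := by
    rw [f₅.1 22 rfl, f₄.1 22 rfl, f₃.1 22 rfl, f₂.1 22 rfl, RamProgram.step_nat _ _ rfl]
  have r22 : s₅.real 22 = s.real 22 := by
    rw [f₅.2 22 rfl, f₄.2 22 rfl, f₃.2 22 rfl, f₂.2 22 rfl, RamProgram.step_real _ _ rfl]
  have n0 : s₅.nat 0 = s₀.nat 0 := by rw [f₅.1 0 rfl, st₄.1]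
  refine (RamProgram.runs_of_step rfl ?_).mono (Nat.le_mul_of_pos_right _ hpos) (fun _ h => h)
  by_cases hc : s.nat 21 0 + (wedgeCount s₀ P Q (s.nat 28 0) (s.nat 29 0) (s.real 22 0) -
      wedgeCount s₀ P Q (s.nat 28 0) (s.nat 29 0) (s.real 21 0)) < s₀.nat 0 2
  · left
    refine ⟨hc, ?_, ?_, ?_⟩ <;> simp [conclude, n25', n26, n21, n22, r22, n0, hc]
  · right
    refine ⟨not_lt.1 hc, ?_, ?_⟩ <;> simp [conclude, n25', n26, n21, n0, hc]

end WalkProgram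

namespace WalkProgram

open CountProgram WedgeProgram

/-- The invariant of the walk; `m` bounds the number of the remaining slabs. -/
def Inv {n : ℕ} (s₀ : RamState) (P Q : Fin n → Fin 2 → ℝ) (SL SR : Set ℕ) (m : ℕ)
    (s : RamState) : Prop :=
  Static s₀ s ∧ ((s.nat 22 0 = 0 ∧ m = s.nat 19 0 + s.nat 20 0 + 1 ∧
      s.nat 19 0 < s₀.nat 16 0 ∧ s.nat 20 0 < s₀.nat 18 0 ∧ s.real 21 0 ≤ s₀.real 23 0 ∧
      -- The upper end of the range still to be searched does not exceed the right end of the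
      -- current interval of either envelope, so the two current lines are decisive just below it.
      (s.nat 19 0 + 1 < s₀.nat 16 0 → s.real 21 0 ≤ s₀.real 19 (s.nat 19 0 + 1)) ∧
      (s.nat 20 0 + 1 < s₀.nat 18 0 → s.real 21 0 ≤ s₀.real 20 (s.nat 20 0 + 1)) ∧
      s.nat 21 0 = countFrom s₀ P Q SL SR (s.real 21 0) ∧ s.nat 21 0 < s₀.nat 0 2) ∨
    (s.nat 22 0 = 1 ∧ m = 0 ∧ Output s₀ s P Q SL SR))

/-- Each iteration lowers one of the two stack positions, which bounds the number of slabs by the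
total height of the stacks; each slab costs two wedge counts. -/
theorem runs_walk : ∃ C : ℕ, ∀ (n : ℕ) (P Q : Fin n → Fin 2 → ℝ) (x : (Fin 2 → ℝ) → ℝ)
    (SL SR : Set ℕ) (x₀ : ℝ) (s₀ : RamState), Input s₀ P Q x SL SR x₀ →
    1 ≤ s₀.nat 0 2 → s₀.nat 0 2 ≤ countFrom s₀ P Q SL SR x₀ →
    walk.Runs s₀ (C * ((s₀.nat 16 0 + s₀.nat 18 0 + 1) * countCost n))
      (fun s' => Output s₀ s' P Q SL SR) := by
  obtain ⟨C, hC⟩ := runs_slab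
  set D := (BoolExpr.natLt (.var 22) (.const 1)).cost with hD
  set E := (BoolExpr.realLt (.var 22) (.var 21)).cost with hE
  refine ⟨head.maxCost + (select.maxCost + (E + (C + 1) + move.maxCost) + D), ?_⟩
  intro n P Q x SL SR x₀ s₀ hin hk1 hk
  have hpos := one_le_countCost n
  have hposL := hin.posL
  have hposR := hin.posR
  have hinit : head.Runs s₀ head.maxCost
      (fun s' => Inv s₀ P Q SL SR (s₀.nat 16 0 + s₀.nat 18 0 - 1) s') := by
    have e21 : (head.step s₀).real 21 0 = s₀.real 23 0 := by simp [head]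
    have e19 : (head.step s₀).nat 19 0 = s₀.nat 16 0 - 1 := by simp [head]
    have e20 : (head.step s₀).nat 20 0 = s₀.nat 18 0 - 1 := by simp [head]
    have e0 : (head.step s₀).nat 21 0 = 0 := by simp [head]
    have ec : countFrom s₀ P Q SL SR (s₀.real 23 0) = 0 :=
      pairCount_eq_zero fun i j h => absurd h.2.1 (not_lt.2 h.2.2)
    refine RamProgram.runs_of_step rfl ⟨Static.of_frame ⟨rfl, rfl, rfl, fun _ _ => rfl, rfl, rfl, rfl,
      rfl⟩ (frame_step _ _) rfl rfl rfl (by decide) rfl rfl rfl rfl, .inl ⟨by simp [head], ?_⟩⟩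
    rw [e21, e19, e20, e0, ec]
    exact ⟨by omega, by omega, by omega, le_rfl, fun h => by omega, fun h => by omega, rfl, hk1⟩
  refine (hinit.seq fun s' hs' => RamProgram.runs_while (Inv s₀ P Q SL SR) id
    (select.maxCost + (E + (C * countCost n + 1) + move.maxCost)) ?_ _ s' hs').mono ?_ ?_
  · rintro m s ⟨hs, hI⟩ hc
    have hc' : s.nat 22 0 < 1 := hc
    rcases hI with ⟨h22, rfl, ha, hb, htop, hxL, hxR, hcum, hlt⟩ | ⟨h22, -, -⟩
    swap
    · omega
    set a := s.nat 19 0 with ha0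
    set b := s.nat 20 0 with hb0
    set hi := s.real 21 0 with hhi
    obtain ⟨-, e15, e17, -, -, -, er19, er20⟩ := id hs
    have q28 : (select.step s).nat 28 0 = s₀.nat 15 a := by simp [select, e15, ← ha0]
    have q29 : (select.step s).nat 29 0 = s₀.nat 17 b := by simp [select, e17, ← hb0]
    have q22 : (select.step s).real 22 0 = max (s₀.real 19 a) (s₀.real 20 b) := by
      simp [select, leftLow, er19, er20, ← ha0, ← hb0]
      split_ifs with h
      · rw [max_eq_right h.le]
      · rw [max_eq_left (not_lt.1 h)]
    have hs₁ : Static s₀ (select.step s) :=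
      hs.of_frame (frame_step _ _) rfl rfl rfl (by decide) rfl rfl rfl rfl
    have q21 : (select.step s).real 21 0 = hi := by rw [RamProgram.step_real _ _ rfl]
    have q21' : (select.step s).nat 21 0 = s.nat 21 0 := by rw [RamProgram.step_nat _ _ rfl]
    have q22' : (select.step s).nat 22 0 = 0 := by rw [RamProgram.step_nat _ _ rfl, h22]
    have q19 : (select.step s).nat 19 = s.nat 19 := RamProgram.step_nat _ _ rfl
    have q20 : (select.step s).nat 20 = s.nat 20 := RamProgram.step_nat _ _ rfl
    set lo := max (s₀.real 19 a) (s₀.real 20 b) with hlo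
    have hmemL := hin.envL.mem a ha
    have hmemR := hin.envR.mem b hb
    have hslab : ∀ r, lo < objective s₀ r → objective s₀ r ≤ hi → (Feasible s₀ SL SR r ↔
        RowHolds s₀ (s₀.nat 15 a) r ∧ RowHolds s₀ (s₀.nat 17 b) r) := by
      intro r h1 h2
      refine ⟨fun h => ⟨h.1 _ hmemL, h.2 _ hmemR⟩, fun ⟨h3, h4⟩ => ⟨fun i hi' => ?_, fun i hi' => ?_⟩⟩
      · rw [hin.left _ hi']
        rw [hin.left _ hmemL] at h3
        exact (hin.envL.le i hi' a ha _ ((le_max_left _ _).trans h1.le)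
          (fun h => h2.trans (hxL h))).trans h3
      · rw [hin.right _ hi']
        rw [hin.right _ hmemR] at h4
        exact (hin.envR.le i hi' b hb _ ((le_max_right _ _).trans h1.le)
          (fun h => h2.trans (hxR h))).trans h4
    refine RamProgram.Runs.seq (select.runs_step rfl s) ?_
    rintro s₁ rfl
    have hmid : (RamProgram.ite (.realLt (.var 22) (.var 21)) slab .skip).Runs (select.step s)
        (E + (C * countCost n + 1)) (fun s₂ => Static s₀ s₂ ∧ s₂.nat 19 = s.nat 19 ∧
          s₂.nat 20 = s.nat 20 ∧ ((s₂.nat 22 0 = 0 ∧ s₂.real 21 0 ≤ lo ∧ s₂.real 21 0 ≤ hi ∧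
            s₂.nat 21 0 = countFrom s₀ P Q SL SR (s₂.real 21 0) ∧ s₂.nat 21 0 < s₀.nat 0 2) ∨
            (s₂.nat 22 0 = 1 ∧ Output s₀ s₂ P Q SL SR))) := by
      refine RamProgram.Runs.ite (fun hc₁ => ?_) (fun hc₁ => ?_)
      · have hlohi : lo < hi := by
          have : (select.step s).real 22 0 < (select.step s).real 21 0 := hc₁
          rwa [q22, q21] at this
        have hrel := countFrom_add_wedgeCount (P := P) (Q := Q) hlohi.le htop hslab
        have hwm : wedgeCount s₀ P Q (s₀.nat 15 a) (s₀.nat 17 b) hi ≤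
            wedgeCount s₀ P Q (s₀.nat 15 a) (s₀.nat 17 b) lo :=
          pairCount_mono fun _ _ hr => ⟨hr.1, hr.2.1, hlohi.trans hr.2.2⟩
        refine (hC n P Q x SL SR x₀ s₀ _ hin hs₁ (by rwa [q28]) (by rwa [q29])).mono (by omega) ?_
        rintro s₂ ⟨hres, hf⟩
        rw [q28, q29, q22, q21, q21'] at hres
        refine ⟨hs₁.of_frame hf rfl rfl rfl (by decide) rfl rfl rfl rfl,
          by rw [hf.1 19 rfl, q19], by rw [hf.1 20 rfl, q20], ?_⟩
        rcases hres with ⟨h1, h2, h3, h4⟩ | ⟨h1, h2, h3⟩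
        · refine .inl ⟨by rw [h4, q22'], h3.le, by rw [h3]; exact hlohi.le, ?_,
            by omega⟩
          rw [h3]
          omega
        · refine .inr ⟨h3, ?_⟩
          have f28 : s₂.nat 28 0 = s₀.nat 15 a := by rw [hf.1 28 rfl, q28]
          have f29 : s₂.nat 29 0 = s₀.nat 17 b := by rw [hf.1 29 rfl, q29]
          unfold Output
          rw [f28, f29]
          exact ⟨hmemL, hmemR, lo, hi, htop, by omega, by omega, hslab, by omega⟩
      · have hlohi : hi ≤ lo := by
          have : ¬ (select.step s).real 22 0 < (select.step s).real 21 0 := hc₁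
          rw [q22, q21] at this
          exact not_lt.1 this
        refine (RamProgram.runs_of_step (p := .skip) rfl ?_).mono
          (Nat.le_add_left _ _) (fun _ h => h)
        simp only [RamProgram.step_skip]
        refine ⟨hs₁, q19, q20, .inl ⟨q22', by rw [q21]; exact hlohi, by rw [q21], ?_, ?_⟩⟩
        · rw [q21', q21]; exact hcum
        · rw [q21']; exact hlt
    refine hmid.seq ?_
    rintro s₂ ⟨hs₂, g19, g20, hres⟩
    refine RamProgram.runs_of_step rfl ?_
    have hs₃ : Static s₀ (move.step s₂) :=
      hs₂.of_frame (frame_step _ _) rfl rfl rfl (by decide) rfl rfl rfl rfl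
    have m22 : (move.step s₂).nat 22 = s₂.nat 22 := RamProgram.step_nat _ _ rfl
    rcases hres with ⟨k22, hle, hle', hcum', hlt'⟩ | ⟨k22, hout⟩
    · have m21 : (move.step s₂).nat 21 = s₂.nat 21 := RamProgram.step_nat _ _ rfl
      have m21' : (move.step s₂).real 21 = s₂.real 21 := RamProgram.step_real _ _ rfl
      -- The walk cannot run off the bottom: at `lo ≤ x₀` all sums counted by `countFrom` at `x₀`
      -- would already be counted, and these are at least `k`. Hence the envelope with the higher
      -- breakpoint is not at its lowest line, whose breakpoint is `x₀`.
      have hx : x₀ < lo := by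
        by_contra h
        have := countFrom_antitone s₀ P Q SL SR (hle.trans (not_lt.1 h))
        omega
      have hs₂' := hs₂
      obtain ⟨-, -, -, -, -, -, g19', g20'⟩ := hs₂'
      by_cases hcase : s₀.real 19 a < s₀.real 20 b
      · have hlo' : lo = s₀.real 20 b := max_eq_right hcase.le
        have hb1 : b ≠ 0 := by
          intro h0
          rw [hlo', h0, hin.envR.bottom hposR] at hx
          exact lt_irrefl _ hx
        have m19 : (move.step s₂).nat 19 0 = a := by
          simp [move, leftLow, g19, g20, g19', g20', ← ha0, ← hb0, hcase]
        have m20 : (move.step s₂).nat 20 0 = b - 1 := by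
          simp [move, leftLow, g19, g20, g19', g20', ← ha0, ← hb0, hcase]
        refine ⟨a + (b - 1) + 1, ⟨hs₃, .inl ?_⟩, by simp only [id]; omega⟩
        rw [m19, m20, m21, m21', m22]
        refine ⟨k22, rfl, ha, by omega, hle'.trans htop, fun h => hle'.trans (hxL h), fun _ => ?_,
          hcum', hlt'⟩
        rw [Nat.sub_add_cancel (by omega), ← hlo']
        exact hle
      · have hlo' : lo = s₀.real 19 a := max_eq_left (not_lt.1 hcase)
        have ha1 : a ≠ 0 := by
          intro h0
          rw [hlo', h0, hin.envL.bottom hposL] at hx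
          exact lt_irrefl _ hx
        have m19 : (move.step s₂).nat 19 0 = a - 1 := by
          simp [move, leftLow, g19, g20, g19', g20', ← ha0, ← hb0, hcase]
        have m20 : (move.step s₂).nat 20 0 = b := by
          simp [move, leftLow, g19, g20, g19', g20', ← ha0, ← hb0, hcase]
        refine ⟨(a - 1) + b + 1, ⟨hs₃, .inl ?_⟩, by simp only [id]; omega⟩
        rw [m19, m20, m21, m21', m22]
        refine ⟨k22, rfl, by omega, hb, hle'.trans htop, fun _ => ?_, fun h => hle'.trans (hxR h),
          hcum', hlt'⟩
        rw [Nat.sub_add_cancel (by omega), ← hlo']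
        exact hle
    · refine ⟨0, ⟨hs₃, .inr ⟨by rw [m22, k22], rfl, ?_⟩⟩, by simp only [id]; omega⟩
      unfold Output
      rw [RamProgram.step_nat (a := 28) _ _ rfl, RamProgram.step_nat (a := 29) _ _ rfl,
        RamProgram.step_nat (a := 25) _ _ rfl]
      exact hout
  · simp only [id]
    have h1 : s₀.nat 16 0 + s₀.nat 18 0 - 1 + 1 ≤ s₀.nat 16 0 + s₀.nat 18 0 + 1 := by omega
    set N := s₀.nat 16 0 + s₀.nat 18 0 + 1 with hN
    have h2 : head.maxCost ≤ head.maxCost * (N * countCost n) :=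
      Nat.le_mul_of_pos_right _ (Nat.mul_pos (by omega) hpos)
    have h3 : select.maxCost + (E + (C * countCost n + 1) + move.maxCost) + D ≤
        (select.maxCost + (E + (C + 1) + move.maxCost) + D) * countCost n := by
      have e1 := Nat.le_mul_of_pos_right select.maxCost hpos
      have e2 := Nat.le_mul_of_pos_right E hpos
      have e3 := Nat.le_mul_of_pos_right move.maxCost hpos
      have e4 := Nat.le_mul_of_pos_right D hpos
      simp only [add_mul, one_mul]
      omega
    calc _ ≤ head.maxCost * (N * countCost n) +
        N * ((select.maxCost + (E + (C + 1) + move.maxCost) + D) * countCost n) :=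
          Nat.add_le_add h2 (Nat.mul_le_mul h1 h3)
      _ = _ := by ring
  · rintro s' ⟨m, ⟨hs, hI⟩, hc⟩
    have hc' : ¬ s'.nat 22 0 < 1 := hc
    rcases hI with ⟨h22, -⟩ | ⟨-, -, h⟩
    · omega
    · exact h

end WalkProgram

/-! ## The answers of an instance -/

theorem List.getElem?_eq_some_iff_countP {l : List ℝ} (hl : l.Pairwise (· ≥ ·)) (k : ℕ) (v : ℝ) :
    l[k]? = some v ↔ l.countP (v < ·) < k + 1 ∧ k + 1 ≤ l.countP (v ≤ ·) := by
  induction l generalizing k with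
  | nil => simp
  | cons a l ih =>
    rw [List.pairwise_cons] at hl
    have hle : a ≤ v → l.countP (v < ·) = 0 := fun ha => by
      rw [List.countP_eq_zero]
      exact fun b hb => by simpa using (hl.1 b hb).trans ha
    have hlt : a < v → l.countP (v ≤ ·) = 0 := fun ha => by
      rw [List.countP_eq_zero]
      exact fun b hb => by simpa using (hl.1 b hb).trans_lt ha
    simp only [List.countP_cons, decide_eq_true_eq]
    rcases lt_trichotomy a v with h | h | h
    · rw [hle h.le, hlt h, if_neg h.not_ge, if_neg h.not_gt]
      cases k with
      | zero => simp [h.ne]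
      | succ k => simp [ih hl.2, hlt h]
    · subst h
      rw [hle le_rfl, if_pos le_rfl, if_neg (lt_irrefl a)]
      cases k with
      | zero => simp
      | succ k => simp [ih hl.2, hle le_rfl]
    · rw [if_pos h, if_pos h.le]
      cases k with
      | zero => simp [h.ne']
      | succ k => simp [ih hl.2]

-- Being the solution becomes a statement about two counts, of the values above `v` and of those at
-- least `v`. All later comparisons of instances are comparisons of such counts.
open Classical in
theorem isKthLargest_iff (M : Multiset ℝ) (k : ℕ) (v : ℝ) :
    IsKthLargest M k v ↔ M.countP (v < ·) < k ∧ k ≤ M.countP (v ≤ ·) := by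
  have h := fun p : ℝ → Prop => congrArg (Multiset.countP p) (M.sort_eq (· ≥ ·))
  simp only [Multiset.coe_countP] at h
  rw [← h, ← h, IsKthLargest]
  cases k with
  | zero => simp
  | succ k =>
    rw [Nat.add_sub_cancel, List.getElem?_eq_some_iff_countP (M.pairwise_sort (· ≥ ·))]
    simp

theorem isKthLargest_of_card (M : Multiset ℝ) {k : ℕ} (h1 : 1 ≤ k) (hk : k ≤ Multiset.card M) :
    ∃ v, IsKthLargest M k v := by
  refine ⟨(M.sort (· ≥ ·))[k - 1]'(by rw [Multiset.length_sort]; omega), h1, ?_⟩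
  simp

namespace SelInstance

variable {lam n : ℕ} {I : SelInstance lam n}

/-- The point `r` satisfies the constraint number `i`. -/
def Satisfies (I : SelInstance lam n) (i : Fin lam) (r : Fin 2 → ℝ) : Prop :=
  I.b i ≤ I.A i 0 * r 0 + I.A i 1 * r 1

/-- The value of the objective function. -/
def obj (I : SelInstance lam n) (r : Fin 2 → ℝ) : ℝ := I.f 0 * r 0 + I.f 1 * r 1

open Classical in
theorem countP_values (I : SelInstance lam n) (p : ℝ → Prop) : I.values.countP p =
    pairCount I.P I.Q (fun r => (∀ i, I.Satisfies i r) ∧ p (I.obj r)) := by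
  have hprod : (Finset.univ.val.map I.P ×ˢ Finset.univ.val.map I.Q).map (fun pq => pq.1 + pq.2) =
      (Finset.univ : Finset (Fin n × Fin n)).val.map (fun x => I.P x.1 + I.Q x.2) := by
    rw [← Finset.univ_product_univ, Finset.product_val]
    simp only [SProd.sprod, Multiset.product, Multiset.bind_map, Multiset.map_bind,
      Multiset.map_map]
    rfl
  rw [values, constrainedMinkowskiSum, hprod, Multiset.countP_map, Multiset.filter_filter,
    Multiset.filter_map, Multiset.card_map, pairCount, Finset.card_def, Finset.filter_val]
  refine congrArg Multiset.card ?_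
  convert Multiset.filter_congr fun x _ => ?_
  simp [Satisfies, obj, Pi.le_def, Matrix.mulVec, dotProduct, Fin.sum_univ_two, and_comm]

theorem isAnswer_iff {v : ℝ} : I.IsAnswer v ↔
    pairCount I.P I.Q (fun r => (∀ i, I.Satisfies i r) ∧ v < I.obj r) < I.k ∧
      I.k ≤ pairCount I.P I.Q (fun r => (∀ i, I.Satisfies i r) ∧ v ≤ I.obj r) := by
  rw [IsAnswer, isKthLargest_iff, countP_values, countP_values]

theorem Valid.exists_isAnswer (h : I.Valid) : ∃ v, I.IsAnswer v := isKthLargest_of_card _ h.1 h.2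

theorem IsAnswer.valid {v : ℝ} (h : I.IsAnswer v) : I.Valid := by
  obtain ⟨h1, h2⟩ := h
  obtain ⟨h3, -⟩ := List.getElem?_eq_some_iff.1 h2
  rw [Multiset.length_sort] at h3
  exact ⟨h1, by omega⟩

theorem IsAnswer.unique {v w : ℝ} (h : I.IsAnswer v) (h' : I.IsAnswer w) : v = w :=
  Option.some_injective _ (h.2.symm.trans h'.2)

theorem Valid.pos (h : I.Valid) : 0 < n := by
  rcases Nat.eq_zero_or_pos n with rfl | h0
  · obtain ⟨h1, h2⟩ := h
    have : I.values = 0 := by simp [values, constrainedMinkowskiSum]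
    rw [this] at h2
    simp at h2; omega
  · exact h0

end SelInstance

/-! ## The reduction to two constraints -/

namespace ReduceProgram

open WedgeProgram WalkProgram

variable {lam n : ℕ} {I : SelInstance lam n} {s s' : RamState} {SL SR : Set ℕ} {x₀ v : ℝ}

/-- The walk is prepared: among the points above a feasible one, the feasible points are those that
satisfy the constraints in `SL` and `SR` and lie below the variable `23`. -/
structure Prepared (I : SelInstance lam n) (s : RamState) (SL SR : Set ℕ) (x₀ : ℝ) : Prop where
  input : Input s I.P I.Q (fun r => I.f 0 * r 1 - I.f 1 * r 0) SL SR x₀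
  f_eq : ∀ j : Fin 2, s.real 7 j = I.f j
  k_eq : s.nat 0 2 = I.k
  feasible : ∀ a b, (∀ i, I.Satisfies i (I.P a + I.Q b)) →
    Feasible s SL SR (I.P a + I.Q b) ∧ I.obj (I.P a + I.Q b) ≤ s.real 23 0
  satisfies : ∀ r₀ r, (∀ i, I.Satisfies i r₀) → Feasible s SL SR r → I.obj r ≤ s.real 23 0 →
    I.obj r₀ ≤ I.obj r → ∀ i, I.Satisfies i r
  lower : ∀ a b, x₀ < I.obj (I.P a + I.Q b)

theorem Prepared.objective_eq (h : Prepared I s SL SR x₀) (r : Fin 2 → ℝ) :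
    objective s r = I.obj r := by
  rw [objective, SelInstance.obj, ← h.f_eq, ← h.f_eq]; rfl

theorem _root_.SelInstance.IsAnswer.exists_point (hv : I.IsAnswer v) :
    ∃ a b, (∀ i, I.Satisfies i (I.P a + I.Q b)) ∧ I.obj (I.P a + I.Q b) = v := by
  by_contra hn
  push Not at hn
  obtain ⟨h1, h2⟩ := SelInstance.isAnswer_iff.1 hv
  exact absurd (h2.trans (pairCount_mono fun a b h => ⟨h.1, lt_of_le_of_ne h.2 (hn a b h.1).symm⟩))
    (not_le.2 h1)

/-- The solution is attained at a feasible point. Hence from `v` upwards the conditions that were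
dropped, being inherited from that point, cost nothing. -/
theorem Prepared.satisfies_iff (h : Prepared I s SL SR x₀) (hv : I.IsAnswer v) (a b : Fin n)
    (hvr : v ≤ I.obj (I.P a + I.Q b)) : (∀ i, I.Satisfies i (I.P a + I.Q b)) ↔
      Feasible s SL SR (I.P a + I.Q b) ∧ I.obj (I.P a + I.Q b) ≤ s.real 23 0 := by
  obtain ⟨a₀, b₀, h1, h2⟩ := hv.exists_point
  exact ⟨h.feasible a b, fun hf => h.satisfies _ _ h1 hf.1 hf.2 (h2.trans_le hvr)⟩

theorem Prepared.countFrom_lt (h : Prepared I s SL SR x₀) (hv : I.IsAnswer v) :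
    countFrom s I.P I.Q SL SR v < I.k := by
  refine lt_of_le_of_lt (pairCount_mono fun a b hab => ?_) (SelInstance.isAnswer_iff.1 hv).1
  rw [h.objective_eq] at hab
  exact ⟨(h.satisfies_iff hv a b hab.2.1.le).2 ⟨hab.1, hab.2.2⟩, hab.2.1⟩

theorem Prepared.le_pairCount (h : Prepared I s SL SR x₀) (hv : I.IsAnswer v) :
    I.k ≤ pairCount I.P I.Q (fun r => Feasible s SL SR r ∧ v ≤ I.obj r ∧ I.obj r ≤ s.real 23 0) := by
  refine (SelInstance.isAnswer_iff.1 hv).2.trans (pairCount_mono fun a b hab => ?_)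
  have := h.feasible a b hab.1
  exact ⟨this.1, hab.2, this.2⟩

theorem Prepared.le_countFrom (h : Prepared I s SL SR x₀) (hv : I.IsAnswer v) :
    I.k ≤ countFrom s I.P I.Q SL SR x₀ := by
  refine (h.le_pairCount hv).trans (pairCount_mono fun a b hab => ?_)
  rw [h.objective_eq]
  exact ⟨hab.1, h.lower a b, hab.2.2⟩

/-- The two constraints that the walk finds have the same answer. -/
theorem Prepared.isAnswer (h : Prepared I s SL SR x₀) (hv : I.IsAnswer v)
    (ho : Output s s' I.P I.Q SL SR) {J : SelInstance 2 n} (hP : J.P = I.P) (hQ : J.Q = I.Q)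
    (hf : J.f = I.f) (hk : J.k = s'.nat 25 0)
    (h0 : ∀ r, J.Satisfies 0 r ↔ RowHolds s (s'.nat 28 0) r)
    (h1 : ∀ r, J.Satisfies 1 r ↔ RowHolds s (s'.nat 29 0) r) : J.IsAnswer v := by
  obtain ⟨-, -, lo, hi, htop, hhi, hlo, hslab, hcount⟩ := ho
  have hkeq := h.k_eq
  have hlt := h.countFrom_lt hv
  have hle := h.le_pairCount hv
  -- The counts at `hi` and `lo` enclose `k`, so the solution lies in the slab.
  have hlov : lo < v := by
    by_contra hn
    have := countFrom_antitone s I.P I.Q SL SR (not_lt.1 hn)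
    omega
  have hvhi : v ≤ hi := by
    by_contra hn
    have := hle.trans (pairCount_mono (T := fun r => Feasible s SL SR r ∧ hi < objective s r ∧
      objective s r ≤ s.real 23 0) fun a b hab => by
        rw [h.objective_eq]
        exact ⟨hab.1, (not_le.1 hn).trans_le hab.2.1, hab.2.2⟩)
    change _ ≤ countFrom s I.P I.Q SL SR hi at this
    omega
  have hsum := countFrom_add_wedgeCount (P := I.P) (Q := I.Q) hvhi htop
    (fun r h2 h3 => hslab r (hlov.trans h2) h3)
  have hobj : J.obj = I.obj := by funext r; rw [SelInstance.obj, SelInstance.obj, hf]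
  rw [SelInstance.isAnswer_iff, hP, hQ, hobj, hk]
  have hsat : ∀ r, (∀ i, J.Satisfies i r) ↔
      RowHolds s (s'.nat 28 0) r ∧ RowHolds s (s'.nat 29 0) r := fun r => by
    rw [Fin.forall_fin_two, h0, h1]
  simp only [hsat]
  -- Within the slab the two instances count the same sums. Above `hi` the new one counts the wedge
  -- and the old one the feasible sums, and the corrected rank absorbs exactly this difference.
  have e1 : pairCount I.P I.Q (fun r => (RowHolds s (s'.nat 28 0) r ∧ RowHolds s (s'.nat 29 0) r) ∧
      v < I.obj r) = wedgeCount s I.P I.Q (s'.nat 28 0) (s'.nat 29 0) v :=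
    pairCount_congr fun a b => by rw [h.objective_eq, and_assoc]
  have e2 : pairCount I.P I.Q (fun r => (RowHolds s (s'.nat 28 0) r ∧ RowHolds s (s'.nat 29 0) r) ∧
      v ≤ I.obj r) = wedgeCount s I.P I.Q (s'.nat 28 0) (s'.nat 29 0) hi + pairCount I.P I.Q
      (fun r => Feasible s SL SR r ∧ v ≤ I.obj r ∧ I.obj r ≤ hi) := by
    refine pairCount_eq_add (fun a b => ?_) (fun a b h2 h3 => ?_)
    · have := hslab (I.P a + I.Q b)
      rw [h.objective_eq] at this ⊢
      refine ⟨fun ⟨⟨h2, h3⟩, h4⟩ => ?_, ?_⟩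
      · rcases le_or_gt (I.obj (I.P a + I.Q b)) hi with h5 | h5
        · exact .inr ⟨(this (hlov.trans_le h4) h5).2 ⟨h2, h3⟩, h4, h5⟩
        · exact .inl ⟨h2, h3, h5⟩
      · rintro (⟨h2, h3, h4⟩ | ⟨h2, h3, h4⟩)
        · exact ⟨⟨h2, h3⟩, hvhi.trans h4.le⟩
        · exact ⟨(this (hlov.trans_le h3) h4).1 h2, h3⟩
    · rw [h.objective_eq] at h2
      exact absurd h2.2.2 (not_lt.2 h3.2.2)
  have e3 : pairCount I.P I.Q (fun r => Feasible s SL SR r ∧ v ≤ I.obj r ∧ I.obj r ≤ s.real 23 0) =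
      countFrom s I.P I.Q SL SR hi + pairCount I.P I.Q
        (fun r => Feasible s SL SR r ∧ v ≤ I.obj r ∧ I.obj r ≤ hi) := by
    refine pairCount_eq_add (fun a b => ?_) (fun a b h2 h3 => ?_)
    · rw [h.objective_eq]
      refine ⟨fun ⟨h2, h3, h4⟩ => ?_, ?_⟩
      · rcases le_or_gt (I.obj (I.P a + I.Q b)) hi with h5 | h5
        · exact .inr ⟨h2, h3, h5⟩
        · exact .inl ⟨h2, h5, h4⟩
      · rintro (⟨h2, h3, h4⟩ | ⟨h2, h3, h4⟩)
        · exact ⟨h2, hvhi.trans h3.le, h4⟩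
        · exact ⟨h2, h3, h4.trans htop⟩
    · rw [h.objective_eq] at h2
      exact absurd h2.2.1 (not_lt.2 h3.2.2)
  omega

/-- The orthogonal constraints `lam` and `lam + 1` hold at all points, and the memory holds the
remaining constraints, the lines and the bound on the objective values. -/
structure HasRows (I : SelInstance lam n) (s : RamState) (B : ℝ) : Prop where
  points : HoldsPoints s I.P I.Q
  f_eq : ∀ j : Fin 2, s.real 7 j = I.f j
  k_eq : s.nat 0 2 = I.k
  row : ∀ (i : Fin lam) r, RowHolds s i r ↔ I.Satisfies i r
  row_left : ∀ r, RowHolds s lam r ↔ -B ≤ I.f 0 * r 1 - I.f 1 * r 0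
  row_right : ∀ r, RowHolds s (lam + 1) r ↔ -B ≤ -(I.f 0 * r 1 - I.f 1 * r 0)
  side_left : lineSide (I.f 0) (I.f 1) (s.real 4 lam) (s.real 5 lam) = 1
  side_right : lineSide (I.f 0) (I.f 1) (s.real 4 (lam + 1)) (s.real 5 (lam + 1)) = 2
  bound : ∀ a b, |I.f 0 * (I.P a + I.Q b) 1 - I.f 1 * (I.P a + I.Q b) 0| ≤ B
  bound_obj : ∀ a b, |I.obj (I.P a + I.Q b)| < B

/-- The constraints of the given side. -/
def sideSet (I : SelInstance lam n) (s : RamState) (σ : ℕ) : Set ℕ :=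
  {i | i < lam + 2 ∧ lineSide (I.f 0) (I.f 1) (s.real 4 i) (s.real 5 i) = σ}

/-- Constraints of sides `1` and `2` are kept in the two sets, the others with a negative
coefficient of `y` are contained in `htop`, and the rest holds at every point at least as high as a
feasible one. -/
theorem HasRows.prepared {B : ℝ} (h : HasRows I s B) (hf : 0 < I.f 0 * I.f 0 + I.f 1 * I.f 1)
    (hslope : ∀ i < lam + 2, s.real 17 i = lineSlope (I.f 0) (I.f 1) (s.real 4 i) (s.real 5 i))
    (hicpt : ∀ i < lam + 2,
      s.real 18 i = lineIntercept (I.f 0) (I.f 1) (s.real 4 i) (s.real 5 i) (s.real 6 i))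
    (htop : ∀ y, y ≤ s.real 23 0 ↔ y ≤ B ∧ ∀ i < lam + 2,
      lineSide (I.f 0) (I.f 1) (s.real 4 i) (s.real 5 i) = 0 →
      alongCoeff (I.f 0) (I.f 1) (s.real 4 i) (s.real 5 i) < 0 →
      s.real 6 i * (I.f 0 * I.f 0 + I.f 1 * I.f 1) ≤
        alongCoeff (I.f 0) (I.f 1) (s.real 4 i) (s.real 5 i) * y)
    (hL : IsEnvelope (s.real 17) (s.real 18) (sideSet I s 1) (-B) (s.nat 16 0) (s.nat 15)
      (s.real 19))
    (hR : IsEnvelope (s.real 17) (s.real 18) (sideSet I s 2) (-B) (s.nat 18 0) (s.nat 17)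
      (s.real 20)) : Prepared I s (sideSet I s 1) (sideSet I s 2) (-B) := by
  have f0 : s.real 7 0 = I.f 0 := h.f_eq 0
  have f1 : s.real 7 1 = I.f 1 := h.f_eq 1
  have hobj : ∀ r, objective s r = I.obj r := fun r => by
    rw [objective, SelInstance.obj, f0, f1]
  have hall : ∀ a b, (∀ i, I.Satisfies i (I.P a + I.Q b)) → ∀ i < lam + 2,
      RowHolds s i (I.P a + I.Q b) := by
    intro a b hs i hi
    have hb := abs_le.1 (h.bound a b)
    by_cases h1 : i < lam
    · exact (h.row ⟨i, h1⟩ _).2 (hs ⟨i, h1⟩)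
    · obtain rfl | rfl : i = lam ∨ i = lam + 1 := by omega
      · exact (h.row_left _).2 hb.1
      · exact (h.row_right _).2 (neg_le_neg hb.2)
  have hform : ∀ i, lineSide (I.f 0) (I.f 1) (s.real 4 i) (s.real 5 i) = 0 → ∀ r,
      RowHolds s i r ↔ s.real 6 i * (I.f 0 * I.f 0 + I.f 1 * I.f 1) ≤
        alongCoeff (I.f 0) (I.f 1) (s.real 4 i) (s.real 5 i) * I.obj r := by
    intro i hi r
    rw [RowHolds, le_form_iff hf, acrossCoeff_eq_zero (by omega) (by omega), zero_mul, add_zero,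
      SelInstance.obj]
  refine ⟨⟨h.points, hL, hR, hL.pos lam ⟨by omega, h.side_left⟩,
    hR.pos (lam + 1) ⟨by omega, h.side_right⟩, ?_, ?_⟩, h.f_eq, h.k_eq, ?_, ?_, ?_⟩
  · rintro i ⟨hi, hside⟩ r
    rw [RowHolds, le_form_iff_of_side_eq_one hf hside, hslope i hi, hicpt i hi, hobj,
      SelInstance.obj]
  · rintro i ⟨hi, hside⟩ r
    rw [RowHolds, le_form_iff_of_side_eq_two hf hside, hslope i hi, hicpt i hi, hobj,
      SelInstance.obj]
  · intro a b hs
    have hs' := hall a b hs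
    refine ⟨⟨fun i hi => hs' i hi.1, fun i hi => hs' i hi.1⟩, (htop _).2
      ⟨(le_abs_self _).trans (h.bound_obj a b).le, fun i hi hside _ => ?_⟩⟩
    exact (hform i hside _).1 (hs' i hi)
  · intro r₀ r hs hfeas hr hle i
    have hi : (i : ℕ) < lam + 2 := by omega
    rw [← h.row]
    by_cases h1 : lineSide (I.f 0) (I.f 1) (s.real 4 i) (s.real 5 i) = 1
    · exact hfeas.1 i ⟨hi, h1⟩
    by_cases h2 : lineSide (I.f 0) (I.f 1) (s.real 4 i) (s.real 5 i) = 2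
    · exact hfeas.2 i ⟨hi, h2⟩
    have h3 : lineSide (I.f 0) (I.f 1) (s.real 4 i) (s.real 5 i) = 0 := by
      have := lineSide_le_two (f₀ := I.f 0) (f₁ := I.f 1) (a₀ := s.real 4 i) (a₁ := s.real 5 i)
      omega
    rw [hform _ h3]
    rcases lt_or_ge (alongCoeff (I.f 0) (I.f 1) (s.real 4 i) (s.real 5 i)) 0 with h4 | h4
    · exact ((htop _).1 hr).2 i hi h3 h4
    · exact ((hform _ h3 r₀).1 ((h.row i r₀).2 (hs i))).trans (mul_le_mul_of_nonneg_left hle h4)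
  · intro a b
    exact (abs_lt.1 (h.bound_obj a b)).1

end ReduceProgram

namespace ReduceProgram

open WedgeProgram WalkProgram PrepareProgram SortProgram EnvelopeProgram

variable {lam n : ℕ} {I : SelInstance lam n} {s s' : RamState}

theorem _root_.Encodes.of_frame (h : Encodes s I) (h0 : s'.nat 0 = s.nat 0)
    (hr : ∀ j < 8, s'.real j = s.real j) : Encodes s' I := by
  refine ⟨by rw [h0, h.lam_eq], by rw [h0, h.n_eq], by rw [h0, h.k_eq], fun i j => ?_,
    fun i j => ?_, fun i j => ?_, fun i => ?_, fun j => ?_⟩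
  · rw [hr j (by omega), h.P_eq]
  · rw [hr (2 + j) (by omega), h.Q_eq]
  · rw [hr (4 + j) (by omega), h.A_eq]
  · rw [hr 6 (by omega), h.b_eq]
  · rw [hr 7 (by omega), h.f_eq]

theorem HasRows.of_frame {B : ℝ} (h : HasRows I s B) (h0 : s'.nat 0 = s.nat 0)
    (hr : ∀ j < 8, s'.real j = s.real j) : HasRows I s' B := by
  have hrow : ∀ i r, RowHolds s' i r ↔ RowHolds s i r := fun i r => by
    rw [RowHolds, RowHolds, hr 4 (by omega), hr 5 (by omega), hr 6 (by omega)]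
  have e4 := hr 4 (by omega)
  have e5 := hr 5 (by omega)
  exact ⟨h.points.of_frame h0 fun j hj => hr j (by omega), fun j => by rw [hr 7 (by omega), h.f_eq],
    by rw [h0, h.k_eq], fun i r => (hrow _ r).trans (h.row i r),
    fun r => (hrow _ r).trans (h.row_left r), fun r => (hrow _ r).trans (h.row_right r),
    by rw [e4, e5, h.side_left], by rw [e4, e5, h.side_right], h.bound, h.bound_obj⟩

/-- From `|f · s| ≤ (|f|² + |s|²) / 2` and `|p + q|² ≤ 2 (|p|² + |q|²)`. The summand `1` makes the
bound strict. -/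
theorem abs_form_lt {f₀ f₁ p₀ p₁ q₀ q₁ B : ℝ}
    (hB : 1 + (f₀ * f₀ + f₁ * f₁) + (p₀ * p₀ + p₁ * p₁ + (q₀ * q₀ + q₁ * q₁)) ≤ B) :
    |f₀ * (p₀ + q₀) + f₁ * (p₁ + q₁)| < B := by
  rw [abs_lt]
  constructor <;> nlinarith [sq_nonneg (f₀ + (p₀ + q₀)), sq_nonneg (f₁ + (p₁ + q₁)),
    sq_nonneg (f₀ - (p₀ + q₀)), sq_nonneg (f₁ - (p₁ + q₁)), sq_nonneg (p₀ - q₀),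
    sq_nonneg (p₁ - q₁), mul_self_nonneg f₀, mul_self_nonneg f₁]

theorem hasRows_addRows (h : Encodes s I) (hf : 0 < I.f 0 * I.f 0 + I.f 1 * I.f 1)
    (hB : s.real 16 0 = 1 + (I.f 0 * I.f 0 + I.f 1 * I.f 1) + ∑ i ∈ Finset.range n,
      (s.real 0 i * s.real 0 i + s.real 1 i * s.real 1 i +
        (s.real 2 i * s.real 2 i + s.real 3 i * s.real 3 i))) :
    HasRows I (addRows.step s) (s.real 16 0) ∧ (addRows.step s).nat 27 0 = lam + 2 := by
  have f0 : s.real 7 0 = I.f 0 := h.f_eq 0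
  have f1 : s.real 7 1 = I.f 1 := h.f_eq 1
  have e4 : ∀ i, (addRows.step s).real 4 i =
      if i = lam + 1 then I.f 1 else if i = lam then 0 - I.f 1 else s.real 4 i := fun i => by
    simp [addRows, h.lam_eq, f1]
  have e5 : ∀ i, (addRows.step s).real 5 i =
      if i = lam + 1 then 0 - I.f 0 else if i = lam then I.f 0 else s.real 5 i := fun i => by
    simp [addRows, h.lam_eq, f0]
  have e6 : ∀ i, (addRows.step s).real 6 i = if i = lam + 1 then 0 - s.real 16 0 else
      if i = lam then 0 - s.real 16 0 else s.real 6 i := fun i => by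
    simp [addRows, h.lam_eq]
  have e0 : ∀ i, (addRows.step s).nat 0 i = s.nat 0 i := fun i => by
    rw [RamProgram.step_nat _ _ rfl]
  have er : ∀ j < 4, (addRows.step s).real j = s.real j := fun j hj =>
    RamProgram.step_real _ _ (by simp [addRows, RamProgram.writesReal]; omega)
  have hsum : ∀ a b : Fin n, I.P a 0 * I.P a 0 + I.P a 1 * I.P a 1 +
      (I.Q b 0 * I.Q b 0 + I.Q b 1 * I.Q b 1) ≤ ∑ i ∈ Finset.range n,
      (s.real 0 i * s.real 0 i + s.real 1 i * s.real 1 i +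
        (s.real 2 i * s.real 2 i + s.real 3 i * s.real 3 i)) := by
    intro a b
    rw [Finset.sum_add_distrib]
    have hP0 : s.real 0 a = I.P a 0 := h.P_eq a 0
    have hP1 : s.real 1 a = I.P a 1 := h.P_eq a 1
    have hQ0 : s.real 2 b = I.Q b 0 := h.Q_eq b 0
    have hQ1 : s.real 3 b = I.Q b 1 := h.Q_eq b 1
    rw [← hP0, ← hP1, ← hQ0, ← hQ1]
    refine add_le_add ?_ ?_
    · exact Finset.single_le_sum
        (f := fun i => s.real 0 i * s.real 0 i + s.real 1 i * s.real 1 i)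
        (fun i _ => add_nonneg (mul_self_nonneg _) (mul_self_nonneg _)) (Finset.mem_range.2 a.2)
    · exact Finset.single_le_sum
        (f := fun i => s.real 2 i * s.real 2 i + s.real 3 i * s.real 3 i)
        (fun i _ => add_nonneg (mul_self_nonneg _) (mul_self_nonneg _)) (Finset.mem_range.2 b.2)
  refine ⟨⟨⟨by rw [e0, h.n_eq], fun i j => ?_, fun i j => ?_⟩, fun j => ?_, by rw [e0, h.k_eq],
    fun i r => ?_, fun r => ?_, fun r => ?_, ?_, ?_, fun a b => ?_, fun a b => ?_⟩, ?_⟩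
  · rw [er j (by omega), h.P_eq]
  · rw [er (2 + j) (by omega), h.Q_eq]
  · rw [RamProgram.step_real _ _ rfl, h.f_eq]
  · have h4 : s.real 4 i = I.A i 0 := h.A_eq i 0
    have h5 : s.real 5 i = I.A i 1 := h.A_eq i 1
    have hi := i.2
    rw [RowHolds, e4, e5, e6, if_neg (by omega), if_neg (by omega), if_neg (by omega),
      if_neg (by omega), if_neg (by omega), if_neg (by omega), h4, h5, h.b_eq,
      SelInstance.Satisfies]
  · rw [RowHolds, e4, e5, e6]
    simp only [Nat.left_eq_add, one_ne_zero, if_false, if_true]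
    constructor <;> intro hr <;> linarith
  · rw [RowHolds, e4, e5, e6]
    simp only [if_true]
    constructor <;> intro hr <;> linarith
  · rw [e4, e5, lineSide, acrossCoeff]
    simp only [Nat.left_eq_add, one_ne_zero, if_false, if_true]
    rw [if_pos (by linarith)]
  · rw [e4, e5, lineSide, acrossCoeff]
    simp only [if_true]
    rw [if_neg (by linarith), if_pos (by linarith)]
  -- The orthogonal coordinate is the linear form with gradient `(-f₁, f₀)`, which has the same
  -- length, so the same `B` bounds it.
  · have := abs_form_lt (f₀ := -I.f 1) (f₁ := I.f 0) (B := s.real 16 0)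
      (p₀ := I.P a 0) (p₁ := I.P a 1) (q₀ := I.Q b 0) (q₁ := I.Q b 1) (by linarith [hsum a b])
    refine le_of_eq_of_le (congrArg _ ?_) this.le
    simp only [Pi.add_apply]
    ring
  · exact abs_form_lt (by linarith [hsum a b])
  · simp [addRows, h.lam_eq]

/-- The preparation of the walk. -/
def prepare : RamProgram :=
  bound ;; addRows ;; lines ;; sort ;; envelope 15 16 19 1 ;; envelope 17 18 20 2

theorem runs_prepare : ∃ C : ℕ, ∀ (lam n : ℕ) (I : SelInstance lam n) (s : RamState),
    Encodes s I → 0 < I.f 0 * I.f 0 + I.f 1 * I.f 1 →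
    s.real 24 0 = I.f 0 * I.f 0 + I.f 1 * I.f 1 →
    prepare.Runs s (C * ((n + 1) + (lam + 3) * (Nat.clog 2 (lam + 2) + 1))) (fun s' =>
      ∃ SL SR x₀, Prepared I s' SL SR x₀ ∧ s'.nat 16 0 ≤ lam + 2 ∧ s'.nat 18 0 ≤ lam + 2) := by
  obtain ⟨C₁, h₁⟩ := runs_bound
  obtain ⟨C₂, h₂⟩ := runs_lines
  obtain ⟨C₃, h₃⟩ := runs_sort
  obtain ⟨C₄, h₄⟩ := runs_envelope (si := 15) (r := 16) (sx := 19) (σ := 1)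
    (.inl ⟨rfl, rfl, rfl, rfl⟩)
  obtain ⟨C₅, h₅⟩ := runs_envelope (si := 17) (r := 18) (sx := 20) (σ := 2)
    (.inr ⟨rfl, rfl, rfl, rfl⟩)
  refine ⟨C₁ + (addRows.maxCost + (C₂ + (C₃ + (C₄ + C₅)))), ?_⟩
  intro lam n I s hs hf hD
  set W := (n + 1) + (lam + 3) * (Nat.clog 2 (lam + 2) + 1) with hW
  have hW1 : n + 1 ≤ W := by omega
  have hW2 : (lam + 3) * (Nat.clog 2 (lam + 2) + 1) ≤ W := by omega
  have hW3 : lam + 3 ≤ W := (Nat.le_mul_of_pos_right _ (by omega)).trans hW2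
  have hW4 : 1 ≤ W := by omega
  simp only [add_mul]
  refine (((h₁ s).frame).mono (Nat.mul_le_mul_left _ (by rwa [hs.n_eq])) (fun _ h => h)).seq ?_
  rintro s₁ ⟨hB, hf₁⟩
  have enc₁ : Encodes s₁ I := hs.of_frame (hf₁.1 0 rfl) fun j hj => hf₁.2 j (by
    interval_cases j <;> rfl)
  have hrows := hasRows_addRows enc₁ hf (by
    rw [hB, hD, hs.n_eq, hf₁.2 0 rfl, hf₁.2 1 rfl, hf₁.2 2 rfl, hf₁.2 3 rfl])
  have D₁ : s₁.real 24 0 = I.f 0 * I.f 0 + I.f 1 * I.f 1 := by rw [hf₁.2 24 rfl, hD]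
  refine ((addRows.runs_step rfl s₁).mono (Nat.le_mul_of_pos_right _ hW4) (fun _ h => h)).seq ?_
  intro s₂ hs₂
  have hf₂ : addRows.Frame s₁ s₂ := hs₂ ▸ frame_step _ _
  rw [← hs₂] at hrows
  obtain ⟨hrows, h27⟩ := hrows
  have B₂ : s₂.real 16 0 = s₁.real 16 0 := by rw [hf₂.2 16 rfl]
  rw [← B₂] at hrows
  have f0 : s₂.real 7 0 = I.f 0 := hrows.f_eq 0
  have f1 : s₂.real 7 1 = I.f 1 := hrows.f_eq 1
  have hl := (h₂ s₂ (by rw [hf₂.2 24 rfl, D₁, f0, f1])).frame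
  rw [h27] at hl
  refine (hl.mono (Nat.mul_le_mul_left _ hW3) (fun _ h => h)).seq ?_
  rintro s₃ ⟨⟨hlines, hlen⟩, hf₃⟩
  have hhold : Holds (s₃.nat 1) 0 (List.range (lam + 2)) := by
    rw [holds_iff_getElem]
    intro j hj
    rw [List.length_range] at hj
    simp [hlines.idx j hj]
  have hsort := (h₃ s₃ (List.range (lam + 2)) _ (by rw [hlen, List.length_range]) rfl hhold).frame
  rw [List.length_range] at hsort
  refine (hsort.mono (Nat.mul_le_mul_left _ hW2) (fun _ h => h)).seq ?_
  rintro s₄ ⟨⟨L, hperm, hpw, hhold₄, -⟩, hf₄⟩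
  have hLlen : L.length = lam + 2 := by rw [hperm.length_eq, List.length_range]
  have hmem : ∀ i, i ∈ L ↔ i < lam + 2 := fun i => by rw [hperm.mem_iff, List.mem_range]
  -- The sort was by slope with ties broken by index; the first component of the lexicographic order
  -- gives the order of the slopes.
  have hpw₄ : L.Pairwise (fun a b => s₄.real 17 a ≤ s₄.real 17 b) := by
    refine hpw.imp_of_mem fun {a b} ha hb hab => ?_
    rw [hf₄.2 17 rfl, ← hlines.key a ((hmem a).1 ha), ← hlines.key b ((hmem b).1 hb)]
    exact (Prod.Lex.monotone_fst _ _ hab)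
  have n27 : s₄.nat 27 0 = L.length := by rw [hLlen, hf₄.1 27 rfl, hf₃.1 27 rfl, h27]
  refine (((h₄ s₄ L n27 hhold₄ hpw₄).frame).mono
    (Nat.mul_le_mul_left _ (by rwa [hLlen])) (fun _ h => h)).seq ?_
  rintro s₅ ⟨⟨hL, hLr⟩, hf₅⟩
  refine ((h₅ s₅ L (by rw [hf₅.1 27 rfl, n27]) (by rwa [hf₅.1 1 rfl])
    (by rwa [hf₅.2 17 rfl])).frame).mono (Nat.mul_le_mul_left _ (by rwa [hLlen])) ?_
  rintro s₆ ⟨⟨hR, hRr⟩, hf₆⟩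
  rw [hLlen] at hLr hRr
  have r16 : s₆.real 16 0 = s₂.real 16 0 := by
    rw [hf₆.2 16 rfl, hf₅.2 16 rfl, hf₄.2 16 rfl, hf₃.2 16 rfl]
  have r23 : s₆.real 23 = s₃.real 23 := by rw [hf₆.2 23 rfl, hf₅.2 23 rfl, hf₄.2 23 rfl]
  have r17 : s₆.real 17 = s₃.real 17 := by rw [hf₆.2 17 rfl, hf₅.2 17 rfl, hf₄.2 17 rfl]
  have r18 : s₆.real 18 = s₃.real 18 := by rw [hf₆.2 18 rfl, hf₅.2 18 rfl, hf₄.2 18 rfl]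
  have rj : ∀ j < 8, s₆.real j = s₂.real j := fun j hj => by
    rw [hf₆.2 j (by interval_cases j <;> rfl), hf₅.2 j (by interval_cases j <;> rfl),
      hf₄.2 j (by interval_cases j <;> rfl), hf₃.2 j (by interval_cases j <;> rfl)]
  have n0 : s₆.nat 0 = s₂.nat 0 := by rw [hf₆.1 0 rfl, hf₅.1 0 rfl, hf₄.1 0 rfl, hf₃.1 0 rfl]
  have r4 := rj 4 (by norm_num)
  have r5 := rj 5 (by norm_num)
  have r6 := rj 6 (by norm_num)
  have hside : ∀ σ, {i | i ∈ L ∧ s₄.nat 14 i = σ} = sideSet I s₆ σ := fun σ => by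
    ext i
    rw [Set.mem_ofPred_eq, sideSet, Set.mem_ofPred_eq, hmem, hf₄.1 14 rfl, r4, r5]
    refine and_congr_right fun hi => ?_
    rw [hlines.side i hi, f0, f1]
  rw [hf₅.1 14 rfl] at hR
  rw [hside] at hL hR
  refine ⟨_, _, _, (hrows.of_frame n0 rj).prepared hf (fun i hi => ?_) (fun i hi => ?_)
    (fun y => ?_) ?_ ?_, ?_, hRr⟩
  · rw [r17, hlines.slope i hi, f0, f1, r4, r5]
  · rw [r18, hlines.icpt i hi, f0, f1, r4, r5, r6]
  · rw [r23, hlines.top, f0, f1, r4, r5, r6]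
  · rw [hf₄.2 16 rfl, hf₃.2 16 rfl, hf₄.2 17 rfl, hf₄.2 18 rfl] at hL
    rw [r17, r18, hf₆.1 16 rfl, hf₆.1 15 rfl, hf₆.2 19 rfl]
    exact hL
  · rw [hf₅.2 16 rfl, hf₄.2 16 rfl, hf₃.2 16 rfl, hf₅.2 17 rfl, hf₅.2 18 rfl, hf₄.2 17 rfl,
      hf₄.2 18 rfl] at hR
    rw [r17, r18]
    exact hR
  · rw [hf₆.1 16 rfl]
    exact hLr

end ReduceProgram

/-- The instance in the memory. -/
def SelInstance.ofState (lam n : ℕ) (s : RamState) : SelInstance lam n where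
  P i j := s.real j i
  Q i j := s.real (2 + j) i
  A i j := s.real (4 + j) i
  b i := s.real 6 i
  f j := s.real 7 j
  k := s.nat 0 2

theorem encodes_ofState {lam n : ℕ} {s : RamState} (h0 : s.nat 0 0 = lam) (h1 : s.nat 0 1 = n) :
    Encodes s (SelInstance.ofState lam n s) :=
  ⟨h0, h1, rfl, fun _ _ => rfl, fun _ _ => rfl, fun _ _ => rfl, fun _ => rfl, fun _ => rfl⟩

namespace ReduceProgram

open WedgeProgram WalkProgram PrepareProgram CountProgram

variable {lam n : ℕ} {I : SelInstance lam n} {s s' : RamState}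

theorem ofState_P_eq (h : HoldsPoints s I.P I.Q) (lam' : ℕ) :
    (SelInstance.ofState lam' n s).P = I.P := by
  funext i j; exact h.P_eq i j

theorem ofState_Q_eq (h : HoldsPoints s I.P I.Q) (lam' : ℕ) :
    (SelInstance.ofState lam' n s).Q = I.Q := by
  funext i j; exact h.Q_eq i j

theorem ofState_f_eq (h : ∀ j : Fin 2, s.real 7 j = I.f j) (lam' : ℕ) :
    (SelInstance.ofState lam' n s).f = I.f := funext h

theorem _root_.Encodes.holdsPoints (h : Encodes s I) : HoldsPoints s I.P I.Q :=
  ⟨h.n_eq, h.P_eq, h.Q_eq⟩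

/-- The squared length of the gradient of the objective function. -/
def gradient : RamProgram := .letReal 24 (.add (.mul f0Expr f0Expr) (.mul f1Expr f1Expr))

/-- The reduction for a constant objective function. -/
def reduceConst : RamProgram :=
  .setNat 0 (.const 0) (.const 2) ;; .setNat 0 (.const 2) (.const 1) ;;
  .setReal 4 (.const 0) (.const 0) ;; .setReal 4 (.const 1) (.const 0) ;;
  .setReal 5 (.const 0) (.const 0) ;; .setReal 5 (.const 1) (.const 0) ;;
  .setReal 6 (.const 0) (.const 0) ;; .setReal 6 (.const 1) (.const 0)

/-- The constraints `28` and `29` replace the constraints `0` and `1`. -/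
def writeRows : RamProgram :=
  -- The chosen rows may themselves be rows `0` or `1`, so both are saved before anything is
  -- overwritten.
  .letReal 25 (.get 4 (.var 28)) ;; .letReal 26 (.get 5 (.var 28)) ;;
  .letReal 27 (.get 6 (.var 28)) ;; .letReal 29 (.get 4 (.var 29)) ;;
  .letReal 30 (.get 5 (.var 29)) ;; .letReal 31 (.get 6 (.var 29)) ;;
  .setReal 4 (.const 0) (.var 25) ;; .setReal 4 (.const 1) (.var 29) ;;
  .setReal 5 (.const 0) (.var 26) ;; .setReal 5 (.const 1) (.var 30) ;;
  .setReal 6 (.const 0) (.var 27) ;; .setReal 6 (.const 1) (.var 31) ;;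
  .setNat 0 (.const 0) (.const 2) ;; .setNat 0 (.const 2) (.var 25)

/-- The reduction to two constraints. -/
def reduce : RamProgram :=
  gradient ;; .ite (.realLt (.const 0) (.var 24)) (prepare ;; walk ;; writeRows) reduceConst

/-- The memory holds an instance with two constraints, with the same point sets and the same
objective function as `I`, and with the answer `v`. -/
def Reduced (I : SelInstance lam n) (v : ℝ) (s' : RamState) : Prop :=
  ∃ J : SelInstance 2 n, Encodes s' J ∧ J.P = I.P ∧ J.Q = I.Q ∧ J.f = I.f ∧ J.IsAnswer v

/-- All objective values are `0`, hence so is the solution. Trivial constraints and rank `1`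
reproduce it, since some sum exists. -/
theorem reduceConst_step {v : ℝ} (h : HoldsPoints s I.P I.Q) (h7 : ∀ j : Fin 2, s.real 7 j = I.f j)
    (hv : I.IsAnswer v) (hf : ¬ 0 < I.f 0 * I.f 0 + I.f 1 * I.f 1) :
    Reduced I v (reduceConst.step s) := by
  set s' := reduceConst.step s with hs'
  have e4 : ∀ i < 2, s'.real 4 i = 0 := fun i hi => by interval_cases i <;> simp [hs', reduceConst]
  have e5 : ∀ i < 2, s'.real 5 i = 0 := fun i hi => by interval_cases i <;> simp [hs', reduceConst]
  have e6 : ∀ i < 2, s'.real 6 i = 0 := fun i hi => by interval_cases i <;> simp [hs', reduceConst]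
  have hpts : HoldsPoints s' I.P I.Q := ⟨by simp [hs', reduceConst, h.n_eq],
    fun i j => by rw [RamProgram.step_real _ _ (by fin_cases j <;> rfl), h.P_eq],
    fun i j => by rw [RamProgram.step_real _ _ (by fin_cases j <;> rfl), h.Q_eq]⟩
  have h7' : ∀ j : Fin 2, s'.real 7 j = I.f j := fun j => by
    rw [RamProgram.step_real _ _ rfl, h7]
  refine ⟨.ofState 2 n s', encodes_ofState (by simp [hs', reduceConst]) hpts.n_eq,
    ofState_P_eq hpts 2, ofState_Q_eq hpts 2, ofState_f_eq h7' 2, ?_⟩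
  have hf0 : I.f 0 = 0 := by nlinarith [mul_self_nonneg (I.f 0), mul_self_nonneg (I.f 1)]
  have hf1 : I.f 1 = 0 := by nlinarith [mul_self_nonneg (I.f 0), mul_self_nonneg (I.f 1)]
  have hobj : ∀ r, I.obj r = 0 := fun r => by rw [SelInstance.obj, hf0, hf1]; ring
  have hobj' : ∀ r, (SelInstance.ofState 2 n s').obj r = I.obj r := fun r => by
    rw [SelInstance.obj, ofState_f_eq h7' 2, SelInstance.obj]
  have hk : (SelInstance.ofState 2 n s').k = 1 := by simp [SelInstance.ofState, hs', reduceConst]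
  obtain ⟨a, b, -, hab⟩ := hv.exists_point
  rw [hobj] at hab
  subst hab
  rw [SelInstance.isAnswer_iff, hk, ofState_P_eq hpts 2, ofState_Q_eq hpts 2]
  simp only [hobj', hobj, lt_irrefl, and_false, le_refl, and_true]
  refine ⟨by simp [pairCount], ?_⟩
  refine (hv.valid.1.trans (SelInstance.isAnswer_iff.1 hv).2).trans
    (pairCount_mono fun _ _ _ i => ?_)
  have h4 := e4 i i.2
  have h5 := e5 i i.2
  have h6 := e6 i i.2
  simp [SelInstance.Satisfies, SelInstance.ofState, h4, h5, h6]

theorem writeRows_step {s₀ : RamState} {v x₀ : ℝ} {SL SR : Set ℕ} (h : Prepared I s₀ SL SR x₀)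
    (hv : I.IsAnswer v) (ho : Output s₀ s I.P I.Q SL SR) (h0 : s.nat 0 = s₀.nat 0)
    (hr : ∀ j < 8, s.real j = s₀.real j) : Reduced I v (writeRows.step s) := by
  set s' := writeRows.step s with hs'
  have hpts : HoldsPoints s' I.P I.Q := by
    have hp := h.input.points.of_frame h0 fun j hj => hr j (by omega)
    exact ⟨by simp [hs', writeRows, hp.n_eq],
      fun i j => by rw [RamProgram.step_real _ _ (by fin_cases j <;> rfl), hp.P_eq],
      fun i j => by rw [RamProgram.step_real _ _ (by fin_cases j <;> rfl), hp.Q_eq]⟩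
  have h7 : ∀ j : Fin 2, s'.real 7 j = I.f j := fun j => by
    rw [RamProgram.step_real _ _ rfl, hr 7 (by omega), h.f_eq]
  refine ⟨.ofState 2 n s', encodes_ofState (by simp [hs', writeRows]) hpts.n_eq,
    ofState_P_eq hpts 2, ofState_Q_eq hpts 2, ofState_f_eq h7 2,
    h.isAnswer hv ho (ofState_P_eq hpts 2) (ofState_Q_eq hpts 2) (ofState_f_eq h7 2) ?_
      (fun r => ?_) (fun r => ?_)⟩
  · simp [SelInstance.ofState, hs', writeRows]
  · simp [SelInstance.Satisfies, SelInstance.ofState, hs', writeRows, RowHolds, hr 4, hr 5, hr 6]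
  · simp [SelInstance.Satisfies, SelInstance.ofState, hs', writeRows, RowHolds, hr 4, hr 5, hr 6]

/-- The running time of `reduce`, up to a constant factor. -/
def reduceCost (lam n : ℕ) : ℕ :=
  (n + 1) + (lam + 3) * (Nat.clog 2 (lam + 2) + 1) + (lam + 3) * countCost n

theorem runs_reduce : ∃ C : ℕ, ∀ (lam n : ℕ) (I : SelInstance lam n) (s : RamState) (v : ℝ),
    I.IsAnswer v → Encodes s I → reduce.Runs s (C * reduceCost lam n) (Reduced I v) := by
  obtain ⟨C₁, h₁⟩ := runs_prepare
  obtain ⟨C₂, h₂⟩ := runs_walk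
  set E := (BoolExpr.realLt (.const 0) (.var 24)).cost with hE
  refine ⟨gradient.maxCost + (E + (C₁ + (2 * C₂ + writeRows.maxCost) + reduceConst.maxCost)), ?_⟩
  intro lam n I s v hv hs
  have hW : 1 ≤ reduceCost lam n := by unfold reduceCost; omega
  have f0 : s.real 7 0 = I.f 0 := hs.f_eq 0
  have f1 : s.real 7 1 = I.f 1 := hs.f_eq 1
  rw [add_mul]
  refine ((gradient.runs_step rfl s).mono (Nat.le_mul_of_pos_right _ hW) (fun _ h => h)).seq ?_
  intro s₁ hs₁
  have hf₁ : gradient.Frame s s₁ := hs₁ ▸ frame_step _ _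
  have D₁ : s₁.real 24 0 = I.f 0 * I.f 0 + I.f 1 * I.f 1 := by
    rw [hs₁]; simp [gradient, f0, f1]
  have enc₁ : Encodes s₁ I := hs.of_frame (hf₁.1 0 rfl) fun j hj => hf₁.2 j (by
    interval_cases j <;> rfl)
  refine (RamProgram.Runs.ite (T := (C₁ + (2 * C₂ + writeRows.maxCost) + reduceConst.maxCost) *
    reduceCost lam n) (fun hc => ?_) (fun hc => ?_)).mono ?_ (fun _ h => h)
  · have hpos : 0 < I.f 0 * I.f 0 + I.f 1 * I.f 1 := by simpa [D₁] using hc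
    refine RamProgram.Runs.mono (T := C₁ * reduceCost lam n + (2 * C₂ * reduceCost lam n +
      writeRows.maxCost)) ?_ ?_ (fun _ h => h)
    · refine ((h₁ lam n I s₁ enc₁ hpos D₁).mono (Nat.mul_le_mul_left _ (by unfold reduceCost; omega))
        (fun _ h => h)).seq ?_
      rintro s₂ ⟨SL, SR, x₀, hp, hl, hr⟩
      refine (((h₂ n I.P I.Q _ SL SR x₀ s₂ hp.input (by rw [hp.k_eq]; exact hv.valid.1)
        (by rw [hp.k_eq]; exact hp.le_countFrom hv)).frame).mono ?_ (fun _ h => h)).seq ?_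
      -- Each stack has height at most `lam + 2`, so the two heights plus one are at most `2 * (lam
      -- + 3)`.
      · calc C₂ * ((s₂.nat 16 0 + s₂.nat 18 0 + 1) * countCost n)
            ≤ C₂ * ((2 * (lam + 3)) * countCost n) :=
              Nat.mul_le_mul_left _ (Nat.mul_le_mul_right _ (by omega))
          _ = 2 * C₂ * ((lam + 3) * countCost n) := by ring
          _ ≤ 2 * C₂ * reduceCost lam n := Nat.mul_le_mul_left _ (by unfold reduceCost; omega)
      · rintro s₃ ⟨ho, hf₃⟩
        exact RamProgram.runs_of_step rfl (writeRows_step hp hv ho (hf₃.1 0 rfl) fun j hj =>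
          hf₃.2 j (by interval_cases j <;> rfl))
    · nlinarith [Nat.le_mul_of_pos_right writeRows.maxCost hW]
  · have hn : ¬ 0 < I.f 0 * I.f 0 + I.f 1 * I.f 1 := by simpa [D₁] using hc
    refine (RamProgram.runs_of_step rfl (reduceConst_step enc₁.holdsPoints enc₁.f_eq hv hn)).mono
      ?_ (fun _ h => h)
    nlinarith [Nat.le_mul_of_pos_right reduceConst.maxCost hW]
  · rw [add_mul E]
    exact Nat.add_le_add_right (Nat.le_mul_of_pos_right _ hW) _

end ReduceProgram

/-! ### The running time in terms of natural logarithms. -/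

theorem Nat.clog_two_le_log {m : ℕ} (hm : 0 < m) : (Nat.clog 2 m : ℝ) ≤ 3 / 2 * Real.log m + 1 := by
  rcases Nat.lt_or_ge 1 m with h | h
  · have h1 : 2 ^ (Nat.clog 2 m - 1) < m := Nat.pow_pred_clog_lt_self one_lt_two h
    have h2 : ((2 : ℝ) ^ (Nat.clog 2 m - 1)) ≤ m := by exact_mod_cast h1.le
    have h3 := Real.log_le_log (by positivity) h2
    rw [Real.log_pow] at h3
    have h4 : (Nat.clog 2 m : ℝ) ≤ ((Nat.clog 2 m - 1 : ℕ) : ℝ) + 1 := by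
      exact_mod_cast (by omega : Nat.clog 2 m ≤ Nat.clog 2 m - 1 + 1)
    -- The factor `3 / 2` exceeds `1 / log 2`.
    have h5 := Real.log_two_gt_d9
    nlinarith [Nat.cast_nonneg (α := ℝ) (Nat.clog 2 m - 1)]
  · obtain rfl : m = 1 := by omega
    simp

namespace ReduceProgram

/-- For `n = 1` the term with `n log n` vanishes, so constants and multiples of `lam` must be
absorbed by `lam log lam`; this works because `lam ≥ 3 > e`. The three parts of the cost sum up to
at most `46.5` times the first term plus `36` times the second, whence `47`. -/
theorem reduceCost_le {lam n : ℕ} (hlam : 2 < lam) (hn : 0 < n) : (reduceCost lam n : ℝ) ≤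
    47 * ((lam : ℝ) * ((n : ℝ) * Real.log n) + (lam : ℝ) * Real.log lam) := by
  have hlam' : (3 : ℝ) ≤ lam := by exact_mod_cast hlam
  have hn' : (1 : ℝ) ≤ n := by exact_mod_cast hn
  have h2 := Real.log_two_gt_d9
  have h2' := Real.log_two_lt_d9
  have hl : 1 ≤ Real.log lam := by
    rw [Real.le_log_iff_exp_le (by positivity)]
    exact (Real.exp_one_lt_d9.trans (by norm_num)).le.trans hlam'
  have hx : 0 ≤ Real.log n := Real.log_nonneg hn'
  have e1 : (Nat.clog 2 (lam + 2) : ℝ) ≤ 3 / 2 * Real.log lam + 3 := by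
    have h : (Nat.clog 2 (lam + 2) : ℝ) ≤ Nat.clog 2 (2 * lam) := by
      exact_mod_cast Nat.clog_mono_right 2 (by omega)
    have h' := Nat.clog_two_le_log (m := 2 * lam) (by omega)
    rw [Nat.cast_mul, Real.log_mul (by norm_num) (by positivity)] at h'
    push_cast at h'
    linarith
  have e2 : (Nat.clog 2 (n + n) : ℝ) ≤ 3 / 2 * Real.log n + 3 := by
    have h' := Nat.clog_two_le_log (m := n + n) (by omega)
    rw [← two_mul, Nat.cast_mul, Real.log_mul (by norm_num) (by positivity)] at h'
    push_cast at h'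
    rw [← two_mul]
    linarith
  -- The summand `1` covers `n = 1`; otherwise `log n ≥ log 2 > 2 / 3`.
  have e3 : (n : ℝ) ≤ 3 / 2 * (n * Real.log n) + 1 := by
    rcases Nat.lt_or_ge 1 n with h | h
    · have h' : Real.log 2 ≤ Real.log n := Real.log_le_log (by norm_num) (by exact_mod_cast h)
      nlinarith
    · obtain rfl : n = 1 := by omega
      simp
  unfold reduceCost CountProgram.countCost
  push_cast
  set l := Real.log lam
  set x := Real.log n
  have e4 : (lam : ℝ) * n ≤ 3 / 2 * (lam * (n * x)) + lam * l := by nlinarith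
  have e5 : ((lam : ℝ) + 3) * (Nat.clog 2 (lam + 2) + 1) ≤ 2 * lam * (3 / 2 * l + 4) :=
    mul_le_mul (by linarith) (by linarith) (by positivity) (by positivity)
  have e6 : ((lam : ℝ) + 3) * ((n + n + 1) * (Nat.clog 2 (n + n) + 1)) ≤
      2 * lam * (3 * n * (3 / 2 * x + 4)) :=
    mul_le_mul (by linarith) (mul_le_mul (by linarith) (by linarith) (by positivity)
      (by positivity)) (by positivity) (by positivity)
  have e7 : (n : ℝ) + 1 ≤ lam * n := by nlinarith
  have e8 : (lam : ℝ) ≤ lam * l := le_mul_of_one_le_right (by positivity) hl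
  have e9 : 0 ≤ (lam : ℝ) * (n * x) := by positivity
  linarith

end ReduceProgram

/-! ### Padding an instance with trivial constraints. -/

section Padding

/-- The constraints number `2, …, m + 1` become trivial. -/
def padRows : ℕ → RamProgram
  | 0 => .skip
  | m + 1 => padRows m ;; .setReal 4 (.const (m + 2)) (.const 0) ;;
      .setReal 5 (.const (m + 2)) (.const 0) ;; .setReal 6 (.const (m + 2)) (.const 0)

theorem straight_padRows (m : ℕ) : (padRows m).straight = true := by
  induction m with
  | zero => rfl
  | succ m ih => simp [padRows, RamProgram.straight, ih]

theorem writesNat_padRows (m a : ℕ) : (padRows m).writesNat a = false := by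
  induction m with
  | zero => rfl
  | succ m ih => simp [padRows, RamProgram.writesNat, ih]

theorem padRows_step (m : ℕ) (s : RamState) (a i : ℕ) : ((padRows m).step s).real a i =
    if (a = 4 ∨ a = 5 ∨ a = 6) ∧ 2 ≤ i ∧ i < m + 2 then 0 else s.real a i := by
  induction m with
  | zero => simp [padRows]; omega
  | succ m ih =>
    simp only [padRows, RamProgram.step_seq, RamProgram.step_setReal, RamState.updateReal_real,
      NatExpr.eval, RealExpr.eval, ih, Rat.cast_zero]
    split_ifs <;> first | rfl | omega

/-- The instance with trivial constraints added. -/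
def padding (m : ℕ) : RamProgram := padRows m ;; .setNat 0 (.const 0) (.const (m + 2))

theorem padding_step {m n : ℕ} {I : SelInstance 2 n} {s : RamState} (hs : Encodes s I) :
    ∃ J : SelInstance (m + 2) n, Encodes ((padding m).step s) J ∧
      ∀ v, J.IsAnswer v ↔ I.IsAnswer v := by
  set s' := (padding m).step s with hs'
  have hr : ∀ a i, s'.real a i =
      if (a = 4 ∨ a = 5 ∨ a = 6) ∧ 2 ≤ i ∧ i < m + 2 then 0 else s.real a i := fun a i => by
    rw [← padRows_step]; rfl
  have hn : ∀ i, s'.nat 0 i = if i = 0 then m + 2 else s.nat 0 i := fun i => by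
    simp [hs', padding, RamProgram.step_nat _ _ (writesNat_padRows m 0)]
  refine ⟨.ofState (m + 2) n s', encodes_ofState (by simp [hn]) (by simp [hn, hs.n_eq]),
    fun v => ?_⟩
  have hP : (SelInstance.ofState (m + 2) n s').P = I.P := by
    funext i j
    rw [← hs.P_eq]
    exact (hr _ _).trans (if_neg (by omega))
  have hQ : (SelInstance.ofState (m + 2) n s').Q = I.Q := by
    funext i j
    rw [← hs.Q_eq]
    exact (hr _ _).trans (if_neg (by omega))
  have hobj : (SelInstance.ofState (m + 2) n s').obj = I.obj := by
    funext r
    rw [SelInstance.obj, SelInstance.obj, ← hs.f_eq, ← hs.f_eq]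
    simp [SelInstance.ofState, hr]
  have hk : (SelInstance.ofState (m + 2) n s').k = I.k := by
    rw [← hs.k_eq]
    exact (hn 2).trans (if_neg (by omega))
  have hsat : ∀ r, (∀ i, (SelInstance.ofState (m + 2) n s').Satisfies i r) ↔
      ∀ i, I.Satisfies i r := by
    intro r
    have hlow : ∀ i : Fin 2, (SelInstance.ofState (m + 2) n s').Satisfies
        ⟨i, by omega⟩ r ↔ I.Satisfies i r := fun i => by
      have hi : ¬ 2 ≤ (i : ℕ) := by omega
      simp [SelInstance.Satisfies, SelInstance.ofState, hr, hi, ← hs.A_eq, ← hs.b_eq]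
    refine ⟨fun h i => (hlow i).1 (h _), fun h i => ?_⟩
    by_cases hi : (i : ℕ) < 2
    · exact (hlow ⟨i, hi⟩).2 (h _)
    · simp [SelInstance.Satisfies, SelInstance.ofState, hr, not_lt.1 hi]
  rw [SelInstance.isAnswer_iff, SelInstance.isAnswer_iff, hP, hQ, hobj, hk]
  simp only [hsat]

end Padding

/-! ### Transferring algorithms between two and `lam` constraints. -/

theorem exists_solvesSelection : ∃ C : ℝ, ∀ (p₂ : RamProgram) (T₂ : ℕ → ℝ),
    SolvesSelection p₂ 2 T₂ → ∃ p : RamProgram, ∀ (lam : ℕ), 2 < lam →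
      SolvesSelection p lam (fun n : ℕ =>
        C * ((lam : ℝ) * ((n : ℝ) * Real.log n) + (lam : ℝ) * Real.log lam + T₂ n)) := by
  obtain ⟨C, hC⟩ := ReduceProgram.runs_reduce
  -- The reduction accounts for `C * 47`; the additional `1` pays for the run of `p₂`.
  refine ⟨C * 47 + 1, fun p₂ T₂ h₂ => ⟨.seq ReduceProgram.reduce p₂, fun lam hlam n I s hI hs => ?_⟩⟩
  obtain ⟨v, hv⟩ := hI.exists_isAnswer
  obtain ⟨t, s', he, ht, J, hJ, -, -, -, hJv⟩ := hC lam n I s v hv hs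
  obtain ⟨t', s'', he', ht', hans⟩ := h₂ n J s' hJv.valid hJ
  refine ⟨t + t', s'', he.seq he', ?_, hans.unique hJv ▸ hv⟩
  have h1 := ReduceProgram.reduceCost_le hlam hI.pos
  have h2 : (t : ℝ) ≤ C * ReduceProgram.reduceCost lam n := by exact_mod_cast ht
  have h3 := mul_le_mul_of_nonneg_left h1 (Nat.cast_nonneg (α := ℝ) C)
  have h4 : 0 ≤ (lam : ℝ) * ((n : ℝ) * Real.log n) + (lam : ℝ) * Real.log lam := by positivity
  -- The function `T₂` is arbitrary, but at this `n` it bounds an actual number of steps.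
  have h5 : 0 ≤ T₂ n := (Nat.cast_nonneg _).trans ht'
  have h6 := mul_nonneg (Nat.cast_nonneg (α := ℝ) C) h5
  push_cast
  nlinarith

theorem exists_solvesSelection_two (lam : ℕ) (hlam : 2 < lam) : ∃ C : ℝ, ∀ (p : RamProgram)
    (T : ℕ → ℝ), SolvesSelection p lam T →
      ∃ p₂ : RamProgram, SolvesSelection p₂ 2 (fun n : ℕ => T n + C) := by
  obtain ⟨m, rfl⟩ : ∃ m, lam = m + 2 := ⟨lam - 2, by omega⟩
  refine ⟨(padding m).maxCost, fun p T h => ⟨.seq (padding m) p, fun n I s hI hs => ?_⟩⟩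
  obtain ⟨J, hJ, hans⟩ := padding_step (m := m) hs
  obtain ⟨t, s', he, ht, rfl⟩ := (padding m).runs_step
    (by simp [padding, RamProgram.straight, straight_padRows]) s
  obtain ⟨v, hv⟩ := hI.exists_isAnswer
  obtain ⟨t', s'', he', ht', hans'⟩ := h n J _ ((hans v).2 hv).valid hJ
  refine ⟨t + t', s'', he.seq he', ?_, (hans _).1 hans'⟩
  have : (t : ℝ) ≤ (padding m).maxCost := by exact_mod_cast ht
  push_cast
  linarith

/-- For fixed `lam` the terms `lam log lam` and the padding cost are constants; since `n log n`
tends to infinity, `T` dominates them. -/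
theorem const_isBigO_of_mul_log {T : ℕ → ℝ}
    (hT : (fun n : ℕ => (n : ℝ) * Real.log n) =O[Filter.atTop] T) (c : ℝ) :
    (fun _ : ℕ => c) =O[Filter.atTop] T := by
  refine Asymptotics.IsBigO.trans (Asymptotics.IsLittleO.isBigO ?_) hT
  refine Asymptotics.isLittleO_const_left.2 (.inr ?_)
  refine tendsto_norm_atTop_atTop.comp ?_
  exact tendsto_natCast_atTop_atTop.atTop_mul_atTop₀
    (Real.tendsto_log_atTop.comp tendsto_natCast_atTop_atTop)

theorem theorem8 :
    -- one program reduces an instance with `lam > 2` constraints to a single instance with two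
    -- constraints and the same point sets and objective, in time `O(lam n log n + lam log lam)`
    (∃ (R : RamProgram) (C : ℝ), ∀ (lam : ℕ), 2 < lam →
      ∀ (n : ℕ) (I : SelInstance lam n) (s : RamState), I.Valid → Encodes s I →
        ∃ (t : ℕ) (s' : RamState) (J : SelInstance 2 n),
          Exec R s t s' ∧
          (t : ℝ) ≤ C * ((lam : ℝ) * ((n : ℝ) * Real.log n) + (lam : ℝ) * Real.log lam) ∧
          Encodes s' J ∧ J.P = I.P ∧ J.Q = I.Q ∧ J.f = I.f ∧
          ∃ v : ℝ, I.IsAnswer v ∧ J.IsAnswer v) ∧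
    -- total time `O(lam n log n + lam log lam + T₂(n))`, by one program for all `lam > 2`
    (∃ C : ℝ, ∀ (p₂ : RamProgram) (T₂ : ℕ → ℝ), SolvesSelection p₂ 2 T₂ →
      ∃ p : RamProgram, ∀ (lam : ℕ), 2 < lam →
        SolvesSelection p lam (fun n : ℕ =>
          C * ((lam : ℝ) * ((n : ℝ) * Real.log n) + (lam : ℝ) * Real.log lam + T₂ n))) ∧
    -- conversely, `lam > 2` constraints are at least as hard as two
    (∀ (lam : ℕ), 2 < lam → ∃ C : ℝ, ∀ (p : RamProgram) (T : ℕ → ℝ), SolvesSelection p lam T →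
      ∃ p₂ : RamProgram, SolvesSelection p₂ 2 (fun n : ℕ => T n + C)) ∧
    -- asymptotic equivalence for each fixed `lam > 2`
    (∀ (lam : ℕ), 2 < lam → ∀ T : ℕ → ℝ,
      (fun n : ℕ => (n : ℝ) * Real.log n) =O[Filter.atTop] T →
        (SelectionSolvableIn 2 T ↔ SelectionSolvableIn lam T)) := by
  refine ⟨?_, exists_solvesSelection, exists_solvesSelection_two, fun lam hlam T hT => ⟨?_, ?_⟩⟩
  · obtain ⟨C, hC⟩ := ReduceProgram.runs_reduce
    refine ⟨ReduceProgram.reduce, C * 47, fun lam hlam n I s hI hs => ?_⟩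
    obtain ⟨v, hv⟩ := hI.exists_isAnswer
    obtain ⟨t, s', he, ht, J, hJ, hP, hQ, hf, hJv⟩ := hC lam n I s v hv hs
    refine ⟨t, s', J, he, ?_, hJ, hP, hQ, hf, v, hv, hJv⟩
    rw [mul_assoc]
    exact (by exact_mod_cast ht : (t : ℝ) ≤ C * ReduceProgram.reduceCost lam n).trans
      (mul_le_mul_of_nonneg_left (ReduceProgram.reduceCost_le hlam hI.pos) (Nat.cast_nonneg _))
  · rintro ⟨p₂, τ, hp, hτ⟩
    obtain ⟨C, hC⟩ := exists_solvesSelection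
    obtain ⟨p, h⟩ := hC p₂ τ hp
    exact ⟨p, _, h lam hlam, ((((hT.const_mul_left _).add (const_isBigO_of_mul_log hT _)).add
      hτ).const_mul_left _)⟩
  · rintro ⟨p, τ, hp, hτ⟩
    obtain ⟨C, hC⟩ := exists_solvesSelection_two lam hlam
    obtain ⟨p₂, h⟩ := hC p τ hp
    exact ⟨p₂, _, h, hτ.add (const_isBigO_of_mul_log hT _)⟩
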